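/- Consider the class of nonlinear wave equations $u_{tt}=f(x,u_x)u_{xx}+g(x,u_x)$ for an unknown function $u=u(t,x)$, parameterized by the pair $\theta=(f,g)$ of arbitrary elements. All considerations are local and smooth ($C^\infty$): $f$ and $g$ are smooth functions on an open subset of the space of $(t,x,u,u_t,u_x,u_{tt},u_{tx},u_{xx})$ that is not restricted in the second-order derivatives; they depend only on $x$ and $u_x$ in the sense that $f_t=f_u=f_{u_t}=f_{u_{tt}}=f_{u_{tx}}=f_{u_{xx}}=0$, and similarly for $g$; $f$ vanishes nowhere; and $(f_{u_x},g_{u_xu_x})\neq(0,0)$, meaning that $f_{u_x}$ and $g_{u_xu_x}$ do not both vanish identically on any nonempty open part of the domain. The equation $\mathcal L_\theta$ is regarded as the submanifold $u_{tt}=fu_{xx}+g$ of the second-order jet space over the domain of $\theta$. A point transformation is a smooth diffeomorphism between open subsets of a space. An admissible transformation of a class of such equations is a triple $(\theta,\tilde\theta,\varphi)$, where $\theta,\tilde\theta$ belong to the class and $\varphi$ is a point transformation of the variables $(t,x,u)$, defined over the domain of $\mathcal L_\theta$, whose second prolongation maps $\mathcal L_\theta$ onto $\mathcal L_{\tilde\theta}$.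 The equivalence (pseudo)group of a class consists of the point transformations $\Phi$ of the space of $(t,x,u,u_t,u_x,u_{tt},u_{tx},u_{xx},f,g)$, with domain not restricted in $u_{tt},u_{tx},u_{xx}$, such that $\Phi$ is projectable to a point transformation $\Phi|_{(t,x,u)}$ of $(t,x,u)$, its projection to the jet space is the second prolongation of $\Phi|_{(t,x,u)}$, and, for each $\theta$ of the class whose graph lies in the domain of $\Phi$, $\Phi$ maps the graph of $\theta$ onto the graph of an element $\Phi\theta$ of the class and $\Phi|_{(t,x,u)}$ maps $\mathcal L_\theta$ to $\mathcal L_{\Phi\theta}$. The class is normalized if for each of its admissible transformations $(\theta,\tilde\theta,\varphi)$ there is a $\Phi$ in its equivalence group such that $\tilde\theta=\Phi\theta$ and $\varphi=\Phi|_{(t,x,u)}$ over the domain of $\mathcal L_\theta$. Theorem. Consider the subclass singled out by the constraints $f_{u_x}=0$ and $g_{u_xu_x}\neq0$, where the latter means that $g_{u_xu_x}$ does not vanish identically on any nonempty open part of the domain. (i) The subclass is preserved by the admissible transformations of the entire class: if $(\theta,\tilde\theta,\varphi)$ is an admissible transformation of the class and $\theta$ belongs to the subclass, then so does $\tilde\theta$.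 (ii) The subclass is normalized. (iii) The equivalence group of the subclass coincides with the equivalence group $G^\sim$ of the entire class. -/

import Mathlib

open scoped ContDiff

namespace WaveClass

/-!
Coordinates.
* Space of variables `Fin 3 → ℝ`: `0 ↦ t`, `1 ↦ x`, `2 ↦ u`.
* Second-order jet space `Fin 8 → ℝ`: `0 ↦ t`, `1 ↦ x`, `2 ↦ u`, `3 ↦ u_t`, `4 ↦ u_x`,
  `5 ↦ u_tt`, `6 ↦ u_tx`, `7 ↦ u_xx`.
* Space of jets and arbitrary elements `Fin 10 → ℝ`: the eight jet coordinates,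
  followed by `8 ↦ f`, `9 ↦ g`.
-/

/-- The space of the variables `(t, x, u)`. -/
abbrev Base := Fin 3 → ℝ

/-- The second-order jet space, with coordinates `(t, x, u, u_t, u_x, u_tt, u_tx, u_xx)`. -/
abbrev Jet := Fin 8 → ℝ

/-- The space with coordinates `(t, x, u, u_t, u_x, u_tt, u_tx, u_xx, f, g)`. -/
abbrev Ext := Fin 10 → ℝ

/-- The projection of a jet to the space of variables `(t, x, u)`. -/
def Jet.base (j : Jet) : Base := fun i => j (Fin.castLE (by norm_num) i)

/-- The projection `(t, x, u_(2), f, g) ↦ (t, x, u_(2))`. -/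
def Ext.jet (w : Ext) : Jet := fun i => w (Fin.castLE (by norm_num) i)

/-- The partial derivative with respect to the `i`-th coordinate. -/
noncomputable def pd {n : ℕ} (i : Fin n) (F : (Fin n → ℝ) → ℝ) (z : Fin n → ℝ) : ℝ :=
  fderiv ℝ F z (Pi.single i 1)

/-- `A` is a full cylinder in the directions of the second-order derivatives
`u_tt`, `u_tx`, `u_xx`. -/
def FreeInSecondDerivatives {n : ℕ} (A : Set (Fin n → ℝ)) : Prop :=
  ∀ w ∈ A, ∀ w' : Fin n → ℝ,
    (∀ i : Fin n, (i : ℕ) ∉ ({5, 6, 7} : Finset ℕ) → w' i = w i) → w' ∈ A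

/-- A value `θ = (f, g)` of the tuple of arbitrary elements: two smooth functions on an open
subset of the jet space, which is not restricted in the second-order derivatives.
The auxiliary conditions on `f` and `g` are imposed by the classes below.
The values of `f` and `g` outside `dom` play no role. -/
structure ArbitraryElements where
  dom : Set Jet
  isOpen_dom : IsOpen dom
  free_dom : FreeInSecondDerivatives dom
  f : Jet → ℝ
  g : Jet → ℝ
  smooth_f : ContDiffOn ℝ ∞ f dom
  smooth_g : ContDiffOn ℝ ∞ g dom

namespace ArbitraryElements

/-- The equation `u_tt = f u_xx + g` as a submanifold of the second-order jet space. -/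
def equation (θ : ArbitraryElements) : Set Jet :=
  {j | j ∈ θ.dom ∧ j 5 = θ.f j * j 7 + θ.g j}

/-- The graph of `θ = (f, g)` in the space of `(t, x, u_(2), f, g)`. -/
def graph (θ : ArbitraryElements) : Set Ext :=
  {w | Ext.jet w ∈ θ.dom ∧ w 8 = θ.f (Ext.jet w) ∧ w 9 = θ.g (Ext.jet w)}

end ArbitraryElements

/-- `F` depends at most on `x` and `u_x` in the sense of the auxiliary system
`F_t = F_u = F_{u_t} = F_{u_tt} = F_{u_tx} = F_{u_xx} = 0`. -/
def DependsOnXUx (A : Set Jet) (F : Jet → ℝ) : Prop :=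
  ∀ j ∈ A, pd 0 F j = 0 ∧ pd 2 F j = 0 ∧ pd 3 F j = 0 ∧
    pd 5 F j = 0 ∧ pd 6 F j = 0 ∧ pd 7 F j = 0

/-- The class of the nonlinear equations `u_tt = f(x, u_x) u_xx + g(x, u_x)`: `f` vanishes
nowhere, and `(f_{u_x}, g_{u_x u_x}) ≠ (0, 0)`, i.e. these two functions do not both vanish
identically on any nonempty open part of the domain. -/
def waveClass : Set ArbitraryElements :=
  {θ | DependsOnXUx θ.dom θ.f ∧ DependsOnXUx θ.dom θ.g ∧
    (∀ j ∈ θ.dom, θ.f j ≠ 0) ∧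
    ∀ V : Set Jet, IsOpen V → V ⊆ θ.dom → V.Nonempty →
      ∃ j ∈ V, (pd 4 θ.f j, pd 4 (pd 4 θ.g) j) ≠ (0, 0)}

/-- The subclass singled out by `f_{u_x} = 0` and `g_{u_x u_x} ≠ 0`, where the latter means, as
in the definition of the class, that `g_{u_x u_x}` does not vanish identically on any nonempty
open part of the domain. -/
def waveSubclass : Set ArbitraryElements :=
  {θ | θ ∈ waveClass ∧ (∀ j ∈ θ.dom, pd 4 θ.f j = 0) ∧
    ∀ V : Set Jet, IsOpen V → V ⊆ θ.dom → V.Nonempty → ∃ j ∈ V, pd 4 (pd 4 θ.g) j ≠ 0}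

/-- A (local) point transformation: a diffeomorphism between open subsets. -/
structure PointTransformation (n : ℕ) where
  toMap : OpenPartialHomeomorph (Fin n → ℝ) (Fin n → ℝ)
  smooth : ContDiffOn ℝ ∞ toMap toMap.source
  smooth_symm : ContDiffOn ℝ ∞ toMap.symm toMap.target

/-- The total derivative `D_t F` of a function `F` of `(t, x, u)`. -/
noncomputable def Dt (F : Base → ℝ) (j : Jet) : ℝ :=
  pd 0 F j.base + j 3 * pd 2 F j.base

/-- The total derivative `D_x F` of a function `F` of `(t, x, u)`. -/
noncomputable def Dx (F : Base → ℝ) (j : Jet) : ℝ :=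
  pd 1 F j.base + j 4 * pd 2 F j.base

/-- The total derivative `D_t D_t F` of a function `F` of `(t, x, u)`. -/
noncomputable def Dtt (F : Base → ℝ) (j : Jet) : ℝ :=
  pd 0 (pd 0 F) j.base + 2 * j 3 * pd 0 (pd 2 F) j.base
    + j 3 ^ 2 * pd 2 (pd 2 F) j.base + j 5 * pd 2 F j.base

/-- The total derivative `D_t D_x F` of a function `F` of `(t, x, u)`. -/
noncomputable def Dtx (F : Base → ℝ) (j : Jet) : ℝ :=
  pd 0 (pd 1 F) j.base + j 4 * pd 0 (pd 2 F) j.base + j 3 * pd 1 (pd 2 F) j.base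
    + j 3 * j 4 * pd 2 (pd 2 F) j.base + j 6 * pd 2 F j.base

/-- The total derivative `D_x D_x F` of a function `F` of `(t, x, u)`. -/
noncomputable def Dxx (F : Base → ℝ) (j : Jet) : ℝ :=
  pd 1 (pd 1 F) j.base + 2 * j 4 * pd 1 (pd 2 F) j.base
    + j 4 ^ 2 * pd 2 (pd 2 F) j.base + j 7 * pd 2 F j.base

/-- `j'` is the image of the jet `j` under the second prolongation of the transformation
`φ = (T, X, U)`. The prolongation is defined at `j` if `D_tT D_xX - D_tX D_xT ≠ 0`, and then the
derivatives of `ũ` are the unique solution of the linear equations obtained by applying `D_t`,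
`D_x`, `D_t²`, `D_t D_x` and `D_x²` to `ũ(T, X) = U`. -/
def Prolongs (φ : Base → Base) (j j' : Jet) : Prop :=
  let T : Base → ℝ := fun z => φ z 0
  let X : Base → ℝ := fun z => φ z 1
  let U : Base → ℝ := fun z => φ z 2
  Dt T j * Dx X j - Dt X j * Dx T j ≠ 0 ∧
  j'.base = φ j.base ∧
  Dt U j = j' 3 * Dt T j + j' 4 * Dt X j ∧
  Dx U j = j' 3 * Dx T j + j' 4 * Dx X j ∧
  Dtt U j = j' 5 * Dt T j ^ 2 + 2 * j' 6 * (Dt T j * Dt X j) + j' 7 * Dt X j ^ 2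
    + j' 3 * Dtt T j + j' 4 * Dtt X j ∧
  Dtx U j = j' 5 * (Dt T j * Dx T j) + j' 6 * (Dt T j * Dx X j + Dx T j * Dt X j)
    + j' 7 * (Dt X j * Dx X j) + j' 3 * Dtx T j + j' 4 * Dtx X j ∧
  Dxx U j = j' 5 * Dx T j ^ 2 + 2 * j' 6 * (Dx T j * Dx X j) + j' 7 * Dx X j ^ 2
    + j' 3 * Dxx T j + j' 4 * Dxx X j

/-- `φ` maps the equation with arbitrary elements `θ` to the one with arbitrary elements `θ'`:
`φ` is defined over the domain of `θ`, and its second prolongation maps the submanifold of the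
first equation onto the submanifold of the second one. (Jets of the first equation at which the
prolongation is undefined are disregarded, so that this is the weakest form of the notion.) -/
def MapsEquation (φ : PointTransformation 3) (θ θ' : ArbitraryElements) : Prop :=
  (∀ j ∈ θ.dom, j.base ∈ φ.toMap.source) ∧
  {j' | ∃ j ∈ θ.equation, Prolongs φ.toMap j j'} = θ'.equation

/-- The set of admissible transformations `(θ, θ', φ)` of a class of equations. -/
def admissibleTransformations (S : Set ArbitraryElements) :
    Set (ArbitraryElements × ArbitraryElements × PointTransformation 3) :=
  {τ | τ.1 ∈ S ∧ τ.2.1 ∈ S ∧ MapsEquation τ.2.2 τ.1 τ.2.1}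

/-- `Φ θ = θ'`: `Φ` is defined on the graph of `θ` and maps it onto the graph of `θ'`. -/
def ActsTo (Φ : PointTransformation 10) (θ θ' : ArbitraryElements) : Prop :=
  θ.graph ⊆ Φ.toMap.source ∧ Φ.toMap '' θ.graph = θ'.graph

/-- `Φ` is projectable to the space of `(t, x, u)` with projection `φ = Φ|_(t,x,u)`, and its
projection to the jet space is the second prolongation of `φ`. (As the first-order components of
the prolongation depend only on first-order jets, `Φ` is then also projectable to the spaces of
first- and second-order jets.) -/
def IsContactLiftOf (Φ : PointTransformation 10) (φ : PointTransformation 3) : Prop :=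
  φ.toMap.source = (fun w : Ext => (Ext.jet w).base) '' Φ.toMap.source ∧
  ∀ w ∈ Φ.toMap.source, Prolongs φ.toMap (Ext.jet w) (Ext.jet (Φ.toMap w))

/-- `Φ` is a (usual) equivalence transformation of the class `S`, and `φ = Φ|_(t,x,u)`:
`Φ` is consistent with the contact structure, and whenever it is defined on the graph of an
element `θ` of `S`, it maps `θ` to an element `θ'` of `S`, and its projection `φ` maps the
equation with arbitrary elements `θ` to the one with arbitrary elements `θ'`. -/
def IsEquivalenceTransformation (S : Set ArbitraryElements)
    (Φ : PointTransformation 10) (φ : PointTransformation 3) : Prop :=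
  FreeInSecondDerivatives Φ.toMap.source ∧
  IsContactLiftOf Φ φ ∧
  ∀ θ ∈ S, θ.graph ⊆ Φ.toMap.source →
    ∃ θ' ∈ S, ActsTo Φ θ θ' ∧ MapsEquation φ θ θ'

/-- The (usual) equivalence (pseudo)group of the class `S`. -/
def equivalenceGroup (S : Set ArbitraryElements) : Set (PointTransformation 10) :=
  {Φ | ∃ φ, IsEquivalenceTransformation S Φ φ}

/-- The class `S` is normalized: each admissible transformation `(θ, θ', φ)` is induced by an
equivalence transformation `Φ` of the class, i.e. `Φ θ = θ'`, and `Φ|_(t,x,u)` is `φ` on the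
domain of the variables `(t, x, u)` of the equation. -/
def Normalized (S : Set ArbitraryElements) : Prop :=
  ∀ θ θ' : ArbitraryElements, ∀ φ : PointTransformation 3,
    (θ, θ', φ) ∈ admissibleTransformations S →
    ∃ Φ ∈ equivalenceGroup S, ∃ ψ : PointTransformation 3,
      IsContactLiftOf Φ ψ ∧ ActsTo Φ θ θ' ∧
      Set.EqOn ψ.toMap φ.toMap (Jet.base '' θ.dom)

end WaveClass

/-!
A transformation `φ = (T, X, U)` from the equation of `θ` to that of `θ'` turns `u_tt = f u_xx + g`
into an identity in the free coordinates `u_tx`, `u_xx`. Splitting with respect to them gives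
`f D_xT D_xX = D_tT D_tX`, an expression for the wave speed `f̃`, and an identity for `g̃`. When
`f_{u_x} = 0`, differentiating the first of these along `u_t` and `u_x` gives `T_u = X_u = 0`, and
then `f̃` cannot depend on `ũ_x̃` either.

If moreover `g_{u_xu_x} ≠ 0`, differentiating the identity for `g̃` along `u_t` and `u_x` gives
`T_t T_x g̃_{ũ_x̃ũ_x̃} = 0`, hence `T_t T_x = 0` by continuity. The possibility `T_x ≠ 0` would
force `U_uu = 0` and then `g̃_{ũ_x̃ũ_x̃} = 0`, so `T_x = X_t = 0`, and further splitting leaves only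
the special transformations `T = T(t)` affine, `X = X(x)`, `U = c u + b(t) + a(x)` with `b`
quadratic, for which `f̃ = f X_x² / T_t²` and `g̃ = (U_u g + U_tt - f (U_xx - ũ_x̃ X_xx)) / T_t²`.
These formulas make sense for every `θ`, so each special transformation lifts to an equivalence
transformation of the entire class and of the subclass, and the subclass is normalized. Conversely,
an equivalence transformation of either class projects to a special transformation and agrees with
its lift wherever `f ≠ 0`: it suffices to test it on elements with constant `f` and with `g`
quadratic in `u_x`, which belong to both classes and pass through every such point.
-/

namespace WaveClass

/-- `D` is the partial derivative of `F` at `z` with respect to the `i`-th coordinate. Being a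
derivative along a coordinate line, it can be computed rule by rule without differentiability of
`F`, whereas `pd i F z` is read off the Fréchet derivative. -/
def HasPd {n : ℕ} (i : Fin n) (F : (Fin n → ℝ) → ℝ) (z : Fin n → ℝ) (D : ℝ) : Prop :=
  HasLineDerivAt ℝ F D z (Pi.single i 1)

section Calculus

variable {n : ℕ} {i : Fin n} {F G : (Fin n → ℝ) → ℝ} {A : Set (Fin n → ℝ)} {z : Fin n → ℝ}
  {D E : ℝ}

theorem hasPd_const (c : ℝ) : HasPd i (fun _ => c) z 0 := hasDerivAt_const _ _

theorem hasPd_coord_self : HasPd i (fun y => y i) z 1 := by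
  have h : HasDerivAt (fun s : ℝ => z i + s) 1 0 := (hasDerivAt_id 0).const_add _
  simpa [HasPd, HasLineDerivAt] using h

theorem hasPd_coord_of_ne {k : Fin n} (h : k ≠ i) : HasPd i (fun y => y k) z 0 := by
  simpa [HasPd, HasLineDerivAt, h] using hasDerivAt_const (0 : ℝ) (z k)

theorem HasPd.congr_deriv (h : HasPd i F z D) (e : D = E) : HasPd i F z E := e ▸ h

theorem HasPd.add (hF : HasPd i F z D) (hG : HasPd i G z E) :
    HasPd i (fun y => F y + G y) z (D + E) := HasDerivAt.fun_add hF hG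

theorem HasPd.sub (hF : HasPd i F z D) (hG : HasPd i G z E) :
    HasPd i (fun y => F y - G y) z (D - E) := HasDerivAt.fun_sub hF hG

theorem HasPd.neg (hF : HasPd i F z D) : HasPd i (fun y => -F y) z (-D) := HasDerivAt.fun_neg hF

theorem HasPd.const_mul (c : ℝ) (hF : HasPd i F z D) :
    HasPd i (fun y => c * F y) z (c * D) := HasDerivAt.const_mul c hF

theorem HasPd.mul (hF : HasPd i F z D) (hG : HasPd i G z E) :
    HasPd i (fun y => F y * G y) z (D * G z + F z * E) := by
  simpa [HasPd, HasLineDerivAt] using HasDerivAt.fun_mul hF hG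

theorem HasPd.sq (hF : HasPd i F z D) : HasPd i (fun y => F y ^ 2) z (2 * F z * D) := by
  simpa [HasPd, HasLineDerivAt] using HasDerivAt.fun_pow hF 2

theorem HasPd.div (hF : HasPd i F z D) (hG : HasPd i G z E) (h : G z ≠ 0) :
    HasPd i (fun y => F y / G y) z ((D * G z - F z * E) / G z ^ 2) := by
  simpa [HasPd, HasLineDerivAt] using HasDerivAt.fun_div hF hG (by simpa using h)

theorem HasPd.unique (hF : HasPd i F z D) (hG : HasPd i F z E) : D = E :=
  HasDerivAt.unique hF hG

theorem hasPd_of_differentiableAt (h : DifferentiableAt ℝ F z) : HasPd i F z (pd i F z) :=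
  h.hasFDerivAt.hasLineDerivAt _

theorem HasPd.pd_eq (hF : HasPd i F z D) (h : DifferentiableAt ℝ F z) : pd i F z = D :=
  (hasPd_of_differentiableAt h).unique hF

theorem hasDerivAt_coord_line (i : Fin n) (z : Fin n → ℝ) :
    HasDerivAt (fun s : ℝ => z + s • (Pi.single i 1 : Fin n → ℝ)) (Pi.single i 1) 0 := by
  simpa using ((hasDerivAt_id (0 : ℝ)).smul_const (Pi.single i 1 : Fin n → ℝ)).const_add z

theorem eventually_coord_line_mem (hA : IsOpen A) (hz : z ∈ A) (i : Fin n) :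
    ∀ᶠ s in nhds (0 : ℝ), z + s • (Pi.single i 1 : Fin n → ℝ) ∈ A :=
  (hasDerivAt_coord_line i z).continuousAt.eventually_mem (hA.mem_nhds (by simpa using hz))

theorem exists_coord_line_mem (hA : IsOpen A) (hz : z ∈ A) (i : Fin n) :
    ∃ s : ℝ, s ≠ 0 ∧ z + s • (Pi.single i 1 : Fin n → ℝ) ∈ A := by
  have hne : ∀ᶠ s in nhdsWithin (0 : ℝ) {0}ᶜ, s ≠ 0 := eventually_mem_nhdsWithin
  exact (hne.and ((eventually_coord_line_mem hA hz i).filter_mono nhdsWithin_le_nhds)).exists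

theorem HasPd.congr_of_eqOn (hF : HasPd i F z D) (hA : IsOpen A) (hz : z ∈ A)
    (h : Set.EqOn G F A) : HasPd i G z D :=
  HasDerivAt.congr_of_eventuallyEq hF <|
    (eventually_coord_line_mem hA hz i).mono fun _ hs => h hs

theorem HasPd.eq_of_eqOn (hF : HasPd i F z D) (hG : HasPd i G z E) (hA : IsOpen A) (hz : z ∈ A)
    (h : Set.EqOn F G A) : D = E :=
  hF.unique (hG.congr_of_eqOn hA hz h)

theorem pd_congr (hA : IsOpen A) (hz : z ∈ A) (h : Set.EqOn F G A) (i : Fin n) :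
    pd i F z = pd i G z := by
  simp only [pd, (h.eventuallyEq_of_mem (hA.mem_nhds hz)).fderiv_eq]

theorem pd_eq_zero_of_eqOn (hA : IsOpen A) (hz : z ∈ A) (h : ∀ y ∈ A, F y = 0) (i : Fin n) :
    pd i F z = 0 := by
  rw [pd_congr hA hz (G := fun _ => 0) h i]
  simp [pd]

theorem fderiv_eq_sum (F : (Fin n → ℝ) → ℝ) (z v : Fin n → ℝ) :
    fderiv ℝ F z v = ∑ k, v k * pd k F z := by
  conv_lhs => rw [pi_eq_sum_univ' v, map_sum]
  simp only [map_smul, smul_eq_mul, pd]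

theorem differentiableAt_of_contDiffOn {E' : Type*} [NormedAddCommGroup E'] [NormedSpace ℝ E']
    {F : (Fin n → ℝ) → E'} (hF : ContDiffOn ℝ ∞ F A) (hA : IsOpen A) (hz : z ∈ A) :
    DifferentiableAt ℝ F z :=
  (hF.contDiffAt (hA.mem_nhds hz)).differentiableAt (by simp)

theorem hasPd_of_contDiffOn (hF : ContDiffOn ℝ ∞ F A) (hA : IsOpen A) (hz : z ∈ A) (i : Fin n) :
    HasPd i F z (pd i F z) :=
  hasPd_of_differentiableAt (differentiableAt_of_contDiffOn hF hA hz)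

theorem contDiffOn_pd (hF : ContDiffOn ℝ ∞ F A) (hA : IsOpen A) (i : Fin n) :
    ContDiffOn ℝ ∞ (pd i F) A :=
  (hF.fderiv_of_isOpen hA (by simp)).clm_apply contDiffOn_const

theorem pd_comm (hF : ContDiffOn ℝ ∞ F A) (hA : IsOpen A) (hz : z ∈ A) (i k : Fin n) :
    pd i (pd k F) z = pd k (pd i F) z := by
  have hd : DifferentiableAt ℝ (fderiv ℝ F) z :=
    differentiableAt_of_contDiffOn (hF.fderiv_of_isOpen hA (by simp)) hA hz
  have pd_pd (a b : Fin n) : pd a (pd b F) z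
      = fderiv ℝ (fderiv ℝ F) z (Pi.single a 1) (Pi.single b 1) := by
    unfold pd
    rw [fderiv_clm_apply hd (differentiableAt_const _)]
    simp
  have hsymm : IsSymmSndFDerivAt ℝ F z :=
    (hF.contDiffAt (hA.mem_nhds hz)).isSymmSndFDerivAt <| by
      simpa using WithTop.coe_le_coe.2 (le_top : (2 : ℕ∞) ≤ ⊤)
  rw [pd_pd, pd_pd, hsymm]

end Calculus

section Jets

variable {h : Base → ℝ} {j : Jet} {i : Fin 8} {D : ℝ}

theorem Jet.base_add_single_of_eq_castLE (j : Jet) (s : ℝ) {k : Fin 3}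
    (hi : i = Fin.castLE (by norm_num) k) :
    Jet.base (j + s • Pi.single i 1) = j.base + s • Pi.single k 1 := by
  subst hi; ext l; fin_cases k <;> fin_cases l <;> simp [Jet.base, Fin.ext_iff]

theorem Jet.base_add_single_of_three_le (j : Jet) (s : ℝ) (hi : 3 ≤ (i : ℕ)) :
    Jet.base (j + s • Pi.single i 1) = j.base := by
  ext k
  have hk : Fin.castLE (by norm_num) k ≠ i := fun e => by
    have := congrArg Fin.val e
    simp only [Fin.val_castLE] at this
    omega
  simp [Jet.base, hk]

theorem HasPd.comp_base {k : Fin 3} (H : HasPd k h j.base D)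
    (hi : i = Fin.castLE (by norm_num) k) : HasPd i (fun j : Jet => h j.base) j D := by
  simpa only [HasPd, HasLineDerivAt, Jet.base_add_single_of_eq_castLE _ _ hi] using H

theorem hasPd_comp_base_fiber (h : Base → ℝ) (j : Jet) (hi : 3 ≤ (i : ℕ)) :
    HasPd i (fun j : Jet => h j.base) j 0 := by
  simpa only [HasPd, HasLineDerivAt, Jet.base_add_single_of_three_le j _ hi]
    using hasDerivAt_const (0 : ℝ) (h j.base)

theorem contDiff_base : ContDiff ℝ ∞ Jet.base := by
  rw [contDiff_pi]; intro k; unfold Jet.base; fun_prop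

theorem isOpen_image_base {A : Set Jet} (hA : IsOpen A) : IsOpen (Jet.base '' A) := by
  let L : Jet →L[ℝ] Base :=
    ContinuousLinearMap.pi fun k => ContinuousLinearMap.proj (Fin.castLE (by norm_num) k)
  have hL : Function.Surjective L := by
    intro z
    refine ⟨fun k => if hk : (k : ℕ) < 3 then z ⟨k, hk⟩ else 0, ?_⟩
    ext k
    simp [L]
  exact L.isOpenMap hL A hA

theorem contDiffOn_comp_base {Ω : Set Base} {E : Type*} [NormedAddCommGroup E] [NormedSpace ℝ E]
    {h : Base → E} (H : ContDiffOn ℝ ∞ h Ω) :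
    ContDiffOn ℝ ∞ (fun j : Jet => h j.base) (Jet.base ⁻¹' Ω) :=
  H.comp contDiff_base.contDiffOn fun _ hj => hj

/-- The points `w` and `w'` of a space over the second-order jet space differ at most in the
second-order derivatives; `FreeInSecondDerivatives` is invariance under this relation. -/
def EqOffSecondDerivatives {n : ℕ} (w w' : Fin n → ℝ) : Prop :=
  ∀ i : Fin n, (i : ℕ) ∉ ({5, 6, 7} : Finset ℕ) → w' i = w i

theorem EqOffSecondDerivatives.symm {n : ℕ} {w w' : Fin n → ℝ} (h : EqOffSecondDerivatives w w') :
    EqOffSecondDerivatives w' w := fun i hi => (h i hi).symm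

/-- The jet `j` with its second-order derivatives `(u_tt, u_tx, u_xx)` replaced by `(r, s, t)`. -/
def withSecondDerivatives (j : Jet) (r s t : ℝ) : Jet := ![j 0, j 1, j 2, j 3, j 4, r, s, t]

theorem base_withSecondDerivatives (j : Jet) (r s t : ℝ) :
    (withSecondDerivatives j r s t).base = j.base := by
  ext k; fin_cases k <;> rfl

theorem eqOffSecondDerivatives_withSecondDerivatives (j : Jet) (r s t : ℝ) :
    EqOffSecondDerivatives j (withSecondDerivatives j r s t) := fun i hi => by
  fin_cases i <;> first | rfl | simp at hi

theorem FreeInSecondDerivatives.withSecondDerivatives_mem {A : Set Jet}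
    (hA : FreeInSecondDerivatives A) (hj : j ∈ A) (r s t : ℝ) :
    withSecondDerivatives j r s t ∈ A :=
  hA j hj _ (eqOffSecondDerivatives_withSecondDerivatives j r s t)

end Jets

/-- `F` is a smooth function on `A` depending at most on `x` and `u_x`: the condition that the
wave class imposes on each of its two arbitrary elements. -/
structure IsXUx (A : Set Jet) (F : Jet → ℝ) : Prop where
  smooth : ContDiffOn ℝ ∞ F A
  dep : DependsOnXUx A F

namespace IsXUx

variable {A : Set Jet} {F : Jet → ℝ} {j : Jet}

theorem fderiv_apply (hF : IsXUx A F) (hj : j ∈ A) (v : Jet) :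
    fderiv ℝ F j v = v 1 * pd 1 F j + v 4 * pd 4 F j := by
  obtain ⟨h0, h2, h3, h5, h6, h7⟩ := hF.dep j hj
  rw [fderiv_eq_sum, Fin.sum_univ_eight]
  simp [h0, h2, h3, h5, h6, h7]

theorem pd_four (hF : IsXUx A F) (hA : IsOpen A) : IsXUx A (pd 4 F) := by
  refine ⟨contDiffOn_pd hF.smooth hA 4, fun j hj => ?_⟩
  simp only [fun i => pd_comm hF.smooth hA hj i 4]
  exact ⟨pd_eq_zero_of_eqOn hA hj (fun y hy => (hF.dep y hy).1) 4,
    pd_eq_zero_of_eqOn hA hj (fun y hy => (hF.dep y hy).2.1) 4,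
    pd_eq_zero_of_eqOn hA hj (fun y hy => (hF.dep y hy).2.2.1) 4,
    pd_eq_zero_of_eqOn hA hj (fun y hy => (hF.dep y hy).2.2.2.1) 4,
    pd_eq_zero_of_eqOn hA hj (fun y hy => (hF.dep y hy).2.2.2.2.1) 4,
    pd_eq_zero_of_eqOn hA hj (fun y hy => (hF.dep y hy).2.2.2.2.2) 4⟩

theorem hasPd_comp (hF : IsXUx A F) (hA : IsOpen A) {Ψ : Jet → Jet} {i : Fin 8} {V W : ℝ}
    (hj : Ψ j ∈ A) (hΨ : DifferentiableAt ℝ Ψ j) (h1 : HasPd i (fun j => Ψ j 1) j V)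
    (h4 : HasPd i (fun j => Ψ j 4) j W) :
    HasPd i (fun j => F (Ψ j)) j (V * pd 1 F (Ψ j) + W * pd 4 F (Ψ j)) := by
  have hΨi := hΨ.hasFDerivAt.hasLineDerivAt (Pi.single i 1)
  have hFΨ := ((differentiableAt_of_contDiffOn hF.smooth hA hj).hasFDerivAt.comp j
    hΨ.hasFDerivAt).hasLineDerivAt (Pi.single i 1)
  have hV := h1.unique (hasDerivAt_pi.1 hΨi 1)
  have hW := h4.unique (hasDerivAt_pi.1 hΨi 4)
  rwa [ContinuousLinearMap.comp_apply, hF.fderiv_apply hj, ← hV, ← hW] at hFΨ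

theorem eq_of_eqOffSecondDerivatives (hF : IsXUx A F) (hA : IsOpen A)
    (hfree : FreeInSecondDerivatives A) (hj : j ∈ A) {k : Jet} (h : EqOffSecondDerivatives j k) :
    F k = F j := by
  have hmem (s : ℝ) : j + s • (k - j) ∈ A := hfree j hj _ fun i hi => by simp [h i hi]
  have hderiv (s : ℝ) : HasDerivAt (fun s : ℝ => F (j + s • (k - j))) 0 s := by
    have hline : HasDerivAt (fun s : ℝ => j + s • (k - j)) (k - j) s := by
      simpa using ((hasDerivAt_id s).smul_const (k - j)).const_add j
    have hcomp := (differentiableAt_of_contDiffOn hF.smooth hA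
      (hmem s)).hasFDerivAt.comp_hasDerivAt s hline
    rw [hF.fderiv_apply (hmem s)] at hcomp
    simpa [h 1 (by simp), h 4 (by simp), Function.comp_def] using hcomp
  simpa using is_const_of_deriv_eq_zero (fun s => (hderiv s).differentiableAt)
    (fun s => (hderiv s).deriv) 1 0

end IsXUx

section LinearSystems

variable {K : Type*} [Field K] {a b c d : K}

theorem cramer_two_iff (h : a * d - b * c ≠ 0) (u v p q : K) :
    u = p * a + q * b ∧ v = p * c + q * d ↔
      p = (u * d - v * b) / (a * d - b * c) ∧ q = (v * a - u * c) / (a * d - b * c) := by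
  rw [eq_div_iff h, eq_div_iff h]
  constructor
  · rintro ⟨rfl, rfl⟩; constructor <;> ring
  · rintro ⟨hp, hq⟩
    constructor <;> refine mul_right_cancel₀ h ?_
    · linear_combination (-a) * hp - b * hq
    · linear_combination (-c) * hp - d * hq

/-- The matrix of this system is the symmetric square of the matrix with rows `(a, b)` and
`(c, d)`, hence it is inverted by the symmetric square of the adjugate. -/
theorem cramer_symmetricSquare_iff (h : a * d - b * c ≠ 0) (l m n r s t : K) :
    l = r * a ^ 2 + 2 * s * (a * b) + t * b ^ 2 ∧
      m = r * (a * c) + s * (a * d + c * b) + t * (b * d) ∧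
      n = r * c ^ 2 + 2 * s * (c * d) + t * d ^ 2 ↔
    r = (d ^ 2 * l - 2 * (b * d) * m + b ^ 2 * n) / (a * d - b * c) ^ 2 ∧
      s = (-(c * d) * l + (a * d + b * c) * m - a * b * n) / (a * d - b * c) ^ 2 ∧
      t = (c ^ 2 * l - 2 * (a * c) * m + a ^ 2 * n) / (a * d - b * c) ^ 2 := by
  have h2 := pow_ne_zero 2 h
  rw [eq_div_iff h2, eq_div_iff h2, eq_div_iff h2]
  constructor
  · rintro ⟨rfl, rfl, rfl⟩; refine ⟨?_, ?_, ?_⟩ <;> ring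
  · rintro ⟨hr, hs, ht⟩
    refine ⟨?_, ?_, ?_⟩ <;> refine mul_right_cancel₀ h2 ?_
    · linear_combination (-a ^ 2) * hr - 2 * a * b * hs - b ^ 2 * ht
    · linear_combination (-a * c) * hr - (a * d + c * b) * hs - b * d * ht
    · linear_combination (-c ^ 2) * hr - 2 * c * d * hs - d ^ 2 * ht

end LinearSystems

/-- The `k`-th component of a map of the space of variables. -/
abbrev component {n : ℕ} (φ : (Fin n → ℝ) → Fin n → ℝ) (k : Fin n) : (Fin n → ℝ) → ℝ :=
  fun z => φ z k

section Prolongation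

variable (φ : Base → Base) (j : Jet)

/-- The total Jacobian `D_tT D_xX - D_tX D_xT` of `φ = (T, X, U)`. -/
noncomputable def totalJacobian : ℝ :=
  Dt (component φ 0) j * Dx (component φ 1) j - Dt (component φ 1) j * Dx (component φ 0) j

/-- The component `ũ_t̃` of the first prolongation of `φ`. -/
noncomputable def prolongUt : ℝ :=
  (Dt (component φ 2) j * Dx (component φ 1) j - Dx (component φ 2) j * Dt (component φ 1) j)
    / totalJacobian φ j

/-- The component `ũ_x̃` of the first prolongation of `φ`. -/
noncomputable def prolongUx : ℝ :=
  (Dx (component φ 2) j * Dt (component φ 0) j - Dt (component φ 2) j * Dx (component φ 0) j)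
    / totalJacobian φ j

/-- The first prolongation of `φ`, as a second-order jet with vanishing second-order
derivatives. -/
noncomputable def firstProlongation : Jet :=
  ![component φ 0 j.base, component φ 1 j.base, component φ 2 j.base,
    prolongUt φ j, prolongUx φ j, 0, 0, 0]

/-- `D_t²U - ũ_t̃ D_t²T - ũ_x̃ D_t²X`, the part of `D_t²(ũ(T, X) = U)` to be matched by the
second-order derivatives of `ũ`. -/
noncomputable def residualTT : ℝ :=
  Dtt (component φ 2) j - prolongUt φ j * Dtt (component φ 0) j
    - prolongUx φ j * Dtt (component φ 1) j

/-- The analogue of `residualTT` for `D_t D_x`. -/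
noncomputable def residualTX : ℝ :=
  Dtx (component φ 2) j - prolongUt φ j * Dtx (component φ 0) j
    - prolongUx φ j * Dtx (component φ 1) j

/-- The analogue of `residualTT` for `D_x²`. -/
noncomputable def residualXX : ℝ :=
  Dxx (component φ 2) j - prolongUt φ j * Dxx (component φ 0) j
    - prolongUx φ j * Dxx (component φ 1) j

/-- `U_u - ũ_t̃ T_u - ũ_x̃ X_u`: the coefficient of `u_tt`, `u_tx`, `u_xx` in `residualTT`,
`residualTX`, `residualXX`. -/
noncomputable def residualSlope : ℝ :=
  pd 2 (component φ 2) j.base - prolongUt φ j * pd 2 (component φ 0) j.base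
    - prolongUx φ j * pd 2 (component φ 1) j.base

/-- The second prolongation of `φ`, with junk values where the total Jacobian vanishes. -/
noncomputable def secondProlongation : Jet :=
  withSecondDerivatives (firstProlongation φ j)
    ((Dx (component φ 1) j ^ 2 * residualTT φ j
      - 2 * (Dt (component φ 1) j * Dx (component φ 1) j) * residualTX φ j
      + Dt (component φ 1) j ^ 2 * residualXX φ j) / totalJacobian φ j ^ 2)
    ((-(Dx (component φ 0) j * Dx (component φ 1) j) * residualTT φ j
      + (Dt (component φ 0) j * Dx (component φ 1) j
        + Dt (component φ 1) j * Dx (component φ 0) j) * residualTX φ j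
      - Dt (component φ 0) j * Dt (component φ 1) j * residualXX φ j) / totalJacobian φ j ^ 2)
    ((Dx (component φ 0) j ^ 2 * residualTT φ j
      - 2 * (Dt (component φ 0) j * Dx (component φ 0) j) * residualTX φ j
      + Dt (component φ 0) j ^ 2 * residualXX φ j) / totalJacobian φ j ^ 2)

variable {φ j}

theorem Jet.ext_iff_base {j j' : Jet} : j' = j ↔ j'.base = j.base ∧ (j' 3 = j 3 ∧ j' 4 = j 4) ∧
    j' 5 = j 5 ∧ j' 6 = j 6 ∧ j' 7 = j 7 := by
  refine ⟨fun h => by simp [h], fun ⟨h, ⟨h3, h4⟩, h5, h6, h7⟩ => ?_⟩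
  ext k
  fin_cases k
  exacts [congrFun h 0, congrFun h 1, congrFun h 2, h3, h4, h5, h6, h7]

theorem base_secondProlongation : (secondProlongation φ j).base = φ j.base := by
  ext k; fin_cases k <;> rfl

theorem prolongs_iff {j' : Jet} :
    Prolongs φ j j' ↔ totalJacobian φ j ≠ 0 ∧ j' = secondProlongation φ j := by
  rw [Jet.ext_iff_base, base_secondProlongation]
  refine and_congr_right fun hΔ => and_congr_right fun _ => ?_
  rw [← and_assoc (a := Dt _ j = _)]
  refine (and_congr_left' (cramer_two_iff hΔ _ _ _ _)).trans (and_congr_right fun h => ?_)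
  have hUt : j' 3 = prolongUt φ j := h.1
  have hUx : j' 4 = prolongUx φ j := h.2
  rw [hUt, hUx]
  refine Iff.trans ?_ (cramer_symmetricSquare_iff hΔ (residualTT φ j) (residualTX φ j)
    (residualXX φ j) _ _ _)
  unfold residualTT residualTX residualXX
  refine and_congr ?_ (and_congr ?_ ?_) <;> constructor <;> intro h <;> linear_combination h

theorem eqOffSecondDerivatives_secondProlongation :
    EqOffSecondDerivatives (firstProlongation φ j) (secondProlongation φ j) :=
  eqOffSecondDerivatives_withSecondDerivatives _ _ _ _

section WithSecondDerivatives

variable (F : Base → ℝ) (r s t : ℝ)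

theorem Dt_withSecondDerivatives : Dt F (withSecondDerivatives j r s t) = Dt F j := by
  simp only [Dt, base_withSecondDerivatives]; rfl

theorem Dx_withSecondDerivatives : Dx F (withSecondDerivatives j r s t) = Dx F j := by
  simp only [Dx, base_withSecondDerivatives]; rfl

theorem totalJacobian_withSecondDerivatives :
    totalJacobian φ (withSecondDerivatives j r s t) = totalJacobian φ j := by
  simp only [totalJacobian, Dt_withSecondDerivatives, Dx_withSecondDerivatives]

theorem prolongUt_withSecondDerivatives :
    prolongUt φ (withSecondDerivatives j r s t) = prolongUt φ j := by
  simp only [prolongUt, Dt_withSecondDerivatives, Dx_withSecondDerivatives,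
    totalJacobian_withSecondDerivatives]

theorem prolongUx_withSecondDerivatives :
    prolongUx φ (withSecondDerivatives j r s t) = prolongUx φ j := by
  simp only [prolongUx, Dt_withSecondDerivatives, Dx_withSecondDerivatives,
    totalJacobian_withSecondDerivatives]

theorem firstProlongation_withSecondDerivatives :
    firstProlongation φ (withSecondDerivatives j r s t) = firstProlongation φ j := by
  simp only [firstProlongation, base_withSecondDerivatives, prolongUt_withSecondDerivatives,
    prolongUx_withSecondDerivatives]

theorem residualTT_withSecondDerivatives :
    residualTT φ (withSecondDerivatives j r s t)
      = residualTT φ (withSecondDerivatives j 0 0 0) + residualSlope φ j * r := by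
  simp only [residualTT, prolongUt_withSecondDerivatives, prolongUx_withSecondDerivatives, Dtt,
    base_withSecondDerivatives, residualSlope]
  simp only [withSecondDerivatives, Matrix.cons_val]
  ring

theorem residualTX_withSecondDerivatives :
    residualTX φ (withSecondDerivatives j r s t)
      = residualTX φ (withSecondDerivatives j 0 0 0) + residualSlope φ j * s := by
  simp only [residualTX, prolongUt_withSecondDerivatives, prolongUx_withSecondDerivatives, Dtx,
    base_withSecondDerivatives, residualSlope]
  simp only [withSecondDerivatives, Matrix.cons_val]
  ring

theorem residualXX_withSecondDerivatives :
    residualXX φ (withSecondDerivatives j r s t)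
      = residualXX φ (withSecondDerivatives j 0 0 0) + residualSlope φ j * t := by
  simp only [residualXX, prolongUt_withSecondDerivatives, prolongUx_withSecondDerivatives, Dxx,
    base_withSecondDerivatives, residualSlope]
  simp only [withSecondDerivatives, Matrix.cons_val]
  ring

end WithSecondDerivatives

end Prolongation

/-- The Jacobian matrix of a map `φ`; the row index is the variable of differentiation. -/
noncomputable def jacobianMatrix {n : ℕ} (φ : (Fin n → ℝ) → Fin n → ℝ) (z : Fin n → ℝ) :
    Matrix (Fin n) (Fin n) ℝ :=
  Matrix.of fun i k => pd i (component φ k) z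

theorem residualSlope_mul_totalJacobian {φ : Base → Base} {j : Jet}
    (hΔ : totalJacobian φ j ≠ 0) :
    residualSlope φ j * totalJacobian φ j = (jacobianMatrix φ j.base).det := by
  have hUt : prolongUt φ j * totalJacobian φ j = _ := div_mul_cancel₀ _ hΔ
  have hUx : prolongUx φ j * totalJacobian φ j = _ := div_mul_cancel₀ _ hΔ
  rw [residualSlope, sub_mul, sub_mul, mul_right_comm, mul_right_comm _ _ (totalJacobian _ _),
    hUt, hUx, Matrix.det_fin_three]
  simp only [totalJacobian, Dt, Dx, jacobianMatrix, Matrix.of_apply]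
  ring

namespace PointTransformation

theorem contDiffOn_component {n : ℕ} (φ : PointTransformation n) (k : Fin n) :
    ContDiffOn ℝ ∞ (component φ.toMap k) φ.toMap.source :=
  contDiffOn_pi.1 φ.smooth k

theorem det_jacobianMatrix_ne_zero {n : ℕ} (φ : PointTransformation n) {z : Fin n → ℝ}
    (hz : z ∈ φ.toMap.source) : (jacobianMatrix φ.toMap z).det ≠ 0 := by
  have hφ := differentiableAt_of_contDiffOn φ.smooth φ.toMap.open_source hz
  have hψ := differentiableAt_of_contDiffOn φ.smooth_symm φ.toMap.open_target
    (φ.toMap.map_source hz)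
  have hcomp : (fderiv ℝ φ.toMap.symm (φ.toMap z)).comp (fderiv ℝ φ.toMap z)
      = ContinuousLinearMap.id ℝ (Fin n → ℝ) := by
    rw [← fderiv_comp z hψ hφ, ← fderiv_id (𝕜 := ℝ) (x := z)]
    exact (φ.toMap.leftInvOn.eqOn.eventuallyEq_of_mem
      (φ.toMap.open_source.mem_nhds hz)).fderiv_eq
  have htranspose : (jacobianMatrix φ.toMap z).transpose
      = LinearMap.toMatrix' (fderiv ℝ φ.toMap z : (Fin n → ℝ) →ₗ[ℝ] Fin n → ℝ) := by
    ext k i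
    have hk := hasFDerivAt_pi'.1 hφ.hasFDerivAt k
    simp [jacobianMatrix, pd, LinearMap.toMatrix'_apply, hk.fderiv]
  have hinv : LinearMap.toMatrix' (fderiv ℝ φ.toMap.symm (φ.toMap z) :
      (Fin n → ℝ) →ₗ[ℝ] Fin n → ℝ) * (jacobianMatrix φ.toMap z).transpose = 1 := by
    rw [htranspose, ← LinearMap.toMatrix'_comp, ← ContinuousLinearMap.toLinearMap_comp, hcomp,
      ContinuousLinearMap.coe_id, LinearMap.toMatrix'_id]
  rw [← Matrix.det_transpose]
  exact Matrix.det_ne_zero_of_left_inverse hinv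

variable (φ : PointTransformation 3)

/-- The component `T` of the transformation `(t, x, u) ↦ (T, X, U)`. -/
abbrev T : Base → ℝ := component φ.toMap 0

/-- The component `X` of the transformation `(t, x, u) ↦ (T, X, U)`. -/
abbrev X : Base → ℝ := component φ.toMap 1

/-- The component `U` of the transformation `(t, x, u) ↦ (T, X, U)`. -/
abbrev U : Base → ℝ := component φ.toMap 2

theorem residualSlope_ne_zero {j : Jet} (hj : j.base ∈ φ.toMap.source)
    (hΔ : totalJacobian φ.toMap j ≠ 0) : residualSlope φ.toMap j ≠ 0 :=
  left_ne_zero_of_mul <|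
    (residualSlope_mul_totalJacobian hΔ).trans_ne (φ.det_jacobianMatrix_ne_zero hj)

end PointTransformation

section ArbitraryElements

variable {θ : ArbitraryElements} {j : Jet}

theorem isXUx_f (h : θ ∈ waveClass) : IsXUx θ.dom θ.f := ⟨θ.smooth_f, h.1⟩

theorem isXUx_g (h : θ ∈ waveClass) : IsXUx θ.dom θ.g := ⟨θ.smooth_g, h.2.1⟩

theorem IsXUx.withSecondDerivatives_eq {F : Jet → ℝ} (hF : IsXUx θ.dom F) (hj : j ∈ θ.dom)
    (r s t : ℝ) : F (withSecondDerivatives j r s t) = F j :=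
  hF.eq_of_eqOffSecondDerivatives θ.isOpen_dom θ.free_dom hj
    (eqOffSecondDerivatives_withSecondDerivatives j r s t)

theorem withSecondDerivatives_mem_equation (h : θ ∈ waveClass) (hj : j ∈ θ.dom) (s t : ℝ) :
    withSecondDerivatives j (θ.f j * t + θ.g j) s t ∈ θ.equation := by
  refine ⟨θ.free_dom.withSecondDerivatives_mem hj _ _ _, ?_⟩
  rw [(isXUx_f h).withSecondDerivatives_eq hj, (isXUx_g h).withSecondDerivatives_eq hj]
  rfl

end ArbitraryElements

namespace MapsEquation

variable {θ θ' : ArbitraryElements} {φ : PointTransformation 3} {j : Jet}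

theorem secondProlongation_mem (hm : MapsEquation φ θ θ') (hθ : θ ∈ waveClass) (hj : j ∈ θ.dom)
    (hΔ : totalJacobian φ.toMap j ≠ 0) (s t : ℝ) :
    secondProlongation φ.toMap (withSecondDerivatives j (θ.f j * t + θ.g j) s t)
      ∈ θ'.equation :=
  hm.2 ▸ ⟨_, withSecondDerivatives_mem_equation hθ hj s t,
    prolongs_iff.2 ⟨by rwa [totalJacobian_withSecondDerivatives], rfl⟩⟩

theorem firstProlongation_mem (hm : MapsEquation φ θ θ') (hθ : θ ∈ waveClass) (hj : j ∈ θ.dom)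
    (hΔ : totalJacobian φ.toMap j ≠ 0) : firstProlongation φ.toMap j ∈ θ'.dom := by
  have hmem := (hm.secondProlongation_mem hθ hj hΔ 0 0).1
  rw [← firstProlongation_withSecondDerivatives]
  exact θ'.free_dom _ hmem _ eqOffSecondDerivatives_secondProlongation.symm

theorem exists_preimage (hm : MapsEquation φ θ θ') (hθ' : θ' ∈ waveClass)
    {j' : Jet} (hj' : j' ∈ θ'.dom) :
    ∃ j ∈ θ.dom, totalJacobian φ.toMap j ≠ 0 ∧
      EqOffSecondDerivatives (firstProlongation φ.toMap j) j' := by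
  obtain ⟨j, hj, hp⟩ := hm.2.ge (withSecondDerivatives_mem_equation hθ' hj' 0 0)
  obtain ⟨hΔ, e⟩ := prolongs_iff.1 hp
  refine ⟨j, hj.1, hΔ, fun i hi => ?_⟩
  rw [← eqOffSecondDerivatives_secondProlongation i hi, ← e,
    eqOffSecondDerivatives_withSecondDerivatives _ _ _ _ i hi]

/-- The image of `u_tt = f u_xx + g` satisfies the transformed equation. Here `u_tx = s` and
`u_xx = t` are free, so that the coefficients can be split. -/
theorem equation_identity (hm : MapsEquation φ θ θ') (hθ : θ ∈ waveClass) (hθ' : θ' ∈ waveClass)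
    (hj : j ∈ θ.dom) (hΔ : totalJacobian φ.toMap j ≠ 0) (s t : ℝ) :
    Dx φ.X j ^ 2 * (residualTT φ.toMap (withSecondDerivatives j 0 0 0)
          + residualSlope φ.toMap j * (θ.f j * t + θ.g j))
        - 2 * (Dt φ.X j * Dx φ.X j) * (residualTX φ.toMap (withSecondDerivatives j 0 0 0)
          + residualSlope φ.toMap j * s)
        + Dt φ.X j ^ 2 * (residualXX φ.toMap (withSecondDerivatives j 0 0 0)
          + residualSlope φ.toMap j * t)
      = θ'.f (firstProlongation φ.toMap j) *
        (Dx φ.T j ^ 2 * (residualTT φ.toMap (withSecondDerivatives j 0 0 0)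
            + residualSlope φ.toMap j * (θ.f j * t + θ.g j))
          - 2 * (Dt φ.T j * Dx φ.T j) * (residualTX φ.toMap (withSecondDerivatives j 0 0 0)
            + residualSlope φ.toMap j * s)
          + Dt φ.T j ^ 2 * (residualXX φ.toMap (withSecondDerivatives j 0 0 0)
            + residualSlope φ.toMap j * t))
        + θ'.g (firstProlongation φ.toMap j) * totalJacobian φ.toMap j ^ 2 := by
  have hmem := hm.firstProlongation_mem hθ hj hΔ
  have hΔ2 := pow_ne_zero 2 hΔ
  have heq := (hm.secondProlongation_mem hθ hj hΔ s t).2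
  rw [secondProlongation, firstProlongation_withSecondDerivatives,
    (isXUx_f hθ').withSecondDerivatives_eq hmem, (isXUx_g hθ').withSecondDerivatives_eq hmem]
    at heq
  simp only [residualTT_withSecondDerivatives (r := θ.f j * t + θ.g j),
    residualTX_withSecondDerivatives (s := s), residualXX_withSecondDerivatives (t := t),
    Dt_withSecondDerivatives, Dx_withSecondDerivatives,
    totalJacobian_withSecondDerivatives] at heq
  change _ / _ = θ'.f (firstProlongation φ.toMap j) * (_ / _) + _ at heq
  rwa [div_eq_iff hΔ2, add_mul, mul_assoc (θ'.f _), div_mul_cancel₀ _ hΔ2] at heq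

theorem coeff_u_tx (hm : MapsEquation φ θ θ') (hθ : θ ∈ waveClass) (hθ' : θ' ∈ waveClass)
    (hj : j ∈ θ.dom) (hΔ : totalJacobian φ.toMap j ≠ 0) :
    Dt φ.X j * Dx φ.X j = θ'.f (firstProlongation φ.toMap j) * (Dt φ.T j * Dx φ.T j) := by
  have key := hm.equation_identity hθ hθ' hj hΔ
  refine mul_left_cancel₀ (φ.residualSlope_ne_zero (hm.1 j hj) hΔ) ?_
  linear_combination (key 0 0 - key 1 0) / 2

theorem coeff_u_xx (hm : MapsEquation φ θ θ') (hθ : θ ∈ waveClass) (hθ' : θ' ∈ waveClass)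
    (hj : j ∈ θ.dom) (hΔ : totalJacobian φ.toMap j ≠ 0) :
    Dx φ.X j ^ 2 * θ.f j + Dt φ.X j ^ 2
      = θ'.f (firstProlongation φ.toMap j) * (Dx φ.T j ^ 2 * θ.f j + Dt φ.T j ^ 2) := by
  have key := hm.equation_identity hθ hθ' hj hΔ
  refine mul_left_cancel₀ (φ.residualSlope_ne_zero (hm.1 j hj) hΔ) ?_
  linear_combination key 0 1 - key 0 0

theorem coeff_one (hm : MapsEquation φ θ θ') (hθ : θ ∈ waveClass) (hθ' : θ' ∈ waveClass)
    (hj : j ∈ θ.dom) (hΔ : totalJacobian φ.toMap j ≠ 0) :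
    (Dx φ.X j ^ 2 - θ'.f (firstProlongation φ.toMap j) * Dx φ.T j ^ 2)
        * (residualSlope φ.toMap j * θ.g j + residualTT φ.toMap (withSecondDerivatives j 0 0 0))
      + (Dt φ.X j ^ 2 - θ'.f (firstProlongation φ.toMap j) * Dt φ.T j ^ 2)
        * residualXX φ.toMap (withSecondDerivatives j 0 0 0)
      = totalJacobian φ.toMap j ^ 2 * θ'.g (firstProlongation φ.toMap j) := by
  linear_combination hm.equation_identity hθ hθ' hj hΔ 0 0
    + 2 * residualTX φ.toMap (withSecondDerivatives j 0 0 0) * hm.coeff_u_tx hθ hθ' hj hΔ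

end MapsEquation

section TotalDerivatives

variable (F : Base → ℝ) (j : Jet)

theorem hasPd_three_Dt : HasPd 3 (Dt F) j (pd 2 F j.base) :=
  ((hasPd_comp_base_fiber (pd 0 F) j (by simp)).add
    (hasPd_coord_self.mul (hasPd_comp_base_fiber (pd 2 F) j (by simp)))).congr_deriv (by ring)

theorem hasPd_three_Dx : HasPd 3 (Dx F) j 0 :=
  ((hasPd_comp_base_fiber (pd 1 F) j (by simp)).add ((hasPd_coord_of_ne (by decide)).mul
    (hasPd_comp_base_fiber (pd 2 F) j (by simp)))).congr_deriv (by ring)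

theorem hasPd_four_Dx : HasPd 4 (Dx F) j (pd 2 F j.base) :=
  ((hasPd_comp_base_fiber (pd 1 F) j (by simp)).add
    (hasPd_coord_self.mul (hasPd_comp_base_fiber (pd 2 F) j (by simp)))).congr_deriv (by ring)

theorem hasPd_four_Dt : HasPd 4 (Dt F) j 0 :=
  ((hasPd_comp_base_fiber (pd 0 F) j (by simp)).add ((hasPd_coord_of_ne (by decide)).mul
    (hasPd_comp_base_fiber (pd 2 F) j (by simp)))).congr_deriv (by ring)

variable {F} {Ω : Set Base}

theorem contDiffOn_Dt (hΩ : IsOpen Ω) (hF : ContDiffOn ℝ ∞ F Ω) :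
    ContDiffOn ℝ ∞ (Dt F) (Jet.base ⁻¹' Ω) :=
  (contDiffOn_comp_base (contDiffOn_pd hF hΩ 0)).add
    ((contDiff_apply ℝ ℝ 3).contDiffOn.mul (contDiffOn_comp_base (contDiffOn_pd hF hΩ 2)))

theorem contDiffOn_Dx (hΩ : IsOpen Ω) (hF : ContDiffOn ℝ ∞ F Ω) :
    ContDiffOn ℝ ∞ (Dx F) (Jet.base ⁻¹' Ω) :=
  (contDiffOn_comp_base (contDiffOn_pd hF hΩ 1)).add
    ((contDiff_apply ℝ ℝ 4).contDiffOn.mul (contDiffOn_comp_base (contDiffOn_pd hF hΩ 2)))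

end TotalDerivatives

namespace PointTransformation

variable (φ : PointTransformation 3) {j : Jet}

theorem contDiffOn_totalJacobian :
    ContDiffOn ℝ ∞ (totalJacobian φ.toMap) (Jet.base ⁻¹' φ.toMap.source) := by
  have hT (k : Fin 3) := contDiffOn_Dt φ.toMap.open_source (φ.contDiffOn_component k)
  have hX (k : Fin 3) := contDiffOn_Dx φ.toMap.open_source (φ.contDiffOn_component k)
  exact ((hT 0).mul (hX 1)).sub ((hT 1).mul (hX 0))

/-- The set of jets at which the prolongation of `φ` is defined. -/
def prolongationDomain : Set Jet := {j | j.base ∈ φ.toMap.source ∧ totalJacobian φ.toMap j ≠ 0}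

theorem isOpen_prolongationDomain : IsOpen φ.prolongationDomain :=
  φ.contDiffOn_totalJacobian.continuousOn.isOpen_inter_preimage
    (φ.toMap.open_source.preimage contDiff_base.continuous) isOpen_ne

theorem contDiffOn_firstProlongation :
    ContDiffOn ℝ ∞ (firstProlongation φ.toMap) φ.prolongationDomain := by
  have hsub : φ.prolongationDomain ⊆ Jet.base ⁻¹' φ.toMap.source := fun j hj => hj.1
  have hφ (k : Fin 3) := (contDiffOn_comp_base (φ.contDiffOn_component k)).mono hsub
  have hT (k : Fin 3) :=
    (contDiffOn_Dt φ.toMap.open_source (φ.contDiffOn_component k)).mono hsub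
  have hX (k : Fin 3) :=
    (contDiffOn_Dx φ.toMap.open_source (φ.contDiffOn_component k)).mono hsub
  have hΔ := φ.contDiffOn_totalJacobian.mono hsub
  rw [contDiffOn_pi]
  intro k
  fin_cases k
  · exact hφ 0
  · exact hφ 1
  · exact hφ 2
  · exact (((hT 2).mul (hX 1)).sub ((hX 2).mul (hT 1))).div hΔ fun j hj => hj.2
  · exact (((hX 2).mul (hT 0)).sub ((hT 2).mul (hX 0))).div hΔ fun j hj => hj.2
  all_goals exact contDiffOn_const

/-- The total Jacobian is affine in `(u_t, u_x)`, and its coefficients are `2 × 2` minors of the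
Jacobian matrix that cannot all vanish. -/
theorem exists_totalJacobian_ne_zero {A : Set Jet} (hA : IsOpen A) (hjA : j ∈ A)
    (hj : j.base ∈ φ.toMap.source) :
    ∃ k ∈ A, k.base = j.base ∧ totalJacobian φ.toMap k ≠ 0 := by
  by_contra! hzero
  have h0 := hzero j hjA rfl
  obtain ⟨s, hs, hsA⟩ := exists_coord_line_mem hA hjA 3
  obtain ⟨t, ht, htA⟩ := exists_coord_line_mem hA hjA 4
  have hs_base := j.base_add_single_of_three_le s (i := 3) (by simp)
  have ht_base := j.base_add_single_of_three_le t (i := 4) (by simp)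
  have h3 := hzero _ hsA hs_base
  have h4 := hzero _ htA ht_base
  simp only [totalJacobian, Dt, Dx, hs_base, ht_base] at h0 h3 h4
  simp only [Pi.add_apply, Pi.smul_apply, smul_eq_mul, Pi.single_eq_same,
    Pi.single_eq_of_ne (show (4 : Fin 8) ≠ 3 by decide),
    Pi.single_eq_of_ne (show (3 : Fin 8) ≠ 4 by decide), mul_one, mul_zero, add_zero] at h3 h4
  have coeff_u_t : pd 2 φ.T j.base * pd 1 φ.X j.base - pd 2 φ.X j.base * pd 1 φ.T j.base = 0 :=
    mul_left_cancel₀ hs (by linear_combination h3 - h0)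
  have coeff_u_x : pd 0 φ.T j.base * pd 2 φ.X j.base - pd 0 φ.X j.base * pd 2 φ.T j.base = 0 :=
    mul_left_cancel₀ ht (by linear_combination h4 - h0)
  refine φ.det_jacobianMatrix_ne_zero hj ?_
  simp only [Matrix.det_fin_three, jacobianMatrix, Matrix.of_apply]
  linear_combination pd 2 φ.U j.base * (h0 - j 3 * coeff_u_t - j 4 * coeff_u_x)
    - pd 1 φ.U j.base * coeff_u_x - pd 0 φ.U j.base * coeff_u_t

/-- `T_u = X_u = 0` at `z`: to first order, `φ` is projectable to the space of `(t, x)`. -/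
structure IsProjectableAt (z : Base) : Prop where
  T_u : pd 2 φ.T z = 0
  X_u : pd 2 φ.X z = 0

end PointTransformation

section Projectable

open PointTransformation

variable {φ : PointTransformation 3} {j : Jet} {F : Base → ℝ}

theorem Dt_of_pd_two_eq_zero (h : pd 2 F j.base = 0) : Dt F j = pd 0 F j.base := by
  rw [Dt, h, mul_zero, add_zero]

theorem Dx_of_pd_two_eq_zero (h : pd 2 F j.base = 0) : Dx F j = pd 1 F j.base := by
  rw [Dx, h, mul_zero, add_zero]

namespace PointTransformation.IsProjectableAt

theorem totalJacobian_eq (h : φ.IsProjectableAt j.base) : totalJacobian φ.toMap j =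
    pd 0 φ.T j.base * pd 1 φ.X j.base - pd 0 φ.X j.base * pd 1 φ.T j.base := by
  rw [totalJacobian, Dt_of_pd_two_eq_zero h.T_u, Dt_of_pd_two_eq_zero h.X_u,
    Dx_of_pd_two_eq_zero h.T_u, Dx_of_pd_two_eq_zero h.X_u]

theorem totalJacobian_mul_U_u_ne_zero (h : φ.IsProjectableAt j.base)
    (hj : j.base ∈ φ.toMap.source) : totalJacobian φ.toMap j * pd 2 φ.U j.base ≠ 0 := by
  intro h0
  refine φ.det_jacobianMatrix_ne_zero hj ?_
  rw [h.totalJacobian_eq] at h0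
  simp only [Matrix.det_fin_three, jacobianMatrix, Matrix.of_apply, h.T_u, h.X_u]
  linear_combination h0

theorem mem_prolongationDomain (h : φ.IsProjectableAt j.base) (hj : j.base ∈ φ.toMap.source) :
    j ∈ φ.prolongationDomain :=
  ⟨hj, left_ne_zero_of_mul (h.totalJacobian_mul_U_u_ne_zero hj)⟩

theorem U_u_ne_zero (h : φ.IsProjectableAt j.base) (hj : j.base ∈ φ.toMap.source) :
    pd 2 φ.U j.base ≠ 0 :=
  right_ne_zero_of_mul (h.totalJacobian_mul_U_u_ne_zero hj)

theorem hasPd_three_totalJacobian (h : φ.IsProjectableAt j.base) :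
    HasPd 3 (totalJacobian φ.toMap) j 0 :=
  (((hasPd_three_Dt φ.T j).mul (hasPd_three_Dx φ.X j)).sub
    ((hasPd_three_Dt φ.X j).mul (hasPd_three_Dx φ.T j))).congr_deriv
    (by rw [h.T_u, h.X_u]; ring)

theorem hasPd_four_totalJacobian (h : φ.IsProjectableAt j.base) :
    HasPd 4 (totalJacobian φ.toMap) j 0 :=
  (((hasPd_four_Dt φ.T j).mul (hasPd_four_Dx φ.X j)).sub
    ((hasPd_four_Dt φ.X j).mul (hasPd_four_Dx φ.T j))).congr_deriv
    (by rw [h.T_u, h.X_u]; ring)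

theorem hasPd_three_prolongUt (h : φ.IsProjectableAt j.base) (hj : j ∈ φ.prolongationDomain) :
    HasPd 3 (prolongUt φ.toMap) j
      (pd 2 φ.U j.base * pd 1 φ.X j.base / totalJacobian φ.toMap j) := by
  have hΔ := hj.2
  refine ((((hasPd_three_Dt φ.U j).mul (hasPd_three_Dx φ.X j)).sub
    ((hasPd_three_Dx φ.U j).mul (hasPd_three_Dt φ.X j))).div
    h.hasPd_three_totalJacobian hΔ).congr_deriv ?_
  rw [h.X_u, Dx_of_pd_two_eq_zero h.X_u]; field_simp; ring

theorem hasPd_four_prolongUt (h : φ.IsProjectableAt j.base) (hj : j ∈ φ.prolongationDomain) :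
    HasPd 4 (prolongUt φ.toMap) j
      (-(pd 2 φ.U j.base * pd 0 φ.X j.base) / totalJacobian φ.toMap j) := by
  have hΔ := hj.2
  refine ((((hasPd_four_Dt φ.U j).mul (hasPd_four_Dx φ.X j)).sub
    ((hasPd_four_Dx φ.U j).mul (hasPd_four_Dt φ.X j))).div
    h.hasPd_four_totalJacobian hΔ).congr_deriv ?_
  rw [h.X_u, Dt_of_pd_two_eq_zero h.X_u]; field_simp; ring

theorem hasPd_three_prolongUx (h : φ.IsProjectableAt j.base) (hj : j ∈ φ.prolongationDomain) :
    HasPd 3 (prolongUx φ.toMap) j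
      (-(pd 2 φ.U j.base * pd 1 φ.T j.base) / totalJacobian φ.toMap j) := by
  have hΔ := hj.2
  refine ((((hasPd_three_Dx φ.U j).mul (hasPd_three_Dt φ.T j)).sub
    ((hasPd_three_Dt φ.U j).mul (hasPd_three_Dx φ.T j))).div
    h.hasPd_three_totalJacobian hΔ).congr_deriv ?_
  rw [h.T_u, Dx_of_pd_two_eq_zero h.T_u]; field_simp; ring

theorem hasPd_four_prolongUx (h : φ.IsProjectableAt j.base) (hj : j ∈ φ.prolongationDomain) :
    HasPd 4 (prolongUx φ.toMap) j
      (pd 2 φ.U j.base * pd 0 φ.T j.base / totalJacobian φ.toMap j) := by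
  have hΔ := hj.2
  refine ((((hasPd_four_Dx φ.U j).mul (hasPd_four_Dt φ.T j)).sub
    ((hasPd_four_Dt φ.U j).mul (hasPd_four_Dx φ.T j))).div
    h.hasPd_four_totalJacobian hΔ).congr_deriv ?_
  rw [h.T_u, Dt_of_pd_two_eq_zero h.T_u]; field_simp; ring

end PointTransformation.IsProjectableAt

end Projectable

namespace IsXUx

variable {θ : ArbitraryElements} {φ : PointTransformation 3} {F : Jet → ℝ} {j : Jet}

theorem hasPd (hF : IsXUx θ.dom F) (hj : j ∈ θ.dom) (i : Fin 8) : HasPd i F j (pd i F j) :=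
  hasPd_of_contDiffOn hF.smooth θ.isOpen_dom hj i

theorem hasPd_zero (hF : IsXUx θ.dom F) (hj : j ∈ θ.dom) : HasPd 0 F j 0 :=
  (hF.hasPd hj 0).congr_deriv (hF.dep j hj).1

theorem hasPd_two (hF : IsXUx θ.dom F) (hj : j ∈ θ.dom) : HasPd 2 F j 0 :=
  (hF.hasPd hj 2).congr_deriv (hF.dep j hj).2.1

theorem hasPd_three (hF : IsXUx θ.dom F) (hj : j ∈ θ.dom) : HasPd 3 F j 0 :=
  (hF.hasPd hj 3).congr_deriv (hF.dep j hj).2.2.1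

theorem hasPd_comp_firstProlongation (hF : IsXUx θ.dom F) (hj : j ∈ φ.prolongationDomain)
    (hmem : firstProlongation φ.toMap j ∈ θ.dom) {i : Fin 8}
    (hX : HasPd i (fun j : Jet => φ.X j.base) j 0) {W : ℝ}
    (hW : HasPd i (prolongUx φ.toMap) j W) :
    HasPd i (fun j => F (firstProlongation φ.toMap j)) j
      (W * pd 4 F (firstProlongation φ.toMap j)) :=
  (hF.hasPd_comp θ.isOpen_dom hmem
    (differentiableAt_of_contDiffOn φ.contDiffOn_firstProlongation
      φ.isOpen_prolongationDomain hj) hX hW).congr_deriv (by ring)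

end IsXUx

namespace MapsEquation

variable {θ θ' : ArbitraryElements} {φ : PointTransformation 3} {j : Jet}

theorem f_mul_Dx_mul_Dx_eq (hm : MapsEquation φ θ θ') (hθ : θ ∈ waveClass) (hθ' : θ' ∈ waveClass)
    (hj : j ∈ θ.dom) (hΔ : totalJacobian φ.toMap j ≠ 0) :
    θ.f j * (Dx φ.T j * Dx φ.X j) = Dt φ.T j * Dt φ.X j := by
  refine mul_left_cancel₀ hΔ ?_
  unfold totalJacobian
  linear_combination (Dt φ.T j * Dx φ.T j) * hm.coeff_u_xx hθ hθ' hj hΔ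
    - (Dx φ.T j ^ 2 * θ.f j + Dt φ.T j ^ 2) * hm.coeff_u_tx hθ hθ' hj hΔ

theorem isProjectableAt_of_totalJacobian_ne_zero (hm : MapsEquation φ θ θ') (hθ : θ ∈ waveClass)
    (hθ' : θ' ∈ waveClass) (hf : ∀ j ∈ θ.dom, pd 4 θ.f j = 0) (hj : j ∈ θ.dom)
    (hΔ : totalJacobian φ.toMap j ≠ 0) : φ.IsProjectableAt j.base := by
  have hopen := θ.isOpen_dom.inter φ.isOpen_prolongationDomain
  have hjmem : j ∈ θ.dom ∩ φ.prolongationDomain := ⟨hj, hm.1 j hj, hΔ⟩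
  have hrel (k) (hk : k ∈ θ.dom ∩ φ.prolongationDomain) :=
    hm.f_mul_Dx_mul_Dx_eq hθ hθ' hk.1 hk.2.2
  have h3 := (((isXUx_f hθ).hasPd_three hj).mul ((hasPd_three_Dx φ.T j).mul
      (hasPd_three_Dx φ.X j))).eq_of_eqOn ((hasPd_three_Dt φ.T j).mul (hasPd_three_Dt φ.X j))
    hopen hjmem hrel
  have h4 := ((((isXUx_f hθ).hasPd hj 4).congr_deriv (hf j hj)).mul ((hasPd_four_Dx φ.T j).mul
      (hasPd_four_Dx φ.X j))).eq_of_eqOn ((hasPd_four_Dt φ.T j).mul (hasPd_four_Dt φ.X j))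
    hopen hjmem hrel
  have h4' : pd 2 φ.T j.base * Dx φ.X j + Dx φ.T j * pd 2 φ.X j.base = 0 :=
    mul_left_cancel₀ (hθ.2.2.1 j hj) (by linear_combination h4)
  constructor <;> refine mul_left_cancel₀ hΔ ?_ <;> unfold totalJacobian
  · linear_combination Dt φ.T j * h4' + Dx φ.T j * h3
  · linear_combination (-Dx φ.X j) * h3 - Dt φ.X j * h4'

theorem isProjectableAt (hm : MapsEquation φ θ θ') (hθ : θ ∈ waveClass)
    (hθ' : θ' ∈ waveClass) (hf : ∀ j ∈ θ.dom, pd 4 θ.f j = 0) (hj : j ∈ θ.dom) :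
    φ.IsProjectableAt j.base := by
  obtain ⟨k, hk, hkj, hΔ⟩ := φ.exists_totalJacobian_ne_zero θ.isOpen_dom hj (hm.1 j hj)
  exact hkj ▸ hm.isProjectableAt_of_totalJacobian_ne_zero hθ hθ' hf hk hΔ

/-- The first two splitting equations determine `f̃` from `f` and the first derivatives of `T` and
`X`, none of which varies along the fibers of the jet space. -/
theorem fiber_derivative_f_eq_zero (hm : MapsEquation φ θ θ') (hθ : θ ∈ waveClass)
    (hθ' : θ' ∈ waveClass) (hf : ∀ j ∈ θ.dom, pd 4 θ.f j = 0) (hj : j ∈ θ.dom) {i : Fin 8}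
    (hi : 3 ≤ (i : ℕ)) (hfi : HasPd i θ.f j 0) {D : ℝ}
    (hD : HasPd i (fun j => θ'.f (firstProlongation φ.toMap j)) j D) : D = 0 := by
  have hproj (k) (hk : k ∈ θ.dom) := hm.isProjectableAt hθ hθ' hf hk
  have hΔ (k) (hk : k ∈ θ.dom) := ((hproj k hk).mem_prolongationDomain (hm.1 k hk)).2
  have hbase (F : Base → ℝ) := hasPd_comp_base_fiber F j hi
  have h_tx := ((hbase (pd 0 φ.X)).mul (hbase (pd 1 φ.X))).eq_of_eqOn
    (hD.mul ((hbase (pd 0 φ.T)).mul (hbase (pd 1 φ.T)))) θ.isOpen_dom hj fun k hk => by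
      have h := hm.coeff_u_tx hθ hθ' hk (hΔ k hk)
      rwa [Dt_of_pd_two_eq_zero (hproj k hk).T_u, Dt_of_pd_two_eq_zero (hproj k hk).X_u,
        Dx_of_pd_two_eq_zero (hproj k hk).T_u, Dx_of_pd_two_eq_zero (hproj k hk).X_u] at h
  have h_xx := (((hbase (pd 1 φ.X)).sq.mul hfi).add (hbase (pd 0 φ.X)).sq).eq_of_eqOn
    (hD.mul (((hbase (pd 1 φ.T)).sq.mul hfi).add (hbase (pd 0 φ.T)).sq)) θ.isOpen_dom hj
    fun k hk => by
      have h := hm.coeff_u_xx hθ hθ' hk (hΔ k hk)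
      rwa [Dt_of_pd_two_eq_zero (hproj k hk).T_u, Dt_of_pd_two_eq_zero (hproj k hk).X_u,
        Dx_of_pd_two_eq_zero (hproj k hk).T_u, Dx_of_pd_two_eq_zero (hproj k hk).X_u] at h
  by_contra hD0
  have hTtTx : pd 0 φ.T j.base * pd 1 φ.T j.base = 0 :=
    mul_left_cancel₀ hD0 (by linear_combination -h_tx)
  have hsum : pd 1 φ.T j.base ^ 2 * θ.f j + pd 0 φ.T j.base ^ 2 = 0 :=
    mul_left_cancel₀ hD0 (by linear_combination -h_xx)
  refine hΔ j hj ?_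
  rw [(hproj j hj).totalJacobian_eq]
  rcases mul_eq_zero.1 hTtTx with h | h
  · have hTx : pd 1 φ.T j.base = 0 := by simpa [h, hθ.2.2.1 j hj] using hsum
    rw [h, hTx]; ring
  · have hTt : pd 0 φ.T j.base = 0 := by simpa [h] using hsum
    rw [h, hTt]; ring

theorem pd_four_f_eq_zero (hm : MapsEquation φ θ θ') (hθ : θ ∈ waveClass)
    (hθ' : θ' ∈ waveClass) (hf : ∀ j ∈ θ.dom, pd 4 θ.f j = 0) (hj : j ∈ θ.dom) :
    pd 4 θ'.f (firstProlongation φ.toMap j) = 0 := by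
  have hproj := hm.isProjectableAt hθ hθ' hf hj
  have hjp := hproj.mem_prolongationDomain (hm.1 j hj)
  have hU := hproj.U_u_ne_zero (hm.1 j hj)
  have hΔ := hjp.2
  have hmem := hm.firstProlongation_mem hθ hj hΔ
  have h3 := hm.fiber_derivative_f_eq_zero hθ hθ' hf hj (by simp) ((isXUx_f hθ).hasPd_three hj)
    ((isXUx_f hθ').hasPd_comp_firstProlongation hjp hmem
      (hasPd_comp_base_fiber φ.X j (by simp)) (hproj.hasPd_three_prolongUx hjp))
  have h4 := hm.fiber_derivative_f_eq_zero hθ hθ' hf hj (by simp)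
    (((isXUx_f hθ).hasPd hj 4).congr_deriv (hf j hj))
    ((isXUx_f hθ').hasPd_comp_firstProlongation hjp hmem
      (hasPd_comp_base_fiber φ.X j (by simp)) (hproj.hasPd_four_prolongUx hjp))
  by_contra hne
  simp only [mul_eq_zero, div_eq_zero_iff, neg_eq_zero, hU, hΔ, hne, false_or, or_false] at h3 h4
  refine hΔ ?_
  rw [hproj.totalJacobian_eq, h3, h4]
  ring

end MapsEquation

theorem mem_waveSubclass_of_admissible {θ θ' : ArbitraryElements} {φ : PointTransformation 3}
    (h : (θ, θ', φ) ∈ admissibleTransformations waveClass) (hθ : θ ∈ waveSubclass) :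
    θ' ∈ waveSubclass := by
  obtain ⟨-, hθ' : θ' ∈ waveClass, hm : MapsEquation φ θ θ'⟩ := h
  have hf (j') (hj' : j' ∈ θ'.dom) : pd 4 θ'.f j' = 0 := by
    obtain ⟨j, hj, hΔ, e⟩ := hm.exists_preimage hθ' hj'
    rw [((isXUx_f hθ').pd_four θ'.isOpen_dom).eq_of_eqOffSecondDerivatives θ'.isOpen_dom
      θ'.free_dom (hm.firstProlongation_mem hθ.1 hj hΔ) e]
    exact hm.pd_four_f_eq_zero hθ.1 hθ' hθ.2.1 hj
  refine ⟨hθ', hf, fun V hV hVd hVn => ?_⟩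
  obtain ⟨j, hj, hne⟩ := hθ'.2.2.2 V hV hVd hVn
  exact ⟨j, hj, fun h0 => hne (by rw [hf j (hVd hj), h0])⟩

/-- The domain of the variables `(t, x, u)` of the arbitrary elements `θ`. -/
def ArbitraryElements.baseDom (θ : ArbitraryElements) : Set Base := Jet.base '' θ.dom

theorem ArbitraryElements.isOpen_baseDom (θ : ArbitraryElements) : IsOpen θ.baseDom :=
  isOpen_image_base θ.isOpen_dom

theorem ArbitraryElements.base_mem_baseDom {θ : ArbitraryElements} {j : Jet} (hj : j ∈ θ.dom) :
    j.base ∈ θ.baseDom := Set.mem_image_of_mem _ hj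

theorem pd_pd_eq_zero {n : ℕ} {F : (Fin n → ℝ) → ℝ} {Ω : Set (Fin n → ℝ)} {z : Fin n → ℝ}
    (hF : ContDiffOn ℝ ∞ F Ω) (hΩ : IsOpen Ω) (hz : z ∈ Ω) {i : Fin n}
    (h : ∀ z ∈ Ω, pd i F z = 0) (k : Fin n) : pd i (pd k F) z = 0 :=
  (pd_comm hF hΩ hz i k).trans (pd_eq_zero_of_eqOn hΩ hz h k)

/-- For `φ` with `T_u = X_u = 0`, the value of
`D_t² U - ũ_t̃ D_t² T - ũ_x̃ D_t² X - f (D_x² U - ũ_t̃ D_x² T - ũ_x̃ D_x² X)` on the equation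
`u_tt = f u_xx + g`: up to a factor, the source term `g̃` of the transformed equation. -/
noncomputable def transformedSource (φ : PointTransformation 3) (θ : ArbitraryElements)
    (j : Jet) : ℝ :=
  pd 2 φ.U j.base * θ.g j
    + (pd 0 (pd 0 φ.U) j.base + 2 * (j 3 * pd 0 (pd 2 φ.U) j.base)
      + j 3 ^ 2 * pd 2 (pd 2 φ.U) j.base
      - prolongUt φ.toMap j * pd 0 (pd 0 φ.T) j.base
      - prolongUx φ.toMap j * pd 0 (pd 0 φ.X) j.base)
    - θ.f j * (pd 1 (pd 1 φ.U) j.base + 2 * (j 4 * pd 1 (pd 2 φ.U) j.base)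
      + j 4 ^ 2 * pd 2 (pd 2 φ.U) j.base
      - prolongUt φ.toMap j * pd 1 (pd 1 φ.T) j.base
      - prolongUx φ.toMap j * pd 1 (pd 1 φ.X) j.base)

/-- The factor relating `transformedSource` to the source term `g̃` of the transformed equation. -/
noncomputable def sourceFactor (φ : PointTransformation 3) (θ' : ArbitraryElements)
    (j : Jet) : ℝ :=
  pd 1 φ.X j.base ^ 2 - θ'.f (firstProlongation φ.toMap j) * pd 1 φ.T j.base ^ 2

/-- `φ` maps the equation of `θ` to that of `θ'`, where both belong to the subclass. -/
structure SubclassMap (φ : PointTransformation 3) (θ θ' : ArbitraryElements) : Prop where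
  mem : θ ∈ waveSubclass
  mem' : θ' ∈ waveSubclass
  maps : MapsEquation φ θ θ'

namespace SubclassMap

open ArbitraryElements

variable {θ θ' : ArbitraryElements} {φ : PointTransformation 3} {j : Jet} {z : Base}

variable (H : SubclassMap φ θ θ')
include H

theorem isXUx_f : IsXUx θ.dom θ.f := WaveClass.isXUx_f H.mem.1

theorem isXUx_g : IsXUx θ.dom θ.g := WaveClass.isXUx_g H.mem.1

theorem isXUx_f' : IsXUx θ'.dom θ'.f := WaveClass.isXUx_f H.mem'.1

theorem isXUx_g' : IsXUx θ'.dom θ'.g := WaveClass.isXUx_g H.mem'.1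

theorem isXUx_g'_ux : IsXUx θ'.dom (pd 4 θ'.g) := H.isXUx_g'.pd_four θ'.isOpen_dom

theorem isXUx_g'_uxux : IsXUx θ'.dom (pd 4 (pd 4 θ'.g)) := H.isXUx_g'_ux.pd_four θ'.isOpen_dom

theorem contDiffOn_component (k : Fin 3) :
    ContDiffOn ℝ ∞ (component φ.toMap k) θ.baseDom := by
  refine (φ.contDiffOn_component k).mono ?_
  rintro _ ⟨j, hj, rfl⟩
  exact H.maps.1 j hj

theorem isProjectableAt (hj : j ∈ θ.dom) : φ.IsProjectableAt j.base :=
  H.maps.isProjectableAt H.mem.1 H.mem'.1 H.mem.2.1 hj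

theorem T_u (hz : z ∈ θ.baseDom) : pd 2 φ.T z = 0 := by
  obtain ⟨j, hj, rfl⟩ := hz
  exact (H.isProjectableAt hj).T_u

theorem X_u (hz : z ∈ θ.baseDom) : pd 2 φ.X z = 0 := by
  obtain ⟨j, hj, rfl⟩ := hz
  exact (H.isProjectableAt hj).X_u

theorem mem_prolongationDomain (hj : j ∈ θ.dom) : j ∈ φ.prolongationDomain :=
  (H.isProjectableAt hj).mem_prolongationDomain (H.maps.1 j hj)

theorem U_u_ne_zero (hj : j ∈ θ.dom) : pd 2 φ.U j.base ≠ 0 :=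
  (H.isProjectableAt hj).U_u_ne_zero (H.maps.1 j hj)

theorem totalJacobian_ne_zero (hj : j ∈ θ.dom) : totalJacobian φ.toMap j ≠ 0 :=
  (H.mem_prolongationDomain hj).2

theorem firstProlongation_mem (hj : j ∈ θ.dom) : firstProlongation φ.toMap j ∈ θ'.dom :=
  H.maps.firstProlongation_mem H.mem.1 hj (H.totalJacobian_ne_zero hj)

theorem f'_ne_zero (hj : j ∈ θ.dom) : θ'.f (firstProlongation φ.toMap j) ≠ 0 :=
  H.mem'.1.2.2.1 _ (H.firstProlongation_mem hj)

theorem jacobian_ne_zero (hj : j ∈ θ.dom) :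
    pd 0 φ.T j.base * pd 1 φ.X j.base - pd 0 φ.X j.base * pd 1 φ.T j.base ≠ 0 :=
  (H.isProjectableAt hj).totalJacobian_eq ▸ H.totalJacobian_ne_zero hj

theorem X_t_mul_X_x (hj : j ∈ θ.dom) : pd 0 φ.X j.base * pd 1 φ.X j.base
    = θ'.f (firstProlongation φ.toMap j) * (pd 0 φ.T j.base * pd 1 φ.T j.base) := by
  have h := H.maps.coeff_u_tx H.mem.1 H.mem'.1 hj (H.totalJacobian_ne_zero hj)
  have hp := H.isProjectableAt hj
  rwa [Dt_of_pd_two_eq_zero hp.T_u, Dt_of_pd_two_eq_zero hp.X_u, Dx_of_pd_two_eq_zero hp.T_u,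
    Dx_of_pd_two_eq_zero hp.X_u] at h

theorem X_x_sq_mul_f_add (hj : j ∈ θ.dom) :
    pd 1 φ.X j.base ^ 2 * θ.f j + pd 0 φ.X j.base ^ 2
      = θ'.f (firstProlongation φ.toMap j)
        * (pd 1 φ.T j.base ^ 2 * θ.f j + pd 0 φ.T j.base ^ 2) := by
  have h := H.maps.coeff_u_xx H.mem.1 H.mem'.1 hj (H.totalJacobian_ne_zero hj)
  have hp := H.isProjectableAt hj
  rwa [Dt_of_pd_two_eq_zero hp.T_u, Dt_of_pd_two_eq_zero hp.X_u, Dx_of_pd_two_eq_zero hp.T_u,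
    Dx_of_pd_two_eq_zero hp.X_u] at h

theorem sourceFactor_mul_transformedSource (hj : j ∈ θ.dom) :
    sourceFactor φ θ' j * transformedSource φ θ j
      = totalJacobian φ.toMap j ^ 2 * θ'.g (firstProlongation φ.toMap j) := by
  have h := H.maps.coeff_one H.mem.1 H.mem'.1 hj (H.totalJacobian_ne_zero hj)
  have h_xx := H.X_x_sq_mul_f_add hj
  have hT := (H.isProjectableAt hj).T_u
  have hX := (H.isProjectableAt hj).X_u
  have hTu (k) : pd k (pd 2 φ.T) j.base = 0 :=
    pd_eq_zero_of_eqOn θ.isOpen_baseDom (base_mem_baseDom hj) (fun _ => H.T_u) k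
  have hXu (k) : pd k (pd 2 φ.X) j.base = 0 :=
    pd_eq_zero_of_eqOn θ.isOpen_baseDom (base_mem_baseDom hj) (fun _ => H.X_u) k
  rw [Dt_of_pd_two_eq_zero hT, Dt_of_pd_two_eq_zero hX, Dx_of_pd_two_eq_zero hT,
    Dx_of_pd_two_eq_zero hX] at h
  simp only [residualTT, residualXX, Dtt, Dxx, prolongUt_withSecondDerivatives,
    prolongUx_withSecondDerivatives, base_withSecondDerivatives, residualSlope, hT, hX, hTu, hXu]
    at h
  simp only [withSecondDerivatives, Matrix.cons_val] at h
  rw [sourceFactor, transformedSource]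
  linear_combination h - (pd 1 (pd 1 φ.U) j.base + 2 * (j 4 * pd 1 (pd 2 φ.U) j.base)
    + j 4 ^ 2 * pd 2 (pd 2 φ.U) j.base - prolongUt φ.toMap j * pd 1 (pd 1 φ.T) j.base
    - prolongUx φ.toMap j * pd 1 (pd 1 φ.X) j.base) * h_xx

theorem hasPd_four_f (hj : j ∈ θ.dom) : HasPd 4 θ.f j 0 :=
  (H.isXUx_f.hasPd hj 4).congr_deriv (H.mem.2.1 j hj)

theorem hasPd_comp_firstProlongation {F : Jet → ℝ} (hF : IsXUx θ'.dom F) (hj : j ∈ θ.dom)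
    {i : Fin 8} {Q : ℝ} (hX : HasPd i (fun j : Jet => φ.X j.base) j 0)
    (hQ : HasPd i (prolongUx φ.toMap) j Q) :
    HasPd i (fun j => F (firstProlongation φ.toMap j)) j
      (Q * pd 4 F (firstProlongation φ.toMap j)) :=
  hF.hasPd_comp_firstProlongation (H.mem_prolongationDomain hj) (H.firstProlongation_mem hj) hX hQ

theorem hasPd_f'_comp (hj : j ∈ θ.dom) {i : Fin 8} {Q : ℝ}
    (hX : HasPd i (fun j : Jet => φ.X j.base) j 0) (hQ : HasPd i (prolongUx φ.toMap) j Q) :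
    HasPd i (fun j => θ'.f (firstProlongation φ.toMap j)) j 0 :=
  (H.hasPd_comp_firstProlongation H.isXUx_f' hj hX hQ).congr_deriv <| by
    rw [H.mem'.2.1 _ (H.firstProlongation_mem hj), mul_zero]

end SubclassMap

/-- The derivative of `transformedSource` with respect to `u_t`. -/
noncomputable def transformedSourceUt (φ : PointTransformation 3) (θ : ArbitraryElements)
    (j : Jet) : ℝ :=
  2 * (pd 0 (pd 2 φ.U) j.base + j 3 * pd 2 (pd 2 φ.U) j.base)
    - pd 2 φ.U j.base * pd 1 φ.X j.base / totalJacobian φ.toMap j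
      * (pd 0 (pd 0 φ.T) j.base - θ.f j * pd 1 (pd 1 φ.T) j.base)
    + pd 2 φ.U j.base * pd 1 φ.T j.base / totalJacobian φ.toMap j
      * (pd 0 (pd 0 φ.X) j.base - θ.f j * pd 1 (pd 1 φ.X) j.base)

/-- The derivative of `transformedSource` with respect to `u_x`. -/
noncomputable def transformedSourceUx (φ : PointTransformation 3) (θ : ArbitraryElements)
    (j : Jet) : ℝ :=
  pd 2 φ.U j.base * pd 4 θ.g j
    + pd 2 φ.U j.base * pd 0 φ.X j.base / totalJacobian φ.toMap j
      * (pd 0 (pd 0 φ.T) j.base - θ.f j * pd 1 (pd 1 φ.T) j.base)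
    - pd 2 φ.U j.base * pd 0 φ.T j.base / totalJacobian φ.toMap j
      * (pd 0 (pd 0 φ.X) j.base - θ.f j * pd 1 (pd 1 φ.X) j.base)
    - 2 * (θ.f j * (pd 1 (pd 2 φ.U) j.base + j 4 * pd 2 (pd 2 φ.U) j.base))

namespace SubclassMap

open ArbitraryElements

variable {θ θ' : ArbitraryElements} {φ : PointTransformation 3} {j : Jet}

variable (H : SubclassMap φ θ θ')
include H

theorem hasPd_three_totalJacobian (hj : j ∈ θ.dom) : HasPd 3 (totalJacobian φ.toMap) j 0 :=
  (H.isProjectableAt hj).hasPd_three_totalJacobian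

theorem hasPd_four_totalJacobian (hj : j ∈ θ.dom) : HasPd 4 (totalJacobian φ.toMap) j 0 :=
  (H.isProjectableAt hj).hasPd_four_totalJacobian

theorem hasPd_three_prolongUx (hj : j ∈ θ.dom) : HasPd 3 (prolongUx φ.toMap) j
    (-(pd 2 φ.U j.base * pd 1 φ.T j.base) / totalJacobian φ.toMap j) :=
  (H.isProjectableAt hj).hasPd_three_prolongUx (H.mem_prolongationDomain hj)

theorem hasPd_four_prolongUx (hj : j ∈ θ.dom) : HasPd 4 (prolongUx φ.toMap) j
    (pd 2 φ.U j.base * pd 0 φ.T j.base / totalJacobian φ.toMap j) :=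
  (H.isProjectableAt hj).hasPd_four_prolongUx (H.mem_prolongationDomain hj)

theorem hasPd_sourceFactor (hj : j ∈ θ.dom) {i : Fin 8} (hi : 3 ≤ (i : ℕ)) {Q : ℝ}
    (hQ : HasPd i (prolongUx φ.toMap) j Q) : HasPd i (sourceFactor φ θ') j 0 :=
  have hb (F : Base → ℝ) := hasPd_comp_base_fiber F j hi
  ((hb (pd 1 φ.X)).sq.sub ((H.hasPd_f'_comp hj (hb φ.X) hQ).mul (hb (pd 1 φ.T)).sq)).congr_deriv
    (by ring)

theorem hasPd_three_transformedSource (hj : j ∈ θ.dom) :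
    HasPd 3 (transformedSource φ θ) j (transformedSourceUt φ θ j) := by
  have hb (F : Base → ℝ) : HasPd 3 (fun j : Jet => F j.base) j 0 :=
    hasPd_comp_base_fiber F j (by simp)
  have hP := (H.isProjectableAt hj).hasPd_three_prolongUt (H.mem_prolongationDomain hj)
  have hQ := H.hasPd_three_prolongUx hj
  have h3 : HasPd 3 (fun j : Jet => j 3) j 1 := hasPd_coord_self
  have h4 : HasPd 3 (fun j : Jet => j 4) j 0 := hasPd_coord_of_ne (by decide)
  refine ((((hb (pd 2 φ.U)).mul (H.isXUx_g.hasPd_three hj)).add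
    (((((hb (pd 0 (pd 0 φ.U))).add ((h3.mul (hb (pd 0 (pd 2 φ.U)))).const_mul 2)).add
      (h3.sq.mul (hb (pd 2 (pd 2 φ.U))))).sub (hP.mul (hb (pd 0 (pd 0 φ.T))))).sub
      (hQ.mul (hb (pd 0 (pd 0 φ.X)))))).sub ((H.isXUx_f.hasPd_three hj).mul
    (((((hb (pd 1 (pd 1 φ.U))).add ((h4.mul (hb (pd 1 (pd 2 φ.U)))).const_mul 2)).add
      (h4.sq.mul (hb (pd 2 (pd 2 φ.U))))).sub (hP.mul (hb (pd 1 (pd 1 φ.T))))).sub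
      (hQ.mul (hb (pd 1 (pd 1 φ.X))))))).congr_deriv ?_
  rw [transformedSourceUt]
  ring

theorem hasPd_four_transformedSource (hj : j ∈ θ.dom) :
    HasPd 4 (transformedSource φ θ) j (transformedSourceUx φ θ j) := by
  have hb (F : Base → ℝ) : HasPd 4 (fun j : Jet => F j.base) j 0 :=
    hasPd_comp_base_fiber F j (by simp)
  have hP := (H.isProjectableAt hj).hasPd_four_prolongUt (H.mem_prolongationDomain hj)
  have hQ := H.hasPd_four_prolongUx hj
  have h3 : HasPd 4 (fun j : Jet => j 3) j 0 := hasPd_coord_of_ne (by decide)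
  have h4 : HasPd 4 (fun j : Jet => j 4) j 1 := hasPd_coord_self
  refine ((((hb (pd 2 φ.U)).mul (H.isXUx_g.hasPd hj 4)).add
    (((((hb (pd 0 (pd 0 φ.U))).add ((h3.mul (hb (pd 0 (pd 2 φ.U)))).const_mul 2)).add
      (h3.sq.mul (hb (pd 2 (pd 2 φ.U))))).sub (hP.mul (hb (pd 0 (pd 0 φ.T))))).sub
      (hQ.mul (hb (pd 0 (pd 0 φ.X)))))).sub ((H.hasPd_four_f hj).mul
    (((((hb (pd 1 (pd 1 φ.U))).add ((h4.mul (hb (pd 1 (pd 2 φ.U)))).const_mul 2)).add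
      (h4.sq.mul (hb (pd 2 (pd 2 φ.U))))).sub (hP.mul (hb (pd 1 (pd 1 φ.T))))).sub
      (hQ.mul (hb (pd 1 (pd 1 φ.X))))))).congr_deriv ?_
  rw [transformedSourceUx]
  ring

theorem sourceFactor_mul_transformedSourceUt (hj : j ∈ θ.dom) :
    sourceFactor φ θ' j * transformedSourceUt φ θ j
      = -(totalJacobian φ.toMap j * (pd 2 φ.U j.base * pd 1 φ.T j.base)
        * pd 4 θ'.g (firstProlongation φ.toMap j)) := by
  have hQ := H.hasPd_three_prolongUx hj
  have hg' := H.hasPd_comp_firstProlongation H.isXUx_g' hj (hasPd_comp_base_fiber _ j (by simp)) hQ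
  have hL := (H.hasPd_sourceFactor hj (by simp) hQ).mul (H.hasPd_three_transformedSource hj)
  have hR := (H.hasPd_three_totalJacobian hj).sq.mul hg'
  have h := hL.eq_of_eqOn hR θ.isOpen_dom hj fun k hk => H.sourceFactor_mul_transformedSource hk
  field_simp at h
  linear_combination h

theorem sourceFactor_mul_transformedSourceUx (hj : j ∈ θ.dom) :
    sourceFactor φ θ' j * transformedSourceUx φ θ j
      = totalJacobian φ.toMap j * (pd 2 φ.U j.base * pd 0 φ.T j.base)
        * pd 4 θ'.g (firstProlongation φ.toMap j) := by
  have hQ := H.hasPd_four_prolongUx hj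
  have hg' := H.hasPd_comp_firstProlongation H.isXUx_g' hj (hasPd_comp_base_fiber _ j (by simp)) hQ
  have hL := (H.hasPd_sourceFactor hj (by simp) hQ).mul (H.hasPd_four_transformedSource hj)
  have hR := (H.hasPd_four_totalJacobian hj).sq.mul hg'
  have h := hL.eq_of_eqOn hR θ.isOpen_dom hj fun k hk => H.sourceFactor_mul_transformedSource hk
  field_simp at h
  linear_combination h

theorem hasPd_three_transformedSourceUt (hj : j ∈ θ.dom) :
    HasPd 3 (transformedSourceUt φ θ) j (2 * pd 2 (pd 2 φ.U) j.base) := by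
  have hb (F : Base → ℝ) : HasPd 3 (fun j : Jet => F j.base) j 0 :=
    hasPd_comp_base_fiber F j (by simp)
  have hΔ := H.hasPd_three_totalJacobian hj
  have hΔ0 := H.totalJacobian_ne_zero hj
  have hf := H.isXUx_f.hasPd_three hj
  refine (((((hb (pd 0 (pd 2 φ.U))).add
    (hasPd_coord_self.mul (hb (pd 2 (pd 2 φ.U))))).const_mul 2).sub
    ((((hb (pd 2 φ.U)).mul (hb (pd 1 φ.X))).div hΔ hΔ0).mul
      ((hb (pd 0 (pd 0 φ.T))).sub (hf.mul (hb (pd 1 (pd 1 φ.T))))))).add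
    ((((hb (pd 2 φ.U)).mul (hb (pd 1 φ.T))).div hΔ hΔ0).mul
      ((hb (pd 0 (pd 0 φ.X))).sub (hf.mul (hb (pd 1 (pd 1 φ.X))))))).congr_deriv ?_
  ring

theorem hasPd_four_transformedSourceUt (hj : j ∈ θ.dom) :
    HasPd 4 (transformedSourceUt φ θ) j 0 := by
  have hb (F : Base → ℝ) : HasPd 4 (fun j : Jet => F j.base) j 0 :=
    hasPd_comp_base_fiber F j (by simp)
  have hΔ := H.hasPd_four_totalJacobian hj
  have hΔ0 := H.totalJacobian_ne_zero hj
  have hf := H.hasPd_four_f hj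
  refine (((((hb (pd 0 (pd 2 φ.U))).add
    ((hasPd_coord_of_ne (by decide)).mul (hb (pd 2 (pd 2 φ.U))))).const_mul 2).sub
    ((((hb (pd 2 φ.U)).mul (hb (pd 1 φ.X))).div hΔ hΔ0).mul
      ((hb (pd 0 (pd 0 φ.T))).sub (hf.mul (hb (pd 1 (pd 1 φ.T))))))).add
    ((((hb (pd 2 φ.U)).mul (hb (pd 1 φ.T))).div hΔ hΔ0).mul
      ((hb (pd 0 (pd 0 φ.X))).sub (hf.mul (hb (pd 1 (pd 1 φ.X))))))).congr_deriv ?_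
  ring

theorem hasPd_four_transformedSourceUx (hj : j ∈ θ.dom) :
    HasPd 4 (transformedSourceUx φ θ) j
      (pd 2 φ.U j.base * pd 4 (pd 4 θ.g) j - 2 * (θ.f j * pd 2 (pd 2 φ.U) j.base)) := by
  have hb (F : Base → ℝ) : HasPd 4 (fun j : Jet => F j.base) j 0 :=
    hasPd_comp_base_fiber F j (by simp)
  have hΔ := H.hasPd_four_totalJacobian hj
  have hΔ0 := H.totalJacobian_ne_zero hj
  have hf := H.hasPd_four_f hj
  refine (((((hb (pd 2 φ.U)).mul ((H.isXUx_g.pd_four θ.isOpen_dom).hasPd hj 4)).add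
    ((((hb (pd 2 φ.U)).mul (hb (pd 0 φ.X))).div hΔ hΔ0).mul
      ((hb (pd 0 (pd 0 φ.T))).sub (hf.mul (hb (pd 1 (pd 1 φ.T))))))).sub
    ((((hb (pd 2 φ.U)).mul (hb (pd 0 φ.T))).div hΔ hΔ0).mul
      ((hb (pd 0 (pd 0 φ.X))).sub (hf.mul (hb (pd 1 (pd 1 φ.X))))))).sub
    ((hf.mul ((hb (pd 1 (pd 2 φ.U))).add
      (hasPd_coord_self.mul (hb (pd 2 (pd 2 φ.U)))))).const_mul 2)).congr_deriv ?_
  ring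

theorem two_mul_sourceFactor_mul_U_uu (hj : j ∈ θ.dom) :
    2 * (sourceFactor φ θ' j * pd 2 (pd 2 φ.U) j.base)
      = pd 2 φ.U j.base ^ 2 * pd 1 φ.T j.base ^ 2
        * pd 4 (pd 4 θ'.g) (firstProlongation φ.toMap j) := by
  have hb (F : Base → ℝ) : HasPd 3 (fun j : Jet => F j.base) j 0 :=
    hasPd_comp_base_fiber F j (by simp)
  have hQ := H.hasPd_three_prolongUx hj
  have hL := (H.hasPd_sourceFactor hj (by simp) hQ).mul (H.hasPd_three_transformedSourceUt hj)
  have hR := (((H.hasPd_three_totalJacobian hj).mul ((hb (pd 2 φ.U)).mul (hb (pd 1 φ.T)))).mul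
    (H.hasPd_comp_firstProlongation H.isXUx_g'_ux hj (hb φ.X) hQ)).neg
  have h := hL.eq_of_eqOn hR θ.isOpen_dom hj fun k hk => H.sourceFactor_mul_transformedSourceUt hk
  have hΔ := H.totalJacobian_ne_zero hj
  field_simp at h
  linear_combination h

theorem T_t_mul_T_x_mul_g'_uxux (hj : j ∈ θ.dom) :
    pd 0 φ.T j.base * pd 1 φ.T j.base * pd 4 (pd 4 θ'.g) (firstProlongation φ.toMap j) = 0 := by
  have hb (F : Base → ℝ) : HasPd 4 (fun j : Jet => F j.base) j 0 :=
    hasPd_comp_base_fiber F j (by simp)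
  have hQ := H.hasPd_four_prolongUx hj
  have hL := (H.hasPd_sourceFactor hj (by simp) hQ).mul (H.hasPd_four_transformedSourceUt hj)
  have hR := (((H.hasPd_four_totalJacobian hj).mul ((hb (pd 2 φ.U)).mul (hb (pd 1 φ.T)))).mul
    (H.hasPd_comp_firstProlongation H.isXUx_g'_ux hj (hb φ.X) hQ)).neg
  have h := hL.eq_of_eqOn hR θ.isOpen_dom hj fun k hk => H.sourceFactor_mul_transformedSourceUt hk
  have hΔ := H.totalJacobian_ne_zero hj
  have hU := H.U_u_ne_zero hj
  field_simp at h
  refine (mul_eq_zero.1 ?_).resolve_left (pow_ne_zero 2 hU)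
  linear_combination h

theorem sourceFactor_mul_g_uxux (hj : j ∈ θ.dom) :
    sourceFactor φ θ' j
        * (pd 2 φ.U j.base * pd 4 (pd 4 θ.g) j - 2 * (θ.f j * pd 2 (pd 2 φ.U) j.base))
      = pd 2 φ.U j.base ^ 2 * pd 0 φ.T j.base ^ 2
        * pd 4 (pd 4 θ'.g) (firstProlongation φ.toMap j) := by
  have hb (F : Base → ℝ) : HasPd 4 (fun j : Jet => F j.base) j 0 :=
    hasPd_comp_base_fiber F j (by simp)
  have hQ := H.hasPd_four_prolongUx hj
  have hL := (H.hasPd_sourceFactor hj (by simp) hQ).mul (H.hasPd_four_transformedSourceUx hj)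
  have hR := ((H.hasPd_four_totalJacobian hj).mul ((hb (pd 2 φ.U)).mul (hb (pd 0 φ.T)))).mul
    (H.hasPd_comp_firstProlongation H.isXUx_g'_ux hj (hb φ.X) hQ)
  have h := hL.eq_of_eqOn hR θ.isOpen_dom hj fun k hk => H.sourceFactor_mul_transformedSourceUx hk
  have hΔ := H.totalJacobian_ne_zero hj
  field_simp at h
  linear_combination h

theorem T_x_mul_g'_uxuxux (hj : j ∈ θ.dom) :
    pd 1 φ.T j.base * pd 4 (pd 4 (pd 4 θ'.g)) (firstProlongation φ.toMap j) = 0 := by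
  have hb (F : Base → ℝ) : HasPd 3 (fun j : Jet => F j.base) j 0 :=
    hasPd_comp_base_fiber F j (by simp)
  have hQ := H.hasPd_three_prolongUx hj
  have hL := ((H.hasPd_sourceFactor hj (by simp) hQ).mul (hb (pd 2 (pd 2 φ.U)))).const_mul 2
  have hR := ((hb (pd 2 φ.U)).sq.mul (hb (pd 1 φ.T)).sq).mul
    (H.hasPd_comp_firstProlongation H.isXUx_g'_uxux hj (hb φ.X) hQ)
  have h := hL.eq_of_eqOn hR θ.isOpen_dom hj fun k hk => H.two_mul_sourceFactor_mul_U_uu hk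
  have hΔ := H.totalJacobian_ne_zero hj
  have hU := H.U_u_ne_zero hj
  field_simp at h
  have h3 : pd 2 φ.U j.base ^ 3
      * (pd 1 φ.T j.base * pd 4 (pd 4 (pd 4 θ'.g)) (firstProlongation φ.toMap j)) ^ 3 = 0 := by
    linear_combination
      pd 4 (pd 4 (pd 4 θ'.g)) (firstProlongation φ.toMap j) ^ 2 * h
  exact pow_eq_zero_iff (by norm_num) |>.1 ((mul_eq_zero.1 h3).resolve_left (pow_ne_zero 3 hU))

theorem exists_g'_uxux_ne_zero {W : Set Base} (hW : IsOpen W) (hj : j ∈ θ.dom)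
    (hjW : j.base ∈ W) :
    ∃ k ∈ θ.dom, k.base ∈ W ∧ pd 4 (pd 4 θ'.g) (firstProlongation φ.toMap k) ≠ 0 := by
  have hpr (k : Jet) : (firstProlongation φ.toMap k).base = φ.toMap k.base := by
    ext i; fin_cases i <;> rfl
  have hopen : IsOpen (θ'.dom ∩ Jet.base ⁻¹' (φ.toMap.target ∩ φ.toMap.symm ⁻¹' W)) :=
    θ'.isOpen_dom.inter
      ((φ.toMap.isOpen_inter_preimage_symm hW).preimage contDiff_base.continuous)
  obtain ⟨j', ⟨hj', -, hj'W⟩, hne⟩ := H.mem'.2.2 _ hopen Set.inter_subset_left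
    ⟨firstProlongation φ.toMap j, H.firstProlongation_mem hj, by
      rw [Set.mem_preimage, hpr]
      refine ⟨φ.toMap.map_source (H.maps.1 j hj), ?_⟩
      rwa [Set.mem_preimage, φ.toMap.left_inv (H.maps.1 j hj)]⟩
  obtain ⟨k, hk, -, e⟩ := H.maps.exists_preimage H.mem'.1 hj'
  have hbase : j'.base = φ.toMap k.base := by
    rw [← hpr]
    ext i
    exact e _ (by fin_cases i <;> decide)
  refine ⟨k, hk, ?_, ?_⟩
  · rwa [Set.mem_preimage, hbase, φ.toMap.left_inv (H.maps.1 k hk)] at hj'W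
  · rwa [← H.isXUx_g'_uxux.eq_of_eqOffSecondDerivatives θ'.isOpen_dom θ'.free_dom
      (H.firstProlongation_mem hk) e]

theorem eq_zero_of_mul_g'_uxux_eq_zero {F : Base → ℝ} (hF : ContinuousOn F θ.baseDom)
    (h : ∀ j ∈ θ.dom, F j.base * pd 4 (pd 4 θ'.g) (firstProlongation φ.toMap j) = 0)
    {z : Base} (hz : z ∈ θ.baseDom) : F z = 0 := by
  by_contra hne
  have hW := hF.isOpen_inter_preimage θ.isOpen_baseDom (isOpen_ne (x := (0 : ℝ)))
  obtain ⟨j, hj, rfl⟩ := hz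
  obtain ⟨k, hk, hkW, hk0⟩ := H.exists_g'_uxux_ne_zero hW hj ⟨base_mem_baseDom hj, hne⟩
  exact (mul_ne_zero hkW.2 hk0) (h k hk)

theorem T_t_mul_T_x {z : Base} (hz : z ∈ θ.baseDom) : pd 0 φ.T z * pd 1 φ.T z = 0 :=
  have hcont (i) : ContinuousOn (pd i φ.T) θ.baseDom :=
    (contDiffOn_pd (H.contDiffOn_component 0) θ.isOpen_baseDom i).continuousOn
  H.eq_zero_of_mul_g'_uxux_eq_zero ((hcont 0).mul (hcont 1))
    (fun _ => H.T_t_mul_T_x_mul_g'_uxux) hz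

end SubclassMap

namespace PointTransformation

/-- The determining equations, at `z`, of the transformations of `(t, x, u)` induced by the
equivalence group. Locally, their general solution is `T = c₁ t + c₀`, `X = X(x)`,
`U = c₂ u + c₄ t² + c₃ t + ψ(x)`. -/
structure IsSpecialAt (φ : PointTransformation 3) (z : Base) : Prop where
  T_x : pd 1 φ.T z = 0
  T_u : pd 2 φ.T z = 0
  X_t : pd 0 φ.X z = 0
  X_u : pd 2 φ.X z = 0
  T_tt : pd 0 (pd 0 φ.T) z = 0
  U_uu : pd 2 (pd 2 φ.U) z = 0
  U_tu : pd 0 (pd 2 φ.U) z = 0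
  U_xu : pd 1 (pd 2 φ.U) z = 0
  U_tx : pd 0 (pd 1 φ.U) z = 0
  U_ttt : pd 0 (pd 0 (pd 0 φ.U)) z = 0

end PointTransformation

theorem ArbitraryElements.hasPd_comp_base {θ : ArbitraryElements} {F : Base → ℝ} {j : Jet}
    (hF : ContDiffOn ℝ ∞ F θ.baseDom) (hj : j ∈ θ.dom) (k : Fin 3) :
    HasPd (Fin.castLE (by norm_num) k) (fun j : Jet => F j.base) j (pd k F j.base) :=
  (hasPd_of_contDiffOn hF θ.isOpen_baseDom (base_mem_baseDom hj) k).comp_base rfl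

theorem IsXUx.hasPd_castLE {θ : ArbitraryElements} {F : Jet → ℝ} {j : Jet} (hF : IsXUx θ.dom F)
    (hj : j ∈ θ.dom) {k : Fin 3} (hk : k ≠ 1) : HasPd (Fin.castLE (by norm_num) k) F j 0 := by
  fin_cases k
  · exact hF.hasPd_zero hj
  · exact absurd rfl hk
  · exact hF.hasPd_two hj

namespace SubclassMap

open ArbitraryElements

variable {θ θ' : ArbitraryElements} {φ : PointTransformation 3} {j : Jet} {z : Base}

variable (H : SubclassMap φ θ θ')
include H

theorem contDiffOn_pd_component (k i : Fin 3) :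
    ContDiffOn ℝ ∞ (pd i (component φ.toMap k)) θ.baseDom :=
  contDiffOn_pd (H.contDiffOn_component k) θ.isOpen_baseDom i

theorem hasPd_prolongUx (hj : j ∈ θ.dom) (i : Fin 8) :
    HasPd i (prolongUx φ.toMap) j (pd i (prolongUx φ.toMap) j) :=
  hasPd_of_contDiffOn (contDiffOn_pi.1 φ.contDiffOn_firstProlongation 4)
    φ.isOpen_prolongationDomain (H.mem_prolongationDomain hj) i

theorem T_t_eq_zero_and_X_x_eq_zero (hj : j ∈ θ.dom) (hx : pd 1 φ.T j.base ≠ 0) :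
    pd 0 φ.T j.base = 0 ∧ pd 1 φ.X j.base = 0 := by
  have hTt := (mul_eq_zero.1 (H.T_t_mul_T_x (base_mem_baseDom hj))).resolve_right hx
  have hXX := H.X_t_mul_X_x hj
  have hΔ := H.jacobian_ne_zero hj
  simp only [hTt, zero_mul, zero_sub, neg_ne_zero, mul_zero, mul_eq_zero] at hΔ hXX
  exact ⟨hTt, hXX.resolve_left (left_ne_zero_of_mul hΔ)⟩

theorem U_u_sq_mul_g'_uxux (hj : j ∈ θ.dom) (hx : pd 1 φ.T j.base ≠ 0) :
    pd 2 φ.U j.base ^ 2 * pd 4 (pd 4 θ'.g) (firstProlongation φ.toMap j)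
      = -2 * (θ'.f (firstProlongation φ.toMap j) * pd 2 (pd 2 φ.U) j.base) := by
  have h := H.two_mul_sourceFactor_mul_U_uu hj
  rw [sourceFactor, (H.T_t_eq_zero_and_X_x_eq_zero hj hx).2] at h
  refine mul_left_cancel₀ (pow_ne_zero 2 hx) ?_
  linear_combination -h

theorem f_mul_g'_uxux_mul_U_u (hj : j ∈ θ.dom) (hx : pd 1 φ.T j.base ≠ 0) :
    θ.f j * pd 4 (pd 4 θ'.g) (firstProlongation φ.toMap j) * pd 2 φ.U j.base
      = -(θ'.f (firstProlongation φ.toMap j) * pd 4 (pd 4 θ.g) j) := by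
  obtain ⟨hTt, hXx⟩ := H.T_t_eq_zero_and_X_x_eq_zero hj hx
  have h := H.sourceFactor_mul_g_uxux hj
  rw [sourceFactor, hTt, hXx] at h
  refine mul_left_cancel₀ (mul_ne_zero (pow_ne_zero 2 hx) (H.U_u_ne_zero hj)) ?_
  linear_combination -h + θ.f j * pd 1 φ.T j.base ^ 2 * H.U_u_sq_mul_g'_uxux hj hx

/-- If `T_x` did not vanish, differentiating `f g̃_ũxũx U_u = -f̃ g_uxux` with respect to `u` would
give `U_uu = 0`, hence `g̃_ũxũx = 0`. -/
theorem T_x (hz : z ∈ θ.baseDom) : pd 1 φ.T z = 0 := by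
  by_contra hx
  obtain ⟨j, hj, rfl⟩ := hz
  have hW := (H.contDiffOn_pd_component 0 1).continuousOn.isOpen_inter_preimage θ.isOpen_baseDom
    (isOpen_ne (x := (0 : ℝ)))
  obtain ⟨k, hk, hkW, hne⟩ := H.exists_g'_uxux_ne_zero hW hj ⟨base_mem_baseDom hj, hx⟩
  have hA : IsOpen (θ.dom ∩ Jet.base ⁻¹' _) :=
    θ.isOpen_dom.inter (hW.preimage contDiff_base.continuous)
  have hX : HasPd 2 (fun j : Jet => φ.X j.base) k 0 :=
    (hasPd_comp_base (H.contDiffOn_component 1) hk 2).congr_deriv (H.X_u hkW.1)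
  have hQ := H.hasPd_prolongUx hk 2
  have hL := ((H.isXUx_f.hasPd_two hk).mul
    (H.hasPd_comp_firstProlongation H.isXUx_g'_uxux hk hX hQ)).mul
    (hasPd_comp_base (H.contDiffOn_pd_component 2 2) hk 2)
  have hR := ((H.hasPd_f'_comp hk hX hQ).mul
    (((H.isXUx_g.pd_four θ.isOpen_dom).pd_four θ.isOpen_dom).hasPd_two hk)).neg
  have h := hL.eq_of_eqOn hR hA ⟨hk, hkW⟩ fun y hy => H.f_mul_g'_uxux_mul_U_u hy.1 hy.2.2
  rw [(mul_eq_zero.1 (H.T_x_mul_g'_uxuxux hk)).resolve_left hkW.2] at h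
  have hUuu : pd 2 (pd 2 φ.U) k.base = 0 := by
    refine (mul_eq_zero.1 ?_).resolve_left (mul_ne_zero (H.mem.1.2.2.1 k hk) hne)
    linear_combination h
  refine mul_ne_zero (pow_ne_zero 2 (H.U_u_ne_zero hk)) hne ?_
  rw [H.U_u_sq_mul_g'_uxux hk hkW.2, hUuu, mul_zero, mul_zero]

theorem T_t_mul_X_x_ne_zero (hj : j ∈ θ.dom) : pd 0 φ.T j.base * pd 1 φ.X j.base ≠ 0 := by
  simpa [H.T_x (base_mem_baseDom hj)] using H.jacobian_ne_zero hj

theorem T_t_ne_zero (hj : j ∈ θ.dom) : pd 0 φ.T j.base ≠ 0 :=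
  left_ne_zero_of_mul (H.T_t_mul_X_x_ne_zero hj)

theorem X_x_ne_zero (hj : j ∈ θ.dom) : pd 1 φ.X j.base ≠ 0 :=
  right_ne_zero_of_mul (H.T_t_mul_X_x_ne_zero hj)

theorem X_t (hz : z ∈ θ.baseDom) : pd 0 φ.X z = 0 := by
  have hTx := H.T_x hz
  obtain ⟨j, hj, rfl⟩ := hz
  have h := H.X_t_mul_X_x hj
  rw [hTx, mul_zero, mul_zero] at h
  exact (mul_eq_zero.1 h).resolve_right (H.X_x_ne_zero hj)

theorem sourceFactor_eq (hj : j ∈ θ.dom) : sourceFactor φ θ' j = pd 1 φ.X j.base ^ 2 := by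
  rw [sourceFactor, H.T_x (base_mem_baseDom hj)]
  ring

theorem totalJacobian_eq (hj : j ∈ θ.dom) :
    totalJacobian φ.toMap j = pd 0 φ.T j.base * pd 1 φ.X j.base := by
  rw [(H.isProjectableAt hj).totalJacobian_eq, H.T_x (base_mem_baseDom hj), mul_zero, sub_zero]

theorem f_transform (hj : j ∈ θ.dom) :
    θ'.f (firstProlongation φ.toMap j) * pd 0 φ.T j.base ^ 2
      = θ.f j * pd 1 φ.X j.base ^ 2 := by
  have h := H.X_x_sq_mul_f_add hj
  rw [H.T_x (base_mem_baseDom hj), H.X_t (base_mem_baseDom hj)] at h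
  linear_combination -h

theorem prolongUx_eq (hj : j ∈ θ.dom) :
    prolongUx φ.toMap j = Dx φ.U j / pd 1 φ.X j.base := by
  have hz := base_mem_baseDom hj
  rw [prolongUx, H.totalJacobian_eq hj, Dt_of_pd_two_eq_zero (H.T_u hz),
    Dx_of_pd_two_eq_zero (H.T_u hz), H.T_x hz, mul_zero, sub_zero, mul_comm (Dx _ _),
    mul_div_mul_left _ _ (H.T_t_ne_zero hj)]

theorem pd_X (hz : z ∈ θ.baseDom) {k : Fin 3} (hk : k ≠ 1) : pd k φ.X z = 0 := by
  fin_cases k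
  · exact H.X_t hz
  · exact absurd rfl hk
  · exact H.X_u hz

theorem pd_X_x (hz : z ∈ θ.baseDom) {k : Fin 3} (hk : k ≠ 1) : pd k (pd 1 φ.X) z = 0 :=
  pd_pd_eq_zero (H.contDiffOn_component 1) θ.isOpen_baseDom hz (fun _ hy => H.pd_X hy hk) 1

theorem pd_X_xx (hz : z ∈ θ.baseDom) {k : Fin 3} (hk : k ≠ 1) :
    pd k (pd 1 (pd 1 φ.X)) z = 0 :=
  pd_pd_eq_zero (H.contDiffOn_pd_component 1 1) θ.isOpen_baseDom hz (fun _ hy => H.pd_X_x hy hk) 1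

theorem hasPd_X (hj : j ∈ θ.dom) {k : Fin 3} (hk : k ≠ 1) :
    HasPd (Fin.castLE (by norm_num) k) (fun j : Jet => φ.X j.base) j 0 :=
  (hasPd_comp_base (H.contDiffOn_component 1) hj k).congr_deriv
    (H.pd_X (base_mem_baseDom hj) hk)

theorem hasPd_X_x (hj : j ∈ θ.dom) {k : Fin 3} (hk : k ≠ 1) :
    HasPd (Fin.castLE (by norm_num) k) (fun j : Jet => pd 1 φ.X j.base) j 0 :=
  (hasPd_comp_base (H.contDiffOn_pd_component 1 1) hj k).congr_deriv
    (H.pd_X_x (base_mem_baseDom hj) hk)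

theorem hasPd_X_xx (hj : j ∈ θ.dom) {k : Fin 3} (hk : k ≠ 1) :
    HasPd (Fin.castLE (by norm_num) k) (fun j : Jet => pd 1 (pd 1 φ.X) j.base) j 0 :=
  (hasPd_comp_base (contDiffOn_pd (H.contDiffOn_pd_component 1 1) θ.isOpen_baseDom 1)
    hj k).congr_deriv (H.pd_X_xx (base_mem_baseDom hj) hk)

theorem T_tt (hz : z ∈ θ.baseDom) : pd 0 (pd 0 φ.T) z = 0 := by
  obtain ⟨j, hj, rfl⟩ := hz
  have h01 : (0 : Fin 3) ≠ 1 := by decide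
  have hL := (H.hasPd_f'_comp hj (H.hasPd_X hj h01) (H.hasPd_prolongUx hj 0)).mul
    (hasPd_comp_base (H.contDiffOn_pd_component 0 0) hj 0).sq
  have hR := (H.isXUx_f.hasPd_castLE hj h01).mul (H.hasPd_X_x hj h01).sq
  have h := hL.eq_of_eqOn hR θ.isOpen_dom hj fun y hy => H.f_transform hy
  refine (mul_eq_zero.1 ?_).resolve_left (mul_ne_zero (mul_ne_zero two_ne_zero
    (H.f'_ne_zero hj)) (H.T_t_ne_zero hj))
  linear_combination h

theorem hasPd_T_t (hj : j ∈ θ.dom) {k : Fin 3} (hk : k ≠ 1) :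
    HasPd (Fin.castLE (by norm_num) k) (fun j : Jet => pd 0 φ.T j.base) j 0 := by
  refine (hasPd_comp_base (H.contDiffOn_pd_component 0 0) hj k).congr_deriv ?_
  fin_cases k
  · exact H.T_tt (base_mem_baseDom hj)
  · exact absurd rfl hk
  · exact pd_pd_eq_zero (H.contDiffOn_component 0) θ.isOpen_baseDom (base_mem_baseDom hj)
      (fun _ hy => H.T_u hy) 0

theorem U_uu (hz : z ∈ θ.baseDom) : pd 2 (pd 2 φ.U) z = 0 := by
  obtain ⟨j, hj, rfl⟩ := hz
  have h := H.two_mul_sourceFactor_mul_U_uu hj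
  rw [H.sourceFactor_eq hj, H.T_x (base_mem_baseDom hj)] at h
  refine (mul_eq_zero.1 ?_).resolve_left (pow_ne_zero 2 (H.X_x_ne_zero hj))
  linear_combination h / 2

theorem T_xx (hz : z ∈ θ.baseDom) : pd 1 (pd 1 φ.T) z = 0 :=
  pd_eq_zero_of_eqOn θ.isOpen_baseDom hz (fun _ => H.T_x) 1

theorem U_tu (hz : z ∈ θ.baseDom) : pd 0 (pd 2 φ.U) z = 0 := by
  have hUuu := H.U_uu hz
  have hTtt := H.T_tt hz
  have hTxx := H.T_xx hz
  obtain ⟨j, hj, rfl⟩ := hz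
  have h := H.sourceFactor_mul_transformedSourceUt hj
  rw [H.sourceFactor_eq hj, transformedSourceUt, hUuu, hTtt, hTxx,
    H.T_x (base_mem_baseDom hj)] at h
  refine (mul_eq_zero.1 ?_).resolve_left (pow_ne_zero 2 (H.X_x_ne_zero hj))
  linear_combination h / 2

theorem pd_U_u (hz : z ∈ θ.baseDom) {k : Fin 3} (hk : k ≠ 1) : pd k (pd 2 φ.U) z = 0 := by
  fin_cases k
  · exact H.U_tu hz
  · exact absurd rfl hk
  · exact H.U_uu hz

theorem X_tt (hz : z ∈ θ.baseDom) : pd 0 (pd 0 φ.X) z = 0 :=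
  pd_eq_zero_of_eqOn θ.isOpen_baseDom hz (fun _ => H.X_t) 0

theorem g_ux_transform (hj : j ∈ θ.dom) :
    pd 1 φ.X j.base * (pd 2 φ.U j.base * pd 4 θ.g j - 2 * (θ.f j * pd 1 (pd 2 φ.U) j.base))
        + pd 2 φ.U j.base * (θ.f j * pd 1 (pd 1 φ.X) j.base)
      = pd 0 φ.T j.base ^ 2 * pd 2 φ.U j.base * pd 4 θ'.g (firstProlongation φ.toMap j) := by
  have hz := base_mem_baseDom hj
  have hT := H.T_t_ne_zero hj
  have hX := H.X_x_ne_zero hj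
  have h := H.sourceFactor_mul_transformedSourceUx hj
  rw [H.sourceFactor_eq hj, transformedSourceUx, H.totalJacobian_eq hj, H.U_uu hz, H.X_t hz,
    H.X_tt hz] at h
  field_simp at h
  refine mul_left_cancel₀ hT ?_
  linear_combination h

theorem hasPd_prolongUx_castLE (hj : j ∈ θ.dom) {k : Fin 3} (hk : k ≠ 1) :
    HasPd (Fin.castLE (by norm_num) k) (prolongUx φ.toMap) j
      (pd k (pd 1 φ.U) j.base / pd 1 φ.X j.base) := by
  have h4 : HasPd (Fin.castLE (by norm_num) k) (fun j : Jet => j 4) j 0 :=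
    hasPd_coord_of_ne (by fin_cases k <;> decide)
  have hDxU := (hasPd_comp_base (H.contDiffOn_pd_component 2 1) hj k).add
    (h4.mul (hasPd_comp_base (H.contDiffOn_pd_component 2 2) hj k))
  have hX := H.X_x_ne_zero hj
  refine ((hDxU.div (H.hasPd_X_x hj hk) hX).congr_of_eqOn θ.isOpen_dom hj
    fun y hy => H.prolongUx_eq hy).congr_deriv ?_
  rw [H.pd_U_u (base_mem_baseDom hj) hk]
  field_simp
  ring

theorem pd_U_x (hz : z ∈ θ.baseDom) {k : Fin 3} (hk : k ≠ 1) : pd k (pd 1 φ.U) z = 0 := by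
  refine H.eq_zero_of_mul_g'_uxux_eq_zero
    (contDiffOn_pd (H.contDiffOn_pd_component 2 1) θ.isOpen_baseDom k).continuousOn ?_ hz
  intro j hj
  have hUu := (hasPd_comp_base (H.contDiffOn_pd_component 2 2) hj k).congr_deriv
    (H.pd_U_u (base_mem_baseDom hj) hk)
  have hUxu := (hasPd_comp_base (contDiffOn_pd (H.contDiffOn_pd_component 2 2) θ.isOpen_baseDom 1)
    hj k).congr_deriv (pd_pd_eq_zero (H.contDiffOn_pd_component 2 2) θ.isOpen_baseDom
      (base_mem_baseDom hj) (fun _ hy => H.pd_U_u hy hk) 1)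
  have hf := H.isXUx_f.hasPd_castLE hj hk
  have hg := (H.isXUx_g.pd_four θ.isOpen_dom).hasPd_castLE hj hk
  have hL := ((H.hasPd_X_x hj hk).mul ((hUu.mul hg).sub ((hf.mul hUxu).const_mul 2))).add
    (hUu.mul (hf.mul (H.hasPd_X_xx hj hk)))
  have hR := ((H.hasPd_T_t hj hk).sq.mul hUu).mul
    (H.hasPd_comp_firstProlongation H.isXUx_g'_ux hj (H.hasPd_X hj hk)
      (H.hasPd_prolongUx_castLE hj hk))
  have h := hL.eq_of_eqOn hR θ.isOpen_dom hj fun y hy => H.g_ux_transform hy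
  have hX := H.X_x_ne_zero hj
  refine (mul_eq_zero.1 ?_).resolve_left
    (mul_ne_zero (pow_ne_zero 2 (H.T_t_ne_zero hj)) (H.U_u_ne_zero hj))
  field_simp at h
  linear_combination -h

theorem U_xu (hz : z ∈ θ.baseDom) : pd 1 (pd 2 φ.U) z = 0 :=
  (pd_comm (H.contDiffOn_component 2) θ.isOpen_baseDom hz 1 2).trans
    (H.pd_U_x hz (k := 2) (by decide))

theorem g_transform (hj : j ∈ θ.dom) :
    θ'.g (firstProlongation φ.toMap j) * pd 0 φ.T j.base ^ 2
      = pd 2 φ.U j.base * θ.g j + pd 0 (pd 0 φ.U) j.base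
        - θ.f j * (pd 1 (pd 1 φ.U) j.base - prolongUx φ.toMap j * pd 1 (pd 1 φ.X) j.base) := by
  have hz := base_mem_baseDom hj
  have h := H.sourceFactor_mul_transformedSource hj
  rw [H.sourceFactor_eq hj, transformedSource, H.totalJacobian_eq hj, H.U_uu hz, H.U_tu hz,
    H.U_xu hz, H.X_tt hz, H.T_tt hz, H.T_xx hz] at h
  refine mul_left_cancel₀ (pow_ne_zero 2 (H.X_x_ne_zero hj)) ?_
  linear_combination -h

theorem U_ttt (hz : z ∈ θ.baseDom) : pd 0 (pd 0 (pd 0 φ.U)) z = 0 := by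
  obtain ⟨j, hj, rfl⟩ := hz
  have hz := base_mem_baseDom hj
  have h01 : (0 : Fin 3) ≠ 1 := by decide
  have hΩ := θ.isOpen_baseDom
  have hcomp (F : Base → ℝ) (hF : ContDiffOn ℝ ∞ F θ.baseDom) := hasPd_comp_base hF hj 0
  have hQ : HasPd 0 (prolongUx φ.toMap) j 0 :=
    (H.hasPd_prolongUx_castLE hj h01).congr_deriv (by rw [H.pd_U_x hz h01, zero_div])
  have hUxx : pd 0 (pd 1 (pd 1 φ.U)) j.base = 0 :=
    pd_pd_eq_zero (H.contDiffOn_pd_component 2 1) hΩ hz (fun _ hy => H.pd_U_x hy h01) 1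
  have hL := (H.hasPd_comp_firstProlongation H.isXUx_g' hj (H.hasPd_X hj h01) hQ).mul
    (H.hasPd_T_t hj h01).sq
  have hR := (((hcomp _ (H.contDiffOn_pd_component 2 2)).mul
    (H.isXUx_g.hasPd_castLE hj h01)).add
      (hcomp _ (contDiffOn_pd (H.contDiffOn_pd_component 2 0) hΩ 0))).sub
    ((H.isXUx_f.hasPd_castLE hj h01).mul
      ((hcomp _ (contDiffOn_pd (H.contDiffOn_pd_component 2 1) hΩ 1)).sub
        (hQ.mul (H.hasPd_X_xx hj h01))))
  have h := hL.eq_of_eqOn hR θ.isOpen_dom hj fun y hy => H.g_transform hy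
  rw [H.U_tu hz, hUxx] at h
  linear_combination -h

theorem isSpecialAt (hz : z ∈ θ.baseDom) : φ.IsSpecialAt z where
  T_x := H.T_x hz
  T_u := H.T_u hz
  X_t := H.X_t hz
  X_u := H.X_u hz
  T_tt := H.T_tt hz
  U_uu := H.U_uu hz
  U_tu := H.U_tu hz
  U_xu := H.U_xu hz
  U_tx := H.pd_U_x hz (k := 0) (by decide)
  U_ttt := H.U_ttt hz

end SubclassMap

theorem HasPd.comp_pi {n m : ℕ} {i : Fin n} {K : (Fin m → ℝ) → ℝ} {Ψ : (Fin n → ℝ) → Fin m → ℝ}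
    {z : Fin n → ℝ} {V : Fin m → ℝ} (hK : DifferentiableAt ℝ K (Ψ z))
    (hΨ : ∀ l, HasPd i (fun z => Ψ z l) z (V l)) :
    HasPd i (fun z => K (Ψ z)) z (∑ l, V l * pd l K (Ψ z)) := by
  have hline : HasDerivAt (fun s : ℝ => Ψ (z + s • Pi.single i 1)) V 0 := hasDerivAt_pi.2 hΨ
  have hK' : HasFDerivAt K (fderiv ℝ K (Ψ z)) (Ψ (z + (0 : ℝ) • Pi.single i 1)) := by
    simpa using hK.hasFDerivAt
  have := hK'.comp_hasDerivAt (0 : ℝ) hline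
  rwa [fderiv_eq_sum] at this

section IsXUxAlgebra

variable {A : Set Jet} {F G : Jet → ℝ} {j : Jet}

theorem IsXUx.hasPd_eq_zero (hA : IsOpen A) (hF : IsXUx A F) (hj : j ∈ A) {i : Fin 8}
    (h1 : i ≠ 1) (h4 : i ≠ 4) : HasPd i F j 0 := by
  refine (hasPd_of_contDiffOn hF.smooth hA hj i).congr_deriv ?_
  have := hF.dep j hj
  fin_cases i <;> simp_all

theorem isXUx_of_hasPd (hA : IsOpen A) (hF : ContDiffOn ℝ ∞ F A)
    (h : ∀ j ∈ A, ∀ i : Fin 8, i ≠ 1 → i ≠ 4 → HasPd i F j 0) : IsXUx A F := by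
  refine ⟨hF, fun j hj => ?_⟩
  have hpd (i : Fin 8) (h1 : i ≠ 1) (h4 : i ≠ 4) : pd i F j = 0 :=
    (h j hj i h1 h4).pd_eq (differentiableAt_of_contDiffOn hF hA hj)
  refine ⟨hpd 0 ?_ ?_, hpd 2 ?_ ?_, hpd 3 ?_ ?_, hpd 5 ?_ ?_, hpd 6 ?_ ?_, hpd 7 ?_ ?_⟩ <;> decide

theorem IsXUx.mono {B : Set Jet} (hF : IsXUx A F) (h : B ⊆ A) : IsXUx B F :=
  ⟨hF.smooth.mono h, fun j hj => hF.dep j (h hj)⟩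

theorem isXUx_coord_four (hA : IsOpen A) : IsXUx A (fun j => j 4) :=
  isXUx_of_hasPd hA (contDiff_apply ℝ ℝ 4).contDiffOn
    fun _ _ _ _ h4 => hasPd_coord_of_ne (Ne.symm h4)

theorem IsXUx.add (hA : IsOpen A) (hF : IsXUx A F) (hG : IsXUx A G) :
    IsXUx A (fun j => F j + G j) :=
  isXUx_of_hasPd hA (hF.smooth.add hG.smooth) fun _ hj _ h1 h4 =>
    ((hF.hasPd_eq_zero hA hj h1 h4).add (hG.hasPd_eq_zero hA hj h1 h4)).congr_deriv (by ring)

theorem IsXUx.sub (hA : IsOpen A) (hF : IsXUx A F) (hG : IsXUx A G) :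
    IsXUx A (fun j => F j - G j) :=
  isXUx_of_hasPd hA (hF.smooth.sub hG.smooth) fun _ hj _ h1 h4 =>
    ((hF.hasPd_eq_zero hA hj h1 h4).sub (hG.hasPd_eq_zero hA hj h1 h4)).congr_deriv (by ring)

theorem IsXUx.mul (hA : IsOpen A) (hF : IsXUx A F) (hG : IsXUx A G) :
    IsXUx A (fun j => F j * G j) :=
  isXUx_of_hasPd hA (hF.smooth.mul hG.smooth) fun _ hj _ h1 h4 =>
    ((hF.hasPd_eq_zero hA hj h1 h4).mul (hG.hasPd_eq_zero hA hj h1 h4)).congr_deriv (by ring)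

theorem IsXUx.sq (hA : IsOpen A) (hF : IsXUx A F) : IsXUx A (fun j => F j ^ 2) := by
  simpa only [pow_two] using hF.mul hA hF

theorem IsXUx.div (hA : IsOpen A) (hF : IsXUx A F) (hG : IsXUx A G) (h : ∀ j ∈ A, G j ≠ 0) :
    IsXUx A (fun j => F j / G j) :=
  isXUx_of_hasPd hA (hF.smooth.div hG.smooth h) fun j hj _ h1 h4 =>
    ((hF.hasPd_eq_zero hA hj h1 h4).div (hG.hasPd_eq_zero hA hj h1 h4) (h j hj)).congr_deriv
      (by simp)

end IsXUxAlgebra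

/-- `h` is a smooth function on `Ω` depending at most on `x`, in the sense that `h_t = h_u = 0`. -/
structure IsX (Ω : Set Base) (h : Base → ℝ) : Prop where
  smooth : ContDiffOn ℝ ∞ h Ω
  pd_zero : ∀ z ∈ Ω, pd 0 h z = 0
  pd_two : ∀ z ∈ Ω, pd 2 h z = 0

theorem isX_coord_one (Ω : Set Base) : IsX Ω (fun z => z 1) where
  smooth := (contDiff_apply ℝ ℝ 1).contDiffOn
  pd_zero _ _ := (hasPd_coord_of_ne (by decide)).pd_eq (differentiableAt_apply _ _)
  pd_two _ _ := (hasPd_coord_of_ne (by decide)).pd_eq (differentiableAt_apply _ _)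

theorem IsX.pd {Ω : Set Base} {h : Base → ℝ} (hh : IsX Ω h) (hΩ : IsOpen Ω) (k : Fin 3) :
    IsX Ω (pd k h) where
  smooth := contDiffOn_pd hh.smooth hΩ k
  pd_zero _ hz := pd_pd_eq_zero hh.smooth hΩ hz hh.pd_zero k
  pd_two _ hz := pd_pd_eq_zero hh.smooth hΩ hz hh.pd_two k

namespace PointTransformation

/-- `φ` satisfies the determining equations `IsSpecialAt` throughout its domain, i.e. it is the
projection of an equivalence transformation. -/
def IsSpecial (φ : PointTransformation 3) : Prop := ∀ z ∈ φ.toMap.source, φ.IsSpecialAt z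

namespace IsSpecial

variable {φ : PointTransformation 3} (hφ : φ.IsSpecial) {z : Base}
include hφ

theorem T_t_ne_zero (hz : z ∈ φ.toMap.source) : pd 0 φ.T z ≠ 0 := fun h0 =>
  φ.det_jacobianMatrix_ne_zero hz <| by
    simp [Matrix.det_fin_three, jacobianMatrix, h0, (hφ z hz).T_x, (hφ z hz).T_u]

theorem X_x_ne_zero (hz : z ∈ φ.toMap.source) : pd 1 φ.X z ≠ 0 := fun h0 =>
  φ.det_jacobianMatrix_ne_zero hz <| by
    simp [Matrix.det_fin_three, jacobianMatrix, h0, (hφ z hz).X_t, (hφ z hz).X_u]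

theorem U_u_ne_zero (hz : z ∈ φ.toMap.source) : pd 2 φ.U z ≠ 0 := fun h0 =>
  φ.det_jacobianMatrix_ne_zero hz <| by
    simp [Matrix.det_fin_three, jacobianMatrix, h0, (hφ z hz).T_u, (hφ z hz).X_u]

theorem isX_X : IsX φ.toMap.source φ.X where
  smooth := φ.contDiffOn_component 1
  pd_zero z hz := (hφ z hz).X_t
  pd_two z hz := (hφ z hz).X_u

theorem isX_T_t : IsX φ.toMap.source (pd 0 φ.T) where
  smooth := contDiffOn_pd (φ.contDiffOn_component 0) φ.toMap.open_source 0
  pd_zero z hz := (hφ z hz).T_tt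
  pd_two _ hz := pd_pd_eq_zero (φ.contDiffOn_component 0) φ.toMap.open_source hz
    (fun z hz => (hφ z hz).T_u) 0

theorem isX_U_u : IsX φ.toMap.source (pd 2 φ.U) where
  smooth := contDiffOn_pd (φ.contDiffOn_component 2) φ.toMap.open_source 2
  pd_zero z hz := (hφ z hz).U_tu
  pd_two z hz := (hφ z hz).U_uu

theorem isX_U_x : IsX φ.toMap.source (pd 1 φ.U) where
  smooth := contDiffOn_pd (φ.contDiffOn_component 2) φ.toMap.open_source 1
  pd_zero z hz := (hφ z hz).U_tx
  pd_two z hz :=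
    (pd_comm (φ.contDiffOn_component 2) φ.toMap.open_source hz 2 1).trans (hφ z hz).U_xu

theorem isX_U_tt : IsX φ.toMap.source (pd 0 (pd 0 φ.U)) := by
  have hΩ := φ.toMap.open_source
  have hU := φ.contDiffOn_component 2
  have hU_t := contDiffOn_pd hU hΩ 0
  exact {
    smooth := contDiffOn_pd hU_t hΩ 0
    pd_zero := fun z hz => (hφ z hz).U_ttt
    pd_two := fun z hz => pd_pd_eq_zero hU_t hΩ hz
      (fun z hz => (pd_comm hU hΩ hz 2 0).trans (hφ z hz).U_tu) 0 }

end IsSpecial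

end PointTransformation

theorem EqOffSecondDerivatives.base_eq {j k : Jet} (h : EqOffSecondDerivatives j k) :
    k.base = j.base := by
  ext l
  fin_cases l
  exacts [h 0 (by simp), h 1 (by simp), h 2 (by simp)]

namespace PointTransformation

/-- The second prolongation of a transformation satisfying `IsSpecial`, in closed form. -/
noncomputable def specialProlongation (φ : PointTransformation 3) (j : Jet) : Jet :=
  ![φ.T j.base, φ.X j.base, φ.U j.base,
    (pd 0 φ.U j.base + j 3 * pd 2 φ.U j.base) / pd 0 φ.T j.base,
    (pd 1 φ.U j.base + j 4 * pd 2 φ.U j.base) / pd 1 φ.X j.base,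
    (pd 0 (pd 0 φ.U) j.base + j 5 * pd 2 φ.U j.base) / pd 0 φ.T j.base ^ 2,
    j 6 * pd 2 φ.U j.base / (pd 0 φ.T j.base * pd 1 φ.X j.base),
    (pd 1 (pd 1 φ.U) j.base + j 7 * pd 2 φ.U j.base
      - (pd 1 φ.U j.base + j 4 * pd 2 φ.U j.base) / pd 1 φ.X j.base * pd 1 (pd 1 φ.X) j.base)
      / pd 1 φ.X j.base ^ 2]

/-- The preimage under `φ` of the base point of a jet. -/
noncomputable def preimageBase (φ : PointTransformation 3) (j : Jet) : Base :=
  φ.toMap.symm j.base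

/-- The inverse of `specialProlongation φ`, expressed through derivatives of `φ` rather than of
its inverse. -/
noncomputable def specialProlongationInv (φ : PointTransformation 3) (j : Jet) : Jet :=
  let z := φ.preimageBase j
  ![z 0, z 1, z 2,
    (pd 0 φ.T z * j 3 - pd 0 φ.U z) / pd 2 φ.U z,
    (pd 1 φ.X z * j 4 - pd 1 φ.U z) / pd 2 φ.U z,
    (pd 0 φ.T z ^ 2 * j 5 - pd 0 (pd 0 φ.U) z) / pd 2 φ.U z,
    pd 0 φ.T z * pd 1 φ.X z * j 6 / pd 2 φ.U z,
    (pd 1 φ.X z ^ 2 * j 7 + j 4 * pd 1 (pd 1 φ.X) z - pd 1 (pd 1 φ.U) z) / pd 2 φ.U z]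

variable {φ : PointTransformation 3} {j k : Jet}

theorem base_specialProlongation : (φ.specialProlongation j).base = φ.toMap j.base := by
  ext k; fin_cases k <;> rfl

theorem base_specialProlongationInv : (φ.specialProlongationInv j).base = φ.preimageBase j := by
  ext k; fin_cases k <;> rfl

theorem preimageBase_specialProlongation (hj : j.base ∈ φ.toMap.source) :
    φ.preimageBase (φ.specialProlongation j) = j.base := by
  rw [preimageBase, base_specialProlongation, φ.toMap.left_inv hj]

theorem preimageBase_mem (hj : j.base ∈ φ.toMap.target) : φ.preimageBase j ∈ φ.toMap.source :=
  φ.toMap.map_target hj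

theorem eqOffSecondDerivatives_specialProlongationInv (h : EqOffSecondDerivatives j k) :
    EqOffSecondDerivatives (φ.specialProlongationInv j) (φ.specialProlongationInv k) := by
  intro i hi
  have hbase : φ.preimageBase k = φ.preimageBase j := by rw [preimageBase, h.base_eq, preimageBase]
  have h3 : k 3 = j 3 := h 3 (by simp)
  have h4 : k 4 = j 4 := h 4 (by simp)
  fin_cases i <;> first
    | simp [specialProlongationInv, hbase, h3, h4]; done
    | simp at hi

namespace IsSpecial

variable (hφ : φ.IsSpecial)
include hφ

theorem specialProlongationInv_specialProlongation (hj : j.base ∈ φ.toMap.source) :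
    φ.specialProlongationInv (φ.specialProlongation j) = j := by
  have hT := hφ.T_t_ne_zero hj
  have hX := hφ.X_x_ne_zero hj
  have hU := hφ.U_u_ne_zero hj
  ext k
  fin_cases k <;> simp only [specialProlongationInv, preimageBase_specialProlongation hj] <;>
    simp only [specialProlongation, Fin.reduceFinMk, Matrix.cons_val]
  · rfl
  · rfl
  · rfl
  all_goals field_simp
  all_goals ring

theorem specialProlongation_specialProlongationInv (hj : j.base ∈ φ.toMap.target) :
    φ.specialProlongation (φ.specialProlongationInv j) = j := by
  have hz := preimageBase_mem hj
  have hT := hφ.T_t_ne_zero hz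
  have hX := hφ.X_x_ne_zero hz
  have hU := hφ.U_u_ne_zero hz
  have hbase : φ.toMap (φ.preimageBase j) = j.base := φ.toMap.right_inv hj
  ext k
  fin_cases k <;> simp only [specialProlongation, base_specialProlongationInv]
  · exact congrFun hbase 0
  · exact congrFun hbase 1
  · exact congrFun hbase 2
  all_goals simp only [specialProlongationInv, Fin.reduceFinMk, Matrix.cons_val]
  all_goals field_simp
  all_goals ring

theorem totalJacobian_eq (hj : j.base ∈ φ.toMap.source) :
    totalJacobian φ.toMap j = pd 0 φ.T j.base * pd 1 φ.X j.base := by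
  have h := hφ _ hj
  rw [IsProjectableAt.totalJacobian_eq ⟨h.T_u, h.X_u⟩, h.X_t, zero_mul, sub_zero]

theorem prolongUt_eq (hj : j.base ∈ φ.toMap.source) : prolongUt φ.toMap j =
    (pd 0 φ.U j.base + j 3 * pd 2 φ.U j.base) / pd 0 φ.T j.base := by
  have h := hφ _ hj
  rw [prolongUt, hφ.totalJacobian_eq hj, Dt_of_pd_two_eq_zero h.X_u, Dx_of_pd_two_eq_zero h.X_u,
    h.X_t, mul_zero, sub_zero, mul_div_mul_right _ _ (hφ.X_x_ne_zero hj), Dt]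

theorem prolongUx_eq (hj : j.base ∈ φ.toMap.source) : prolongUx φ.toMap j =
    (pd 1 φ.U j.base + j 4 * pd 2 φ.U j.base) / pd 1 φ.X j.base := by
  have h := hφ _ hj
  rw [prolongUx, hφ.totalJacobian_eq hj, Dt_of_pd_two_eq_zero h.T_u, Dx_of_pd_two_eq_zero h.T_u,
    h.T_x, mul_zero, sub_zero, mul_comm (pd 0 φ.T j.base),
    mul_div_mul_right _ _ (hφ.T_t_ne_zero hj), Dx]

theorem pd_pd_T_eq_zero {z : Base} (hz : z ∈ φ.toMap.source) {i k : Fin 3}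
    (h : ¬(i = 0 ∧ k = 0)) : pd i (pd k φ.T) z = 0 := by
  have hΩ := φ.toMap.open_source
  have hT := φ.contDiffOn_component 0
  have hzero (l : Fin 3) (hl : l ≠ 0) (y) (hy : y ∈ φ.toMap.source) : pd l φ.T y = 0 := by
    fin_cases l
    exacts [absurd rfl hl, (hφ y hy).T_x, (hφ y hy).T_u]
  by_cases hk : k = 0
  · exact pd_pd_eq_zero hT hΩ hz (hzero i fun hi => h ⟨hi, hk⟩) k
  · exact pd_eq_zero_of_eqOn hΩ hz (hzero k hk) i

theorem pd_pd_X_eq_zero {z : Base} (hz : z ∈ φ.toMap.source) {i k : Fin 3}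
    (h : ¬(i = 1 ∧ k = 1)) : pd i (pd k φ.X) z = 0 := by
  have hΩ := φ.toMap.open_source
  have hX := φ.contDiffOn_component 1
  have hzero (l : Fin 3) (hl : l ≠ 1) (y) (hy : y ∈ φ.toMap.source) : pd l φ.X y = 0 := by
    fin_cases l
    exacts [(hφ y hy).X_t, absurd rfl hl, (hφ y hy).X_u]
  by_cases hk : k = 1
  · exact pd_pd_eq_zero hX hΩ hz (hzero i fun hi => h ⟨hi, hk⟩) k
  · exact pd_eq_zero_of_eqOn hΩ hz (hzero k hk) i

theorem residualTT_eq (hj : j.base ∈ φ.toMap.source) :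
    residualTT φ.toMap j = pd 0 (pd 0 φ.U) j.base + j 5 * pd 2 φ.U j.base := by
  have h := hφ _ hj
  simp [residualTT, Dtt, h.T_u, h.X_u, h.T_tt, h.U_uu, h.U_tu, hφ.pd_pd_T_eq_zero hj,
    hφ.pd_pd_X_eq_zero hj]

theorem residualTX_eq (hj : j.base ∈ φ.toMap.source) :
    residualTX φ.toMap j = j 6 * pd 2 φ.U j.base := by
  have h := hφ _ hj
  simp [residualTX, Dtx, h.T_u, h.X_u, h.U_uu, h.U_tu, h.U_xu, h.U_tx, hφ.pd_pd_T_eq_zero hj,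
    hφ.pd_pd_X_eq_zero hj]

theorem residualXX_eq (hj : j.base ∈ φ.toMap.source) :
    residualXX φ.toMap j = pd 1 (pd 1 φ.U) j.base + j 7 * pd 2 φ.U j.base
      - (pd 1 φ.U j.base + j 4 * pd 2 φ.U j.base) / pd 1 φ.X j.base
        * pd 1 (pd 1 φ.X) j.base := by
  have h := hφ _ hj
  simp [residualXX, Dxx, h.T_u, h.X_u, h.U_uu, h.U_xu, hφ.pd_pd_T_eq_zero hj,
    hφ.pd_pd_X_eq_zero hj, hφ.prolongUx_eq hj]

theorem secondProlongation_eq (hj : j.base ∈ φ.toMap.source) :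
    secondProlongation φ.toMap j = φ.specialProlongation j := by
  have h := hφ _ hj
  have hT := hφ.T_t_ne_zero hj
  have hX := hφ.X_x_ne_zero hj
  simp only [secondProlongation, specialProlongation, hφ.residualTT_eq hj, hφ.residualTX_eq hj,
    hφ.residualXX_eq hj, hφ.totalJacobian_eq hj, Dt_of_pd_two_eq_zero h.T_u,
    Dt_of_pd_two_eq_zero h.X_u, Dx_of_pd_two_eq_zero h.T_u, Dx_of_pd_two_eq_zero h.X_u, h.T_x,
    h.X_t, withSecondDerivatives, firstProlongation, hφ.prolongUt_eq hj, hφ.prolongUx_eq hj]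
  ext k
  fin_cases k <;> simp only [Fin.reduceFinMk, Matrix.cons_val]
  all_goals field_simp
  all_goals ring

theorem prolongs_iff (hj : j.base ∈ φ.toMap.source) :
    Prolongs φ.toMap j k ↔ k = φ.specialProlongation j := by
  rw [WaveClass.prolongs_iff, hφ.totalJacobian_eq hj, hφ.secondProlongation_eq hj]
  exact and_iff_right (mul_ne_zero (hφ.T_t_ne_zero hj) (hφ.X_x_ne_zero hj))

end IsSpecial

end PointTransformation

namespace PointTransformation

variable {φ : PointTransformation 3} {h : Base → ℝ} {z : Base} {j : Jet}

theorem isOpen_base_preimage_source : IsOpen (Jet.base ⁻¹' φ.toMap.source) :=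
  φ.toMap.open_source.preimage contDiff_base.continuous

theorem isOpen_base_preimage_target : IsOpen (Jet.base ⁻¹' φ.toMap.target) :=
  φ.toMap.open_target.preimage contDiff_base.continuous

theorem contDiffOn_comp_symm (hh : ContDiffOn ℝ ∞ h φ.toMap.source) :
    ContDiffOn ℝ ∞ (fun z => h (φ.toMap.symm z)) φ.toMap.target :=
  hh.comp φ.smooth_symm fun _ hz => φ.toMap.map_target hz

theorem contDiffOn_comp_preimageBase (hh : ContDiffOn ℝ ∞ h φ.toMap.source) :
    ContDiffOn ℝ ∞ (fun j => h (φ.preimageBase j)) (Jet.base ⁻¹' φ.toMap.target) :=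
  contDiffOn_comp_base (contDiffOn_comp_symm hh)

theorem pd_eq_sum_pd_symm (hh : ContDiffOn ℝ ∞ h φ.toMap.source) (hz : z ∈ φ.toMap.source)
    (i : Fin 3) :
    pd i h z = ∑ l, pd i (component φ.toMap l) z
      * pd l (fun z => h (φ.toMap.symm z)) (φ.toMap z) := by
  have hΩ := φ.toMap.open_source
  have hsymm := differentiableAt_of_contDiffOn (contDiffOn_comp_symm hh) φ.toMap.open_target
    (φ.toMap.map_source hz)
  exact (hasPd_of_contDiffOn hh hΩ hz i).eq_of_eqOn
    (HasPd.comp_pi hsymm fun l => hasPd_of_contDiffOn (φ.contDiffOn_component l) hΩ hz i) hΩ hz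
    fun y hy => by rw [φ.toMap.left_inv hy]

namespace IsSpecial

variable (hφ : φ.IsSpecial)
include hφ

theorem contDiffOn_specialProlongation :
    ContDiffOn ℝ ∞ φ.specialProlongation (Jet.base ⁻¹' φ.toMap.source) := by
  have hT (j : Jet) (hj : j ∈ Jet.base ⁻¹' φ.toMap.source) := hφ.T_t_ne_zero hj
  have hX (j : Jet) (hj : j ∈ Jet.base ⁻¹' φ.toMap.source) := hφ.X_x_ne_zero hj
  have coord (i : Fin 8) := (contDiff_apply (n := ∞) ℝ ℝ i).contDiffOn
    (s := Jet.base ⁻¹' φ.toMap.source)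
  have smooth_pd (i k : Fin 3) := contDiffOn_pd (φ.contDiffOn_component k) φ.toMap.open_source i
  have comp (k : Fin 3) := contDiffOn_comp_base (φ.contDiffOn_component k)
  have comp_pd (i k : Fin 3) := contDiffOn_comp_base (smooth_pd i k)
  have comp_pd_pd (i k : Fin 3) :=
    contDiffOn_comp_base (contDiffOn_pd (smooth_pd i k) φ.toMap.open_source i)
  have prolongUx := ((comp_pd 1 2).add ((coord 4).mul (comp_pd 2 2))).div (comp_pd 1 1) hX
  rw [contDiffOn_pi]
  intro k
  fin_cases k
  · exact comp 0
  · exact comp 1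
  · exact comp 2
  · exact ((comp_pd 0 2).add ((coord 3).mul (comp_pd 2 2))).div (comp_pd 0 0) hT
  · exact prolongUx
  · exact ((comp_pd_pd 0 2).add ((coord 5).mul (comp_pd 2 2))).div ((comp_pd 0 0).pow 2)
      fun j hj => pow_ne_zero 2 (hT j hj)
  · exact ((coord 6).mul (comp_pd 2 2)).div ((comp_pd 0 0).mul (comp_pd 1 1))
      fun j hj => mul_ne_zero (hT j hj) (hX j hj)
  · exact (((comp_pd_pd 1 2).add ((coord 7).mul (comp_pd 2 2))).sub
      (prolongUx.mul (comp_pd_pd 1 1))).div ((comp_pd 1 1).pow 2)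
      fun j hj => pow_ne_zero 2 (hX j hj)

theorem contDiffOn_specialProlongationInv :
    ContDiffOn ℝ ∞ φ.specialProlongationInv (Jet.base ⁻¹' φ.toMap.target) := by
  have hU (j : Jet) (hj : j ∈ Jet.base ⁻¹' φ.toMap.target) := hφ.U_u_ne_zero (preimageBase_mem hj)
  have coord (i : Fin 8) := (contDiff_apply (n := ∞) ℝ ℝ i).contDiffOn
    (s := Jet.base ⁻¹' φ.toMap.target)
  have smooth_pd (i k : Fin 3) := contDiffOn_pd (φ.contDiffOn_component k) φ.toMap.open_source i
  have base_coord (k : Fin 3) :=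
    contDiffOn_comp_preimageBase (φ := φ) (contDiff_apply ℝ ℝ k).contDiffOn
  have comp_pd (i k : Fin 3) := contDiffOn_comp_preimageBase (smooth_pd i k)
  have comp_pd_pd (i k : Fin 3) :=
    contDiffOn_comp_preimageBase (contDiffOn_pd (smooth_pd i k) φ.toMap.open_source i)
  rw [contDiffOn_pi]
  intro k
  fin_cases k
  · exact base_coord 0
  · exact base_coord 1
  · exact base_coord 2
  · exact (((comp_pd 0 0).mul (coord 3)).sub (comp_pd 0 2)).div (comp_pd 2 2) hU
  · exact (((comp_pd 1 1).mul (coord 4)).sub (comp_pd 1 2)).div (comp_pd 2 2) hU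
  · exact ((((comp_pd 0 0).pow 2).mul (coord 5)).sub (comp_pd_pd 0 2)).div (comp_pd 2 2) hU
  · exact (((comp_pd 0 0).mul (comp_pd 1 1)).mul (coord 6)).div (comp_pd 2 2) hU
  · exact (((((comp_pd 1 1).pow 2).mul (coord 7)).add ((coord 4).mul (comp_pd_pd 1 1))).sub
      (comp_pd_pd 1 2)).div (comp_pd 2 2) hU

theorem isX_comp_symm (hh : IsX φ.toMap.source h) :
    IsX φ.toMap.target (fun z => h (φ.toMap.symm z)) := by
  have hzero (z) (hz : z ∈ φ.toMap.source) :
      pd 0 (fun z => h (φ.toMap.symm z)) (φ.toMap z) = 0 ∧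
        pd 2 (fun z => h (φ.toMap.symm z)) (φ.toMap z) = 0 := by
    have hs := hφ z hz
    have h0 := pd_eq_sum_pd_symm hh.smooth hz 0
    have h2 := pd_eq_sum_pd_symm hh.smooth hz 2
    rw [Fin.sum_univ_three, hs.T_u, hs.X_u, hh.pd_two z hz, zero_mul, zero_mul, zero_add,
      zero_add] at h2
    have hpd_two := (mul_eq_zero.1 h2.symm).resolve_left (hφ.U_u_ne_zero hz)
    rw [Fin.sum_univ_three, hs.X_t, hh.pd_zero z hz, hpd_two, zero_mul, mul_zero, add_zero,
      add_zero] at h0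
    exact ⟨(mul_eq_zero.1 h0.symm).resolve_left (hφ.T_t_ne_zero hz), hpd_two⟩
  have hmem (z) (hz : z ∈ φ.toMap.target) := hzero _ (φ.toMap.map_target hz)
  refine ⟨contDiffOn_comp_symm hh.smooth, fun z hz => ?_, fun z hz => ?_⟩
  · simpa only [φ.toMap.right_inv hz] using (hmem z hz).1
  · simpa only [φ.toMap.right_inv hz] using (hmem z hz).2

end IsSpecial

end PointTransformation

theorem IsX.isXUx_comp_base {Ω : Set Base} {h : Base → ℝ} (hh : IsX Ω h) (hΩ : IsOpen Ω) :
    IsXUx (Jet.base ⁻¹' Ω) (fun j => h j.base) := by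
  refine isXUx_of_hasPd (hΩ.preimage contDiff_base.continuous) (contDiffOn_comp_base hh.smooth)
    fun j hj i h1 _ => ?_
  have hasPd_h (k : Fin 3) := hasPd_of_contDiffOn hh.smooth hΩ hj k
  by_cases hi : 3 ≤ (i : ℕ)
  · exact hasPd_comp_base_fiber h j hi
  obtain rfl | rfl | rfl : i = 0 ∨ i = 1 ∨ i = 2 := by
    simp only [Fin.ext_iff, Fin.val_zero, Fin.val_one, Fin.val_two]; omega
  · exact ((hasPd_h 0).comp_base rfl).congr_deriv (hh.pd_zero _ hj)
  · exact absurd rfl h1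
  · exact ((hasPd_h 2).comp_base rfl).congr_deriv (hh.pd_two _ hj)

namespace PointTransformation.IsSpecial

variable {φ : PointTransformation 3} {h : Base → ℝ} (hφ : φ.IsSpecial)
include hφ

theorem isXUx_comp_preimageBase (hh : IsX φ.toMap.source h) :
    IsXUx (Jet.base ⁻¹' φ.toMap.target) (fun j => h (φ.preimageBase j)) :=
  (hφ.isX_comp_symm hh).isXUx_comp_base φ.toMap.open_target

theorem isXUx_specialProlongationInv_four :
    IsXUx (Jet.base ⁻¹' φ.toMap.target) (fun j => φ.specialProlongationInv j 4) := by
  have hA := φ.isOpen_base_preimage_target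
  exact (((hφ.isXUx_comp_preimageBase (hφ.isX_X.pd φ.toMap.open_source 1)).mul hA
    (isXUx_coord_four hA)).sub hA (hφ.isXUx_comp_preimageBase hφ.isX_U_x)).div hA
    (hφ.isXUx_comp_preimageBase hφ.isX_U_u) fun j hj => hφ.U_u_ne_zero (preimageBase_mem hj)

theorem isXUx_comp_specialProlongationInv {A : Set Jet} {F : Jet → ℝ} (hA : IsOpen A)
    (hF : IsXUx A F) :
    IsXUx (Jet.base ⁻¹' φ.toMap.target ∩ φ.specialProlongationInv ⁻¹' A)
      (fun j => F (φ.specialProlongationInv j)) := by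
  have htarget := φ.isOpen_base_preimage_target
  have hsmooth := hφ.contDiffOn_specialProlongationInv
  have hx := hφ.isXUx_comp_preimageBase (isX_coord_one _)
  refine isXUx_of_hasPd (hsmooth.continuousOn.isOpen_inter_preimage htarget hA)
    (hF.smooth.comp (hsmooth.mono Set.inter_subset_left) fun j hj => hj.2) fun j hj i h1 h4 => ?_
  exact (hF.hasPd_comp hA hj.2 (differentiableAt_of_contDiffOn hsmooth htarget hj.1)
    (hx.hasPd_eq_zero htarget hj.1 h1 h4)
    (hφ.isXUx_specialProlongationInv_four.hasPd_eq_zero htarget hj.1 h1 h4)).congr_deriv (by ring)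

end PointTransformation.IsSpecial

namespace PointTransformation

/-- The transformation of the value of the coefficient `f` over the point `z` that is induced by
a transformation `φ` satisfying `IsSpecial`. -/
noncomputable def transformF (φ : PointTransformation 3) (z : Base) (a : ℝ) : ℝ :=
  a * pd 1 φ.X z ^ 2 / pd 0 φ.T z ^ 2

/-- The transformation of the value `b` of the term `g` over the point `z` that is induced by a
transformation `φ` satisfying `IsSpecial`; `a` is the value of `f`, and `q` is the transformed
value `ũ_x̃`. -/
noncomputable def transformG (φ : PointTransformation 3) (z : Base) (q a b : ℝ) : ℝ :=
  (pd 2 φ.U z * b + pd 0 (pd 0 φ.U) z - a * (pd 1 (pd 1 φ.U) z - q * pd 1 (pd 1 φ.X) z))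
    / pd 0 φ.T z ^ 2

namespace IsSpecial

variable {φ : PointTransformation 3} (hφ : φ.IsSpecial)
include hφ

section Smoothness

variable {E : Type*} [NormedAddCommGroup E] [NormedSpace ℝ E] {A : Set E} {β : E → Base}
  {q a b : E → ℝ}

theorem contDiffOn_transformF (hβ : ContDiffOn ℝ ∞ β A) (hmaps : Set.MapsTo β A φ.toMap.source)
    (ha : ContDiffOn ℝ ∞ a A) : ContDiffOn ℝ ∞ (fun w => φ.transformF (β w) (a w)) A := by
  have smooth_pd (i k : Fin 3) : ContDiffOn ℝ ∞ (fun w => pd i (component φ.toMap k) (β w)) A :=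
    (contDiffOn_pd (φ.contDiffOn_component k) φ.toMap.open_source i).comp hβ hmaps
  exact (ha.mul ((smooth_pd 1 1).pow 2)).div ((smooth_pd 0 0).pow 2)
    fun w hw => pow_ne_zero 2 (hφ.T_t_ne_zero (hmaps hw))

theorem contDiffOn_transformG (hβ : ContDiffOn ℝ ∞ β A) (hmaps : Set.MapsTo β A φ.toMap.source)
    (hq : ContDiffOn ℝ ∞ q A) (ha : ContDiffOn ℝ ∞ a A) (hb : ContDiffOn ℝ ∞ b A) :
    ContDiffOn ℝ ∞ (fun w => φ.transformG (β w) (q w) (a w) (b w)) A := by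
  have hpd (i k : Fin 3) := contDiffOn_pd (φ.contDiffOn_component k) φ.toMap.open_source i
  have smooth_pd (i k : Fin 3) := (hpd i k).comp hβ hmaps
  have smooth_pd_pd (i k : Fin 3) :=
    (contDiffOn_pd (hpd i k) φ.toMap.open_source i).comp hβ hmaps
  exact ((((smooth_pd 2 2).mul hb).add (smooth_pd_pd 0 2)).sub
    (ha.mul ((smooth_pd_pd 1 2).sub (hq.mul (smooth_pd_pd 1 1))))).div ((smooth_pd 0 0).pow 2)
    fun w hw => pow_ne_zero 2 (hφ.T_t_ne_zero (hmaps hw))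

end Smoothness

theorem isOpen_imageDom {A : Set Jet} (hA : IsOpen A) :
    IsOpen (Jet.base ⁻¹' φ.toMap.target ∩ φ.specialProlongationInv ⁻¹' A) :=
  hφ.contDiffOn_specialProlongationInv.continuousOn.isOpen_inter_preimage
    φ.isOpen_base_preimage_target hA

/-- The image of the arbitrary elements `θ` under the transformation induced by `φ`. -/
noncomputable def imageElements (θ : ArbitraryElements) : ArbitraryElements where
  dom := Jet.base ⁻¹' φ.toMap.target ∩ φ.specialProlongationInv ⁻¹' θ.dom
  isOpen_dom := hφ.isOpen_imageDom θ.isOpen_dom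
  free_dom := by
    rintro j ⟨hj, hj'⟩ k (h : EqOffSecondDerivatives j k)
    refine ⟨?_, θ.free_dom _ hj' _ (eqOffSecondDerivatives_specialProlongationInv h)⟩
    rwa [Set.mem_preimage, h.base_eq]
  f := fun j => φ.transformF (φ.preimageBase j) (θ.f (φ.specialProlongationInv j))
  g := fun j => φ.transformG (φ.preimageBase j) (j 4) (θ.f (φ.specialProlongationInv j))
    (θ.g (φ.specialProlongationInv j))
  smooth_f := by
    have hinv := hφ.contDiffOn_specialProlongationInv.mono
      (Set.inter_subset_left (t := φ.specialProlongationInv ⁻¹' θ.dom))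
    have hβ := (contDiffOn_comp_base φ.smooth_symm).mono
      (Set.inter_subset_left (t := φ.specialProlongationInv ⁻¹' θ.dom))
    exact hφ.contDiffOn_transformF hβ (fun j hj => preimageBase_mem hj.1)
      (θ.smooth_f.comp hinv fun j hj => hj.2)
  smooth_g := by
    have hinv := hφ.contDiffOn_specialProlongationInv.mono
      (Set.inter_subset_left (t := φ.specialProlongationInv ⁻¹' θ.dom))
    have hβ := (contDiffOn_comp_base φ.smooth_symm).mono
      (Set.inter_subset_left (t := φ.specialProlongationInv ⁻¹' θ.dom))
    exact hφ.contDiffOn_transformG hβ (fun j hj => preimageBase_mem hj.1)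
      (contDiff_apply ℝ ℝ 4).contDiffOn (θ.smooth_f.comp hinv fun j hj => hj.2)
      (θ.smooth_g.comp hinv fun j hj => hj.2)

variable {θ : ArbitraryElements} {j : Jet}

theorem specialProlongation_mem_imageElements_dom_iff (hz : j.base ∈ φ.toMap.source) :
    φ.specialProlongation j ∈ (hφ.imageElements θ).dom ↔ j ∈ θ.dom := by
  have htarget : φ.specialProlongation j ∈ Jet.base ⁻¹' φ.toMap.target := by
    rw [Set.mem_preimage, base_specialProlongation]
    exact φ.toMap.map_source hz
  simp only [imageElements, Set.mem_inter_iff, htarget, true_and, Set.mem_preimage,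
    hφ.specialProlongationInv_specialProlongation hz]

theorem imageElements_f (hz : j.base ∈ φ.toMap.source) :
    (hφ.imageElements θ).f (φ.specialProlongation j) = φ.transformF j.base (θ.f j) := by
  simp only [imageElements, preimageBase_specialProlongation hz,
    hφ.specialProlongationInv_specialProlongation hz]

theorem imageElements_g (hz : j.base ∈ φ.toMap.source) :
    (hφ.imageElements θ).g (φ.specialProlongation j)
      = φ.transformG j.base (φ.specialProlongation j 4) (θ.f j) (θ.g j) := by
  simp only [imageElements, preimageBase_specialProlongation hz,
    hφ.specialProlongationInv_specialProlongation hz]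

theorem isXUx_comp_preimageBase_imageElements {h : Base → ℝ} (hh : IsX φ.toMap.source h) :
    IsXUx (hφ.imageElements θ).dom (fun j => h (φ.preimageBase j)) :=
  (hφ.isXUx_comp_preimageBase hh).mono Set.inter_subset_left

theorem isXUx_imageElements_f (hf : IsXUx θ.dom θ.f) :
    IsXUx (hφ.imageElements θ).dom (hφ.imageElements θ).f := by
  have hA := (hφ.imageElements θ).isOpen_dom
  exact ((hφ.isXUx_comp_specialProlongationInv θ.isOpen_dom hf).mul hA
    ((hφ.isXUx_comp_preimageBase_imageElements (hφ.isX_X.pd φ.toMap.open_source 1)).sq hA)).div hA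
    ((hφ.isXUx_comp_preimageBase_imageElements hφ.isX_T_t).sq hA)
    fun j hj => pow_ne_zero 2 (hφ.T_t_ne_zero (preimageBase_mem hj.1))

theorem isXUx_imageElements_g (hf : IsXUx θ.dom θ.f) (hg : IsXUx θ.dom θ.g) :
    IsXUx (hφ.imageElements θ).dom (hφ.imageElements θ).g := by
  have hA := (hφ.imageElements θ).isOpen_dom
  have hΩ := φ.toMap.open_source
  have hT_t := hφ.isXUx_comp_preimageBase_imageElements (θ := θ) hφ.isX_T_t
  have hU_u := hφ.isXUx_comp_preimageBase_imageElements (θ := θ) hφ.isX_U_u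
  have hU_tt := hφ.isXUx_comp_preimageBase_imageElements (θ := θ) hφ.isX_U_tt
  have hU_xx := hφ.isXUx_comp_preimageBase_imageElements (θ := θ) (hφ.isX_U_x.pd hΩ 1)
  have hX_xx := hφ.isXUx_comp_preimageBase_imageElements (θ := θ) ((hφ.isX_X.pd hΩ 1).pd hΩ 1)
  have hf' := hφ.isXUx_comp_specialProlongationInv θ.isOpen_dom hf
  have hg' := hφ.isXUx_comp_specialProlongationInv θ.isOpen_dom hg
  exact (((hU_u.mul hA hg').add hA hU_tt).sub hA
    (hf'.mul hA (hU_xx.sub hA ((isXUx_coord_four hA).mul hA hX_xx)))).div hA (hT_t.sq hA)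
    fun j hj => pow_ne_zero 2 (hφ.T_t_ne_zero (preimageBase_mem hj.1))

section Derivatives

theorem hasPd_specialProlongation_four (hj : j.base ∈ φ.toMap.source) :
    HasPd 4 (fun j => φ.specialProlongation j 4) j (pd 2 φ.U j.base / pd 1 φ.X j.base) := by
  have hX := hφ.X_x_ne_zero hj
  have base (h : Base → ℝ) : HasPd 4 (fun j : Jet => h j.base) j 0 :=
    hasPd_comp_base_fiber h j (by simp)
  exact (((base (pd 1 φ.U)).add (hasPd_coord_self.mul (base (pd 2 φ.U)))).div
    (base (pd 1 φ.X)) hX).congr_deriv (by field_simp; ring)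

theorem hasPd_comp_specialProlongation {A : Set Jet} {F : Jet → ℝ} (hF : IsXUx A F)
    (hA : IsOpen A) (hj : j.base ∈ φ.toMap.source) (hmem : φ.specialProlongation j ∈ A) :
    HasPd 4 (fun j => F (φ.specialProlongation j)) j
      (pd 2 φ.U j.base / pd 1 φ.X j.base * pd 4 F (φ.specialProlongation j)) :=
  (hF.hasPd_comp hA hmem (differentiableAt_of_contDiffOn hφ.contDiffOn_specialProlongation
    φ.isOpen_base_preimage_source hj) (hasPd_comp_base_fiber φ.X j (by simp))
    (hφ.hasPd_specialProlongation_four hj)).congr_deriv (by ring)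

variable {A : Set Jet} (hA : IsOpen A) (hAθ : A ⊆ θ.dom)
  (hAφ : A ⊆ Jet.base ⁻¹' φ.toMap.source) (hj : j ∈ A)
include hA hAθ hAφ hj

theorem f_ux_eq_zero_of_imageElements (hf : IsXUx θ.dom θ.f)
    (hzero : pd 4 (hφ.imageElements θ).f (φ.specialProlongation j) = 0) : pd 4 θ.f j = 0 := by
  have base (h : Base → ℝ) : HasPd 4 (fun j : Jet => h j.base) j 0 :=
    hasPd_comp_base_fiber h j (by simp)
  have hpull := hφ.hasPd_comp_specialProlongation (hφ.isXUx_imageElements_f hf)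
    (hφ.imageElements θ).isOpen_dom (hAφ hj)
    ((hφ.specialProlongation_mem_imageElements_dom_iff (hAφ hj)).2 (hAθ hj))
  have hderiv := HasPd.eq_of_eqOn (hpull.mul (base (pd 0 φ.T)).sq)
    ((hf.hasPd (hAθ hj) 4).mul (base (pd 1 φ.X)).sq) hA hj fun k hk => by
      rw [hφ.imageElements_f (hAφ hk), transformF,
        div_mul_cancel₀ _ (pow_ne_zero 2 (hφ.T_t_ne_zero (hAφ hk)))]
  rw [hzero] at hderiv
  exact mul_left_cancel₀ (pow_ne_zero 2 (hφ.X_x_ne_zero (hAφ hj)))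
    (by linear_combination -hderiv)

variable (hf : IsXUx θ.dom θ.f) (hg : IsXUx θ.dom θ.g) (hf_ux : ∀ k ∈ A, pd 4 θ.f k = 0)
include hf hg hf_ux

theorem imageElements_g_ux :
    pd 4 (hφ.imageElements θ).g (φ.specialProlongation j) * pd 0 φ.T j.base ^ 2
      = pd 1 φ.X j.base * pd 4 θ.g j + θ.f j * pd 1 (pd 1 φ.X) j.base := by
  have hX := hφ.X_x_ne_zero (hAφ hj)
  have hU := hφ.U_u_ne_zero (hAφ hj)
  have base (h : Base → ℝ) : HasPd 4 (fun j : Jet => h j.base) j 0 :=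
    hasPd_comp_base_fiber h j (by simp)
  have hpull := hφ.hasPd_comp_specialProlongation (hφ.isXUx_imageElements_g hf hg)
    (hφ.imageElements θ).isOpen_dom (hAφ hj)
    ((hφ.specialProlongation_mem_imageElements_dom_iff (hAφ hj)).2 (hAθ hj))
  have hderiv := HasPd.eq_of_eqOn (hpull.mul (base (pd 0 φ.T)).sq)
    ((((base (pd 2 φ.U)).mul (hg.hasPd (hAθ hj) 4)).add (base (pd 0 (pd 0 φ.U)))).sub
      (((hf.hasPd (hAθ hj) 4).congr_deriv (hf_ux j hj)).mul ((base (pd 1 (pd 1 φ.U))).sub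
        ((hφ.hasPd_specialProlongation_four (hAφ hj)).mul (base (pd 1 (pd 1 φ.X)))))))
    hA hj fun k hk => by
      rw [hφ.imageElements_g (hAφ hk), transformG,
        div_mul_cancel₀ _ (pow_ne_zero 2 (hφ.T_t_ne_zero (hAφ hk)))]
  field_simp at hderiv
  exact mul_left_cancel₀ hU (by linear_combination hderiv)

theorem g_uxux_eq_zero_of_imageElements
    (hzero : pd 4 (pd 4 (hφ.imageElements θ).g) (φ.specialProlongation j) = 0) :
    pd 4 (pd 4 θ.g) j = 0 := by
  have base (h : Base → ℝ) : HasPd 4 (fun j : Jet => h j.base) j 0 :=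
    hasPd_comp_base_fiber h j (by simp)
  have hdom := (hφ.imageElements θ).isOpen_dom
  have hpull := hφ.hasPd_comp_specialProlongation ((hφ.isXUx_imageElements_g hf hg).pd_four hdom)
    hdom (hAφ hj) ((hφ.specialProlongation_mem_imageElements_dom_iff (hAφ hj)).2 (hAθ hj))
  have hderiv := HasPd.eq_of_eqOn (hpull.mul (base (pd 0 φ.T)).sq)
    (((base (pd 1 φ.X)).mul ((hg.pd_four θ.isOpen_dom).hasPd (hAθ hj) 4)).add
      (((hf.hasPd (hAθ hj) 4).congr_deriv (hf_ux j hj)).mul (base (pd 1 (pd 1 φ.X)))))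
    hA hj fun k hk => hφ.imageElements_g_ux hA hAθ hAφ hk hf hg hf_ux
  rw [hzero] at hderiv
  exact mul_left_cancel₀ (hφ.X_x_ne_zero (hAφ hj)) (by linear_combination -hderiv)

end Derivatives

theorem imageElements_mem_waveClass (hθ : θ ∈ waveClass) : hφ.imageElements θ ∈ waveClass := by
  have hf := isXUx_f hθ
  have hg := isXUx_g hθ
  refine ⟨(hφ.isXUx_imageElements_f hf).dep, (hφ.isXUx_imageElements_g hf hg).dep,
    fun j hj => ?_, fun V hV hVdom ⟨k, hk⟩ => ?_⟩
  · have hz := preimageBase_mem hj.1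
    exact div_ne_zero (mul_ne_zero (hθ.2.2.1 _ hj.2) (pow_ne_zero 2 (hφ.X_x_ne_zero hz)))
      (pow_ne_zero 2 (hφ.T_t_ne_zero hz))
  by_contra! hzero
  set A := θ.dom ∩ (Jet.base ⁻¹' φ.toMap.source ∩ φ.specialProlongation ⁻¹' V)
  have hA : IsOpen A := θ.isOpen_dom.inter
    (hφ.contDiffOn_specialProlongation.continuousOn.isOpen_inter_preimage
      φ.isOpen_base_preimage_source hV)
  have hAθ : A ⊆ θ.dom := Set.inter_subset_left
  have hAφ : A ⊆ Jet.base ⁻¹' φ.toMap.source := fun j hj => hj.2.1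
  have hA_nonempty : A.Nonempty := by
    refine ⟨φ.specialProlongationInv k, (hVdom hk).2, ?_, ?_⟩
    · rw [Set.mem_preimage, base_specialProlongationInv]
      exact preimageBase_mem (hVdom hk).1
    · rwa [Set.mem_preimage, hφ.specialProlongation_specialProlongationInv (hVdom hk).1]
  have hf_ux (j) (hj : j ∈ A) : pd 4 θ.f j = 0 :=
    hφ.f_ux_eq_zero_of_imageElements hA hAθ hAφ hj hf (Prod.mk.inj (hzero _ hj.2.2)).1
  obtain ⟨j, hj, hne⟩ := hθ.2.2.2 A hA hAθ hA_nonempty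
  exact hne (Prod.ext (hf_ux j hj) (hφ.g_uxux_eq_zero_of_imageElements hA hAθ hAφ hj hf hg hf_ux
    (Prod.mk.inj (hzero _ hj.2.2)).2))

theorem specialProlongation_mem_imageElements_equation_iff (hz : j.base ∈ φ.toMap.source) :
    φ.specialProlongation j ∈ (hφ.imageElements θ).equation ↔ j ∈ θ.equation := by
  refine and_congr (hφ.specialProlongation_mem_imageElements_dom_iff hz) ?_
  have hT := hφ.T_t_ne_zero hz
  have hX := hφ.X_x_ne_zero hz
  have hU := hφ.U_u_ne_zero hz
  have utt : φ.specialProlongation j 5 = (pd 0 (pd 0 φ.U) j.base + j 5 * pd 2 φ.U j.base)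
    / pd 0 φ.T j.base ^ 2 := rfl
  have uxx : φ.specialProlongation j 7 = (pd 1 (pd 1 φ.U) j.base + j 7 * pd 2 φ.U j.base
    - φ.specialProlongation j 4 * pd 1 (pd 1 φ.X) j.base) / pd 1 φ.X j.base ^ 2 := rfl
  rw [hφ.imageElements_f hz, hφ.imageElements_g hz, transformF, transformG, utt, uxx]
  field_simp
  exact ⟨fun h => mul_left_cancel₀ hU (by linear_combination h),
    fun h => by linear_combination pd 2 φ.U j.base * h⟩

theorem mapsEquation_imageElements (hdom : ∀ j ∈ θ.dom, j.base ∈ φ.toMap.source) :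
    MapsEquation φ θ (hφ.imageElements θ) := by
  refine ⟨hdom, Set.ext fun j' => ⟨?_, fun hj' => ?_⟩⟩
  · rintro ⟨j, hj, hp⟩
    obtain rfl := (hφ.prolongs_iff (hdom j hj.1)).1 hp
    exact (hφ.specialProlongation_mem_imageElements_equation_iff (hdom j hj.1)).2 hj
  · have hbase := hdom _ hj'.1.2
    have hinv := hφ.specialProlongation_specialProlongationInv hj'.1.1
    refine ⟨φ.specialProlongationInv j', ?_, (hφ.prolongs_iff hbase).2 hinv.symm⟩
    rwa [← hφ.specialProlongation_mem_imageElements_equation_iff hbase, hinv]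

end IsSpecial

end PointTransformation

/-- The point of the space over the jet space with jet `j` and values `f = a`, `g = b`. -/
def Ext.ofJet (j : Jet) (a b : ℝ) : Ext := ![j 0, j 1, j 2, j 3, j 4, j 5, j 6, j 7, a, b]

section OfJet

variable {w : Ext} {j k : Jet} {a b : ℝ}

theorem Ext.jet_ofJet (j : Jet) (a b : ℝ) : (Ext.ofJet j a b).jet = j := by
  ext k; fin_cases k <;> rfl

theorem Ext.ofJet_jet (ha : w 8 = a) (hb : w 9 = b) : Ext.ofJet w.jet a b = w := by
  subst ha hb
  ext k; fin_cases k <;> rfl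

theorem ArbitraryElements.ofJet_mem_graph_iff {θ : ArbitraryElements} :
    Ext.ofJet j a b ∈ θ.graph ↔ j ∈ θ.dom ∧ a = θ.f j ∧ b = θ.g j := by
  rw [graph, Set.mem_ofPred_eq, Ext.jet_ofJet]
  rfl

theorem EqOffSecondDerivatives.ofJet (h : EqOffSecondDerivatives j k) (a b : ℝ) :
    EqOffSecondDerivatives (Ext.ofJet j a b) (Ext.ofJet k a b) := by
  intro i hi
  fin_cases i <;> first
    | rfl
    | exact h 0 (by simp)
    | exact h 1 (by simp)
    | exact h 2 (by simp)
    | exact h 3 (by simp)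
    | exact h 4 (by simp)
    | simp at hi

theorem contDiff_jet : ContDiff ℝ ∞ Ext.jet := by
  rw [contDiff_pi]; intro k; unfold Ext.jet; fun_prop

theorem continuous_base_jet : Continuous fun w : Ext => w.jet.base :=
  contDiff_base.continuous.comp contDiff_jet.continuous

theorem contDiffOn_ofJet {n : ℕ} {A : Set (Fin n → ℝ)} {J : (Fin n → ℝ) → Jet}
    {a b : (Fin n → ℝ) → ℝ} (hJ : ContDiffOn ℝ ∞ J A) (ha : ContDiffOn ℝ ∞ a A)
    (hb : ContDiffOn ℝ ∞ b A) : ContDiffOn ℝ ∞ (fun w => Ext.ofJet (J w) (a w) (b w)) A := by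
  have h := contDiffOn_pi.1 hJ
  rw [contDiffOn_pi]
  intro k
  fin_cases k
  exacts [h 0, h 1, h 2, h 3, h 4, h 5, h 6, h 7, ha, hb]

end OfJet

namespace PointTransformation

/-- The transformation of the space of jets and arbitrary elements induced by a transformation
`φ` satisfying `IsSpecial`. -/
noncomputable def specialLiftMap (φ : PointTransformation 3) (w : Ext) : Ext :=
  Ext.ofJet (φ.specialProlongation w.jet) (φ.transformF w.jet.base (w 8))
    (φ.transformG w.jet.base (φ.specialProlongation w.jet 4) (w 8) (w 9))

/-- The inverse of `specialLiftMap φ`. -/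
noncomputable def specialLiftMapInv (φ : PointTransformation 3) (w : Ext) : Ext :=
  let z := φ.preimageBase w.jet
  let a := w 8 * pd 0 φ.T z ^ 2 / pd 1 φ.X z ^ 2
  Ext.ofJet (φ.specialProlongationInv w.jet) a
    ((w 9 * pd 0 φ.T z ^ 2 - pd 0 (pd 0 φ.U) z
      + a * (pd 1 (pd 1 φ.U) z - w.jet 4 * pd 1 (pd 1 φ.X) z)) / pd 2 φ.U z)

variable {φ : PointTransformation 3} {θ : ArbitraryElements} {w : Ext}

theorem jet_specialLiftMap : (φ.specialLiftMap w).jet = φ.specialProlongation w.jet :=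
  Ext.jet_ofJet _ _ _

theorem jet_specialLiftMapInv : (φ.specialLiftMapInv w).jet = φ.specialProlongationInv w.jet :=
  Ext.jet_ofJet _ _ _

namespace IsSpecial

variable (hφ : φ.IsSpecial)
include hφ

theorem specialLiftMapInv_specialLiftMap (hw : w.jet.base ∈ φ.toMap.source) :
    φ.specialLiftMapInv (φ.specialLiftMap w) = w := by
  have hT := hφ.T_t_ne_zero hw
  have hX := hφ.X_x_ne_zero hw
  have hU := hφ.U_u_ne_zero hw
  have h8 : φ.specialLiftMap w 8 = φ.transformF w.jet.base (w 8) := rfl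
  have h9 : φ.specialLiftMap w 9
    = φ.transformG w.jet.base (φ.specialProlongation w.jet 4) (w 8) (w 9) := rfl
  simp only [specialLiftMapInv, jet_specialLiftMap, preimageBase_specialProlongation hw,
    hφ.specialProlongationInv_specialProlongation hw, h8, h9, transformF, transformG]
  refine Ext.ofJet_jet ?_ ?_
  · field_simp
  · field_simp
    ring

theorem specialLiftMap_specialLiftMapInv (hw : w.jet.base ∈ φ.toMap.target) :
    φ.specialLiftMap (φ.specialLiftMapInv w) = w := by
  have hT := hφ.T_t_ne_zero (preimageBase_mem hw)
  have hX := hφ.X_x_ne_zero (preimageBase_mem hw)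
  have hU := hφ.U_u_ne_zero (preimageBase_mem hw)
  rw [specialLiftMap, jet_specialLiftMapInv, base_specialProlongationInv,
    hφ.specialProlongation_specialProlongationInv hw]
  refine Ext.ofJet_jet ?_ ?_ <;>
    simp only [specialLiftMapInv, Ext.ofJet, transformF, transformG, Matrix.cons_val]
  · field_simp
  · field_simp
    ring

theorem image_specialLiftMap_graph (hdom : ∀ j ∈ θ.dom, j.base ∈ φ.toMap.source) :
    φ.specialLiftMap '' θ.graph = (hφ.imageElements θ).graph := by
  refine Set.Subset.antisymm (Set.image_subset_iff.2 ?_) ?_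
  · rintro w ⟨hw, h8, h9⟩
    have hz := hdom _ hw
    refine ArbitraryElements.ofJet_mem_graph_iff.2 ⟨?_, ?_, ?_⟩
    · exact (hφ.specialProlongation_mem_imageElements_dom_iff hz).2 hw
    · rw [hφ.imageElements_f hz, h8]
    · rw [hφ.imageElements_g hz, h8, h9]
  · rintro w ⟨⟨htarget, hmem⟩, h8, h9⟩
    refine ⟨Ext.ofJet _ _ _, ArbitraryElements.ofJet_mem_graph_iff.2 ⟨hmem, rfl, rfl⟩, ?_⟩
    rw [specialLiftMap, Ext.jet_ofJet, base_specialProlongationInv,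
      hφ.specialProlongation_specialProlongationInv htarget]
    exact Ext.ofJet_jet h8 h9

theorem contDiffOn_specialLiftMap :
    ContDiffOn ℝ ∞ φ.specialLiftMap ((fun w : Ext => w.jet.base) ⁻¹' φ.toMap.source) := by
  have hprolongation : ContDiffOn ℝ ∞ (fun w : Ext => φ.specialProlongation w.jet)
      ((fun w : Ext => w.jet.base) ⁻¹' φ.toMap.source) :=
    hφ.contDiffOn_specialProlongation.comp contDiff_jet.contDiffOn fun _ hw => hw
  have hbase := (contDiff_base.comp contDiff_jet).contDiffOn
    (s := (fun w : Ext => w.jet.base) ⁻¹' φ.toMap.source)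
  have coord (i : Fin 10) := (contDiff_apply (n := ∞) ℝ ℝ i).contDiffOn
    (s := (fun w : Ext => w.jet.base) ⁻¹' φ.toMap.source)
  have hmaps : Set.MapsTo (fun w : Ext => w.jet.base)
    ((fun w : Ext => w.jet.base) ⁻¹' φ.toMap.source) φ.toMap.source := fun _ hw => hw
  exact contDiffOn_ofJet hprolongation (hφ.contDiffOn_transformF hbase hmaps (coord 8))
    (hφ.contDiffOn_transformG hbase hmaps (contDiffOn_pi.1 hprolongation 4) (coord 8) (coord 9))

theorem contDiffOn_specialLiftMapInv :
    ContDiffOn ℝ ∞ φ.specialLiftMapInv ((fun w : Ext => w.jet.base) ⁻¹' φ.toMap.target) := by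
  set A := (fun w : Ext => w.jet.base) ⁻¹' φ.toMap.target
  have comp {h : Base → ℝ} (hh : ContDiffOn ℝ ∞ h φ.toMap.source) :
      ContDiffOn ℝ ∞ (fun w : Ext => h (φ.preimageBase w.jet)) A :=
    (contDiffOn_comp_preimageBase hh).comp contDiff_jet.contDiffOn fun _ hw => hw
  have hinv : ContDiffOn ℝ ∞ (fun w : Ext => φ.specialProlongationInv w.jet) A :=
    hφ.contDiffOn_specialProlongationInv.comp contDiff_jet.contDiffOn fun _ hw => hw
  have coord (i : Fin 10) := (contDiff_apply (n := ∞) ℝ ℝ i).contDiffOn (s := A)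
  have ux : ContDiffOn ℝ ∞ (fun w : Ext => w.jet 4) A :=
    (contDiff_pi.1 contDiff_jet 4).contDiffOn
  have smooth_pd (i k : Fin 3) := contDiffOn_pd (φ.contDiffOn_component k) φ.toMap.open_source i
  have comp_pd (i k : Fin 3) := comp (smooth_pd i k)
  have comp_pd_pd (i k : Fin 3) := comp (contDiffOn_pd (smooth_pd i k) φ.toMap.open_source i)
  have hX (w : Ext) (hw : w ∈ A) := hφ.X_x_ne_zero (preimageBase_mem (j := w.jet) hw)
  have hU (w : Ext) (hw : w ∈ A) := hφ.U_u_ne_zero (preimageBase_mem (j := w.jet) hw)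
  have hf := ((coord 8).mul ((comp_pd 0 0).pow 2)).div ((comp_pd 1 1).pow 2)
    fun w hw => pow_ne_zero 2 (hX w hw)
  exact contDiffOn_ofJet hinv hf (((((coord 9).mul ((comp_pd 0 0).pow 2)).sub
    (comp_pd_pd 0 2)).add (hf.mul ((comp_pd_pd 1 2).sub (ux.mul (comp_pd_pd 1 1))))).div
    (comp_pd 2 2) hU)

/-- `specialLiftMap φ` as a point transformation of the space of jets and arbitrary elements. -/
noncomputable def specialLift : PointTransformation 10 where
  toMap :=
    { toFun := φ.specialLiftMap
      invFun := φ.specialLiftMapInv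
      source := (fun w : Ext => w.jet.base) ⁻¹' φ.toMap.source
      target := (fun w : Ext => w.jet.base) ⁻¹' φ.toMap.target
      map_source' := fun w hw => by
        rw [Set.mem_preimage, jet_specialLiftMap, base_specialProlongation]
        exact φ.toMap.map_source hw
      map_target' := fun w hw => by
        rw [Set.mem_preimage, jet_specialLiftMapInv, base_specialProlongationInv]
        exact preimageBase_mem hw
      left_inv' := fun _ hw => hφ.specialLiftMapInv_specialLiftMap hw
      right_inv' := fun _ hw => hφ.specialLiftMap_specialLiftMapInv hw
      open_source := φ.toMap.open_source.preimage continuous_base_jet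
      open_target := φ.toMap.open_target.preimage continuous_base_jet
      continuousOn_toFun := hφ.contDiffOn_specialLiftMap.continuousOn
      continuousOn_invFun := hφ.contDiffOn_specialLiftMapInv.continuousOn }
  smooth := hφ.contDiffOn_specialLiftMap
  smooth_symm := hφ.contDiffOn_specialLiftMapInv

theorem isContactLiftOf_specialLift : IsContactLiftOf hφ.specialLift φ := by
  refine ⟨Set.Subset.antisymm (fun z hz => ?_) (Set.image_subset_iff.2 fun _ hw => hw),
    fun w hw => (hφ.prolongs_iff hw).2 jet_specialLiftMap⟩
  have hbase : (Ext.ofJet ![z 0, z 1, z 2, 0, 0, 0, 0, 0] 0 0).jet.base = z := by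
    ext k; fin_cases k <;> rfl
  exact ⟨_, show Jet.base _ ∈ φ.toMap.source from hbase.symm ▸ hz, hbase⟩

end IsSpecial

end PointTransformation

section

variable {φ : PointTransformation 3} {θ θ' : ArbitraryElements}

theorem PointTransformation.IsSpecial.exists_image (hφ : φ.IsSpecial) {Φ : PointTransformation 10}
    (hΦ : ∀ w ∈ Φ.toMap.source, w 8 ≠ 0 → Φ.toMap w = φ.specialLiftMap w)
    (hbase : ∀ w ∈ Φ.toMap.source, (Ext.jet w).base ∈ φ.toMap.source)
    (hθ : θ ∈ waveClass) (hgraph : θ.graph ⊆ Φ.toMap.source) :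
    ∃ θ' ∈ waveClass, ActsTo Φ θ θ' ∧ MapsEquation φ θ θ' := by
  have hdom (j) (hj : j ∈ θ.dom) : j.base ∈ φ.toMap.source := by
    have := hbase _ (hgraph (ArbitraryElements.ofJet_mem_graph_iff.2 ⟨hj, rfl, rfl⟩))
    rwa [Ext.jet_ofJet] at this
  refine ⟨hφ.imageElements θ, hφ.imageElements_mem_waveClass hθ, ⟨hgraph, ?_⟩,
    hφ.mapsEquation_imageElements hdom⟩
  rw [← hφ.image_specialLiftMap_graph hdom]
  refine Set.image_congr fun w hw => hΦ w (hgraph hw) ?_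
  rw [hw.2.1]
  exact hθ.2.2.1 _ hw.1

namespace SubclassMap

variable (H : SubclassMap φ θ θ')
include H

theorem eq_transform {j j' : Jet} (hj : j ∈ θ.dom) (hp : Prolongs φ.toMap j j') :
    j' ∈ θ'.dom ∧ θ'.f j' = φ.transformF j.base (θ.f j) ∧
      θ'.g j' = φ.transformG j.base (j' 4) (θ.f j) (θ.g j) := by
  obtain ⟨-, rfl⟩ := prolongs_iff.1 hp
  have hT := pow_ne_zero 2 (H.T_t_ne_zero hj)
  have hmem := H.firstProlongation_mem hj
  have e := eqOffSecondDerivatives_secondProlongation (φ := φ.toMap) (j := j)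
  refine ⟨θ'.free_dom _ hmem _ e, ?_, ?_⟩
  · rw [H.isXUx_f'.eq_of_eqOffSecondDerivatives θ'.isOpen_dom θ'.free_dom hmem e,
      PointTransformation.transformF, eq_div_iff hT, H.f_transform hj]
  · rw [H.isXUx_g'.eq_of_eqOffSecondDerivatives θ'.isOpen_dom θ'.free_dom hmem e,
      PointTransformation.transformG, eq_div_iff hT, H.g_transform hj]
    rfl

theorem specialProlongation_eq_transform (hφ : φ.IsSpecial) {j : Jet} (hj : j ∈ θ.dom) :
    φ.specialProlongation j ∈ θ'.dom ∧
      θ'.f (φ.specialProlongation j) = φ.transformF j.base (θ.f j) ∧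
      θ'.g (φ.specialProlongation j)
        = φ.transformG j.base (φ.specialProlongation j 4) (θ.f j) (θ.g j) :=
  H.eq_transform hj ((hφ.prolongs_iff (H.maps.1 j hj)).2 rfl)

theorem image_specialProlongation_dom (hφ : φ.IsSpecial) :
    φ.specialProlongation '' θ.dom = θ'.dom := by
  refine Set.Subset.antisymm
    (Set.image_subset_iff.2 fun j hj => (H.specialProlongation_eq_transform hφ hj).1) ?_
  intro j' hj'
  obtain ⟨k, hk, -, e⟩ := H.maps.exists_preimage H.mem'.1 hj'
  have hsource := H.maps.1 k hk
  have e' : EqOffSecondDerivatives (φ.specialProlongation k) j' := fun i hi => by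
    rw [e i hi, ← eqOffSecondDerivatives_secondProlongation i hi, hφ.secondProlongation_eq hsource]
  have htarget : j'.base ∈ φ.toMap.target := by
    rw [e'.base_eq, PointTransformation.base_specialProlongation]
    exact φ.toMap.map_source hsource
  have einv := PointTransformation.eqOffSecondDerivatives_specialProlongationInv (φ := φ) e'
  rw [hφ.specialProlongationInv_specialProlongation hsource] at einv
  exact ⟨φ.specialProlongationInv j', θ.free_dom k hk _ einv,
    hφ.specialProlongation_specialProlongationInv htarget⟩

theorem image_specialLiftMap_graph (hφ : φ.IsSpecial) :
    φ.specialLiftMap '' θ.graph = θ'.graph := by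
  refine Set.Subset.antisymm (Set.image_subset_iff.2 ?_) ?_
  · rintro w ⟨hw, h8, h9⟩
    obtain ⟨hmem, hf, hg⟩ := H.specialProlongation_eq_transform hφ hw
    exact ArbitraryElements.ofJet_mem_graph_iff.2 ⟨hmem, by rw [hf, h8], by rw [hg, h8, h9]⟩
  · rintro w ⟨hw, h8, h9⟩
    obtain ⟨j, hj, hjw⟩ := (H.image_specialProlongation_dom hφ).ge hw
    obtain ⟨-, hf, hg⟩ := H.specialProlongation_eq_transform hφ hj
    refine ⟨Ext.ofJet j (θ.f j) (θ.g j),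
      ArbitraryElements.ofJet_mem_graph_iff.2 ⟨hj, rfl, rfl⟩, ?_⟩
    rw [PointTransformation.specialLiftMap, Ext.jet_ofJet, hjw]
    rw [hjw] at hf hg
    exact Ext.ofJet_jet (h8.trans hf) (h9.trans hg)

end SubclassMap

end

namespace PointTransformation

/-- The restriction of a point transformation to an open set. -/
def restrict {n : ℕ} (φ : PointTransformation n) {A : Set (Fin n → ℝ)} (hA : IsOpen A) :
    PointTransformation n where
  toMap := φ.toMap.restrOpen A hA
  smooth := φ.smooth.mono fun _ hz => hz.1
  smooth_symm := φ.smooth_symm.mono fun _ hz => hz.1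

variable {φ : PointTransformation 3} {θ : ArbitraryElements}

theorem source_restrict_baseDom (hmaps : ∀ j ∈ θ.dom, j.base ∈ φ.toMap.source) :
    (φ.restrict θ.isOpen_baseDom).toMap.source = θ.baseDom :=
  Set.inter_eq_right.2 (Set.image_subset_iff.2 hmaps)

theorem freeInSecondDerivatives_source_specialLift (hφ : φ.IsSpecial) :
    FreeInSecondDerivatives hφ.specialLift.toMap.source := by
  intro w (hw : (Ext.jet w).base ∈ φ.toMap.source) w' h
  have hbase : (Ext.jet w').base = (Ext.jet w).base := by
    ext k
    fin_cases k
    exacts [h 0 (by simp), h 1 (by simp), h 2 (by simp)]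
  exact (congrArg (· ∈ φ.toMap.source) hbase).mpr hw

theorem IsSpecial.isEquivalenceTransformation_specialLift (hφ : φ.IsSpecial) :
    IsEquivalenceTransformation waveSubclass hφ.specialLift φ := by
  refine ⟨freeInSecondDerivatives_source_specialLift hφ, hφ.isContactLiftOf_specialLift,
    fun η hη hgraph => ?_⟩
  obtain ⟨η', hη', hact, hm⟩ := hφ.exists_image (Φ := hφ.specialLift) (fun _ _ _ => rfl)
    (fun _ hw => hw) hη.1 hgraph
  exact ⟨η', mem_waveSubclass_of_admissible ⟨hη.1, hη', hm⟩ hη, hact, hm⟩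

end PointTransformation

theorem SubclassMap.restrict {φ : PointTransformation 3} {θ θ' : ArbitraryElements}
    (H : SubclassMap φ θ θ') : SubclassMap (φ.restrict θ.isOpen_baseDom) θ θ' where
  mem := H.mem
  mem' := H.mem'
  maps := ⟨fun j hj => ⟨H.maps.1 j hj, θ.base_mem_baseDom hj⟩, H.maps.2⟩

theorem normalized_waveSubclass : Normalized waveSubclass := by
  intro θ θ' φ ⟨hθ, hθ', hm⟩
  have H : SubclassMap _ θ θ' := SubclassMap.restrict ⟨hθ, hθ', hm⟩
  have hsource := PointTransformation.source_restrict_baseDom hm.1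
  have hψ : (φ.restrict θ.isOpen_baseDom).IsSpecial := fun z hz => H.isSpecialAt (hsource ▸ hz)
  exact ⟨hψ.specialLift, ⟨_, hψ.isEquivalenceTransformation_specialLift⟩, _,
    hψ.isContactLiftOf_specialLift,
    ⟨fun w hw => H.maps.1 _ hw.1, H.image_specialLiftMap_graph hψ⟩, fun _ _ => rfl⟩

section QuadraticElements

variable {A : Set Ext} (hA : IsOpen A) (hfree : FreeInSecondDerivatives A) (w : Ext)

/-- The equation with constant `f` and with `g` quadratic in `u_x` whose graph passes through the
point `w`, restricted so that its graph is contained in `A`. -/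
noncomputable def quadraticElements : ArbitraryElements where
  dom := (fun j : Jet => Ext.ofJet j (w 8) (w 9 + (j 4 - w 4) ^ 2)) ⁻¹' A
  isOpen_dom := by
    have hg : ContDiffOn ℝ ∞ (fun j : Jet => w 9 + (j 4 - w 4) ^ 2) Set.univ := by fun_prop
    exact hA.preimage (continuousOn_univ.1
      (contDiffOn_ofJet contDiffOn_id contDiffOn_const hg).continuousOn)
  free_dom := by
    intro j hj k (h : EqOffSecondDerivatives j k)
    have hux : k 4 = j 4 := h 4 (by simp)
    rw [Set.mem_preimage, hux]
    exact hfree _ hj _ (h.ofJet _ _)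
  f := fun _ => w 8
  g := fun j => w 9 + (j 4 - w 4) ^ 2
  smooth_f := contDiffOn_const
  smooth_g := by fun_prop

theorem graph_quadraticElements_subset : (quadraticElements hA hfree w).graph ⊆ A := by
  rintro v ⟨hv, h8, h9⟩
  have hv_eq : Ext.ofJet v.jet (w 8) (w 9 + (v.jet 4 - w 4) ^ 2) = v := Ext.ofJet_jet h8 h9
  exact hv_eq ▸ hv

variable {w}

theorem mem_graph_quadraticElements (hw : w ∈ A) : w ∈ (quadraticElements hA hfree w).graph := by
  have h9 : w 9 = w 9 + (w.jet 4 - w 4) ^ 2 := by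
    rw [show w.jet 4 = w 4 from rfl]
    ring
  refine ⟨?_, rfl, h9⟩
  change Ext.ofJet w.jet (w 8) (w 9 + (w.jet 4 - w 4) ^ 2) ∈ A
  rwa [Ext.ofJet_jet rfl h9]

theorem isXUx_quadraticElements_g :
    IsXUx (quadraticElements hA hfree w).dom (quadraticElements hA hfree w).g :=
  isXUx_of_hasPd (quadraticElements hA hfree w).isOpen_dom (quadraticElements hA hfree w).smooth_g
    fun _ _ _ _ h4 => ((hasPd_const _).add
      (((hasPd_coord_of_ne (Ne.symm h4)).sub (hasPd_const _)).sq)).congr_deriv (by ring)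

theorem quadraticElements_g_uxux (j : Jet) :
    pd 4 (pd 4 (quadraticElements hA hfree w).g) j = 2 := by
  have hg_ux : pd 4 (quadraticElements hA hfree w).g = fun j => 2 * (j 4 - w 4) := funext fun j =>
    HasPd.pd_eq
      (((hasPd_const _).add ((hasPd_coord_self.sub (hasPd_const _)).sq)).congr_deriv (by ring))
      (by change DifferentiableAt ℝ (fun j : Jet => w 9 + (j 4 - w 4) ^ 2) j; fun_prop)
  rw [hg_ux]
  exact (((hasPd_coord_self.sub (hasPd_const _)).const_mul 2).congr_deriv (by ring)).pd_eq
    (by fun_prop)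

theorem quadraticElements_mem_waveSubclass (h8 : w 8 ≠ 0) :
    quadraticElements hA hfree w ∈ waveSubclass := by
  have hf (i : Fin 8) (j : Jet) : pd i (quadraticElements hA hfree w).f j = 0 :=
    (hasPd_const (w 8)).pd_eq (differentiableAt_const _)
  refine ⟨⟨fun j _ => ⟨hf _ j, hf _ j, hf _ j, hf _ j, hf _ j, hf _ j⟩,
    (isXUx_quadraticElements_g hA hfree).dep, fun _ _ => h8,
    fun V _ _ ⟨j, hj⟩ => ⟨j, hj, ?_⟩⟩, fun j _ => hf _ j, fun V _ _ ⟨j, hj⟩ => ⟨j, hj, ?_⟩⟩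
  · rw [quadraticElements_g_uxux]
    simp
  · rw [quadraticElements_g_uxux]
    exact two_ne_zero

end QuadraticElements

namespace IsEquivalenceTransformation

variable {Φ : PointTransformation 10} {φ : PointTransformation 3} {w : Ext}

theorem base_mem_source {S : Set ArbitraryElements} (hΦ : IsEquivalenceTransformation S Φ φ)
    (hw : w ∈ Φ.toMap.source) : w.jet.base ∈ φ.toMap.source :=
  hΦ.2.1.1 ▸ Set.mem_image_of_mem _ hw

variable (hΦ : IsEquivalenceTransformation waveSubclass Φ φ)
include hΦ

theorem exists_subclassMap (hw : w ∈ Φ.toMap.source) (h8 : w 8 ≠ 0) :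
    ∃ θ θ', w ∈ θ.graph ∧ SubclassMap φ θ θ' ∧ ActsTo Φ θ θ' := by
  have hA := Φ.toMap.open_source
  have hmem := quadraticElements_mem_waveSubclass hA hΦ.1 h8
  obtain ⟨θ', hθ', hact, hm⟩ := hΦ.2.2 _ hmem (graph_quadraticElements_subset hA hΦ.1 w)
  exact ⟨_, θ', mem_graph_quadraticElements hA hΦ.1 hw, ⟨hmem, hθ', hm⟩, hact⟩

theorem isSpecial : φ.IsSpecial := by
  intro z hz
  rw [hΦ.2.1.1] at hz
  obtain ⟨w, hw, rfl⟩ := hz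
  obtain ⟨v, hv, h8, hjet⟩ : ∃ v ∈ Φ.toMap.source, v 8 ≠ 0 ∧ Ext.jet v = Ext.jet w := by
    by_cases h8 : w 8 = 0
    · obtain ⟨s, hs, hmem⟩ := exists_coord_line_mem Φ.toMap.open_source hw 8
      refine ⟨_, hmem, by simpa [h8] using hs, ?_⟩
      ext k
      fin_cases k <;> simp [Ext.jet, Fin.ext_iff]
    · exact ⟨w, hw, h8, rfl⟩
  obtain ⟨θ, θ', hgraph, H, -⟩ := hΦ.exists_subclassMap hv h8
  have hbase := H.isSpecialAt (ArbitraryElements.base_mem_baseDom hgraph.1)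
  rwa [hjet] at hbase

theorem eq_specialLiftMap (hw : w ∈ Φ.toMap.source) (h8 : w 8 ≠ 0) :
    Φ.toMap w = φ.specialLiftMap w := by
  obtain ⟨θ, θ', hgraph, H, hact⟩ := hΦ.exists_subclassMap hw h8
  have hp := hΦ.2.1.2 w hw
  obtain ⟨-, hf, hg⟩ := H.eq_transform hgraph.1 hp
  have himage : Φ.toMap w ∈ θ'.graph := hact.2 ▸ Set.mem_image_of_mem _ hgraph
  rw [hΦ.isSpecial.prolongs_iff (hΦ.base_mem_source hw)] at hp
  rw [← himage.2.1, ← hgraph.2.1] at hf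
  rw [← himage.2.2, ← hgraph.2.1, ← hgraph.2.2] at hg
  rw [PointTransformation.specialLiftMap, ← hp]
  exact (Ext.ofJet_jet hf hg).symm

end IsEquivalenceTransformation

theorem isEquivalenceTransformation_waveSubclass_iff {Φ : PointTransformation 10}
    {φ : PointTransformation 3} : IsEquivalenceTransformation waveSubclass Φ φ ↔
      IsEquivalenceTransformation waveClass Φ φ := by
  refine ⟨fun hΦ => ⟨hΦ.1, hΦ.2.1, fun θ hθ hgraph => hΦ.isSpecial.exists_image
    (fun _ => hΦ.eq_specialLiftMap) (fun _ => hΦ.base_mem_source) hθ hgraph⟩, ?_⟩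
  rintro ⟨hfree, hlift, hall⟩
  refine ⟨hfree, hlift, fun θ hθ hgraph => ?_⟩
  obtain ⟨θ', hθ', hact, hm⟩ := hall θ hθ.1 hgraph
  exact ⟨θ', mem_waveSubclass_of_admissible ⟨hθ.1, hθ', hm⟩ hθ, hact, hm⟩

theorem equivalenceGroup_waveSubclass :
    equivalenceGroup waveSubclass = equivalenceGroup waveClass :=
  Set.ext fun _ => exists_congr fun _ => isEquivalenceTransformation_waveSubclass_iff

end WaveClass

theorem mainTheorem5 :
    (∀ θ θ' : WaveClass.ArbitraryElements, ∀ φ : WaveClass.PointTransformation 3,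
      (θ, θ', φ) ∈ WaveClass.admissibleTransformations WaveClass.waveClass →
      θ ∈ WaveClass.waveSubclass → θ' ∈ WaveClass.waveSubclass) ∧
    WaveClass.Normalized WaveClass.waveSubclass ∧
    WaveClass.equivalenceGroup WaveClass.waveSubclass =
      WaveClass.equivalenceGroup WaveClass.waveClass :=
  ⟨fun _ _ _ h hθ => WaveClass.mem_waveSubclass_of_admissible h hθ,
    WaveClass.normalized_waveSubclass, WaveClass.equivalenceGroup_waveSubclass⟩
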